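/- Conventions. $\mathbb{N}^{\mathbb{N}}$ is Baire space, $\langle q,p\rangle$ and $\langle p_0,p_1,\dots\rangle$ are the usual computable pairing and infinite tupling, and $\mathsf{U}\langle q,p\rangle=\mathsf{U}_q(p)$ is the universal function: $q$ lists (codes of) pairs $(v,w)$ of finite words, the digits $0,1,2$ being dummy symbols without influence on the list, and $\mathsf{U}_q(p)$ is the supremum of all $w$ listed together with a prefix $v$ of $p$ (undefined if this is not an infinite sequence). Multivalued partial functions are composed with $\mathrm{dom}(g\circ f)=\{x\in\mathrm{dom}(f): f(x)\subseteq\mathrm{dom}(g)\}$. For a problem $f:\subseteq\mathbb{N}^{\mathbb{N}}\rightrightarrows\mathbb{N}^{\mathbb{N}}$ let $\langle\mathrm{id}\times f\rangle\langle q,p\rangle=\{\langle q,r\rangle: r\in f(p)\}$ and $S_f:=\mathsf{U}\circ\langle \mathrm{id}\times f\rangle$. Define: - $f^\infty(q_0):=\{\langle q_0,q_1,\dots\rangle:(\forall i)\ q_{i+1}\in S_f(q_i)\}$, with $q_0\in\mathrm{dom}(f^\infty)$ iff all the sets $A_0=\{q_0\}$, $A_{i+1}=S_f(A_i)$ are contained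 in $\mathrm{dom}(S_f)$; - $f^\diamond(q_0)$ is the set of all $q_k$, $k\ge 0$, for which there are $q_1,\dots,q_{k-1}$ with $q_{i+1}\in S_f(q_i)$ and $q_i(0)\neq 0$ for all $i<k$, and $q_k(0)=0$; here $q_0\in\mathrm{dom}(f^\diamond)$ iff there is neither a finite run $q_0,\dots,q_k$ (that is, $q_{i+1}\in S_f(q_i)$ for $i<k$) with $q_i(0)\ne0$ for all $i\le k$ and $q_k\notin\mathrm{dom}(S_f)$, nor an infinite run $q_0,q_1,\dots$ with $q_i(0)\neq0$ for all $i$; - $f^{[0]}=\mathrm{id}$, $f^{[1]}=\langle\mathrm{id}\times f\rangle$, $f^{[n+1]}=\langle\mathrm{id}\times f\rangle\circ\mathsf{U}\circ f^{[n]}$ for $n\ge1$, and $f^\omega(p)=\langle f^{[0]}(p),f^{[1]}(p),f^{[2]}(p),\dots\rangle$ for all $p\in\bigcap_n\mathrm{dom}(f^{[n]})$; - $\widehat f\langle p_0,p_1,\dots\rangle=\{\langle q_0,q_1,\dots\rangle:(\forall i)\ q_i\in f(p_i)\}$. The set $\mathcal{D}$ of Turing degrees is represented by $\deg:\mathbb{N}^{\mathbb{N}}\to\mathcal{D}$,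 $p\mapsto\deg(p)$, and for a problem $f:\subseteq\mathcal{D}\rightrightarrows\mathcal{D}$ the operators are applied to its realizer version $f^{\mathrm r}(p)=\{q:\deg(q)\in f(\deg(p))\}$. Write $\le_{\mathrm W}$, $\le_{\mathrm{sW}}$, $\equiv_{\mathrm{sW}}$ for Weihrauch reducibility, strong Weihrauch reducibility and strong Weihrauch equivalence. Statement. There exists a sequence $(p_n)_{n\in\mathbb{N}}$ in $\mathbb{N}^{\mathbb{N}}$ with $p_{n+1}<_{\mathrm T}p_n$ for all $n$ and $\langle p_1,p_2,p_3,\dots\rangle<_{\mathrm T}p_0$. For every such sequence let $a_n:=\deg(p_n)$, let $0\in\mathcal{D}$ be the degree of the computable sequences, and let $f:\subseteq\mathcal{D}\rightrightarrows\mathcal{D}$ be the problem with $\mathrm{dom}(f)=\{0\}\cup\{a_n:n\in\mathbb{N}\}$ and \[ f(a_0)=\{a_0\},\qquad f(a_{n+1})=\{a_n\},\qquad f(0)=\{a_n:n\in\mathbb{N}\}. \] Then \[ f^\infty\not\le_{\mathrm W} f^\omega\quad\text{and}\quad f^\omega\equiv_{\mathrm{sW}}\widehat{f^\diamond}. \]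 Moreover $\widehat{f^\diamond}\le_{\mathrm{sW}}f^\infty$ and $f^\infty\not\le_{\mathrm W}\widehat{f^\diamond}$, so that for this $f$ the inverse limit is strictly stronger than the parallelized diamond. -/

import Mathlib

namespace Weihrauch

/-! ### Baire space, words, computable functions on Baire space -/

/-- Baire space. -/
abbrev Baire : Type := ℕ → ℕ

/-- The finite word `w` is a prefix of the infinite sequence `p`. -/
def IsPrefixOf (w : List ℕ) (p : Baire) : Prop :=
  ∀ (i : ℕ) (hi : i < w.length), w[i] = p i

/-- The infinite sequence `q` is the supremum, in the prefix order, of the set of words `S`. -/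
def IsSupOf (S : Set (List ℕ)) (q : Baire) : Prop :=
  (∀ w ∈ S, IsPrefixOf w q) ∧ ∀ n : ℕ, ∃ w ∈ S, n ≤ w.length

/-- A partial function on Baire space is computable if some computable monotone word function
approximates it on its domain. -/
def ComputableFun (F : Baire →. Baire) : Prop :=
  ∃ f : List ℕ → List ℕ, Computable f ∧ (∀ v w : List ℕ, v <+: w → f v <+: f w) ∧
    ∀ p q : Baire, q ∈ F p → IsSupOf {u | ∃ w, IsPrefixOf w p ∧ f w = u} q

/-- The pairing `⟨q, p⟩ = q(0) p(0) q(1) p(1) ...`. -/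
def pair (q p : Baire) : Baire := fun n => if n % 2 = 0 then q (n / 2) else p (n / 2)

/-- The first component of a pair: `first (pair q p) = q`. -/
def first (z : Baire) : Baire := fun n => z (2 * n)

/-- The second component of a pair: `second (pair q p) = p`. -/
def second (z : Baire) : Baire := fun n => z (2 * n + 1)

/-- The infinite tupling `⟨p 0, p 1, p 2, ...⟩`. -/
def tuple (p : ℕ → Baire) : Baire := fun n => p (Nat.unpair n).1 (Nat.unpair n).2

/-- The components of an infinite tuple: `component (tuple p) i = p i`. -/
def component (z : Baire) (i : ℕ) : Baire := fun k => z (Nat.pair i k)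

/-! ### Multivalued functions

A partial multivalued function from `X` to `Y` is a map `f : X → Set Y`; its domain is the set of
all `x` such that `f x` is nonempty. -/

/-- The domain of a partial multivalued function. -/
def dom {X Y : Type*} (f : X → Set Y) : Set X := {x | (f x).Nonempty}

/-- The composition `g ∘ f` of multivalued functions, whose domain consists of all `x ∈ dom f`
such that `f x ⊆ dom g`. -/
def comp {X Y Z : Type*} (g : Y → Set Z) (f : X → Set Y) : X → Set Z :=
  fun x => {z | f x ⊆ dom g ∧ ∃ y ∈ f x, z ∈ g y}

/-- The universal function `U⟨q, p⟩ = Φ_q(p)`, as a (single-valued, partial) multivalued function.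
The name `q` lists the pairs `(v, w)` of the graph of a word function, a pair being listed by its
code shifted by `3`, so that the digits `0`, `1`, `2` are dummy symbols. The value is the supremum
of all words `w` that are listed together with a prefix `v` of `p`. -/
def univ : Baire → Set Baire := fun z =>
  {r | IsSupOf {w | ∃ (v : List ℕ) (i : ℕ), IsPrefixOf v (second z) ∧
    first z i = Encodable.encode (v, w) + 3} r}

/-- The problem `⟨id × f⟩`, which maps `⟨q, p⟩` to all `⟨q, r⟩` with `r ∈ f p`. -/
def idTimes (f : Baire → Set Baire) : Baire → Set Baire := fun z =>
  {s | ∃ r ∈ f (second z), s = pair (first z) r}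

/-- One round of a loop on `f`, the problem `U ∘ ⟨id × f⟩`. -/
def step (f : Baire → Set Baire) : Baire → Set Baire := comp univ (idTimes f)

/-! ### The inverse limit -/

/-- The sets `A₀ = {q₀}` and `A_{i+1} = (U ∘ ⟨id × f⟩)(A_i)`. -/
def stage (f : Baire → Set Baire) (q₀ : Baire) : ℕ → Set Baire
  | 0 => {q₀}
  | i + 1 => {r | ∃ q ∈ stage f q₀ i, r ∈ step f q}

/-- The inverse limit `f^∞` of a problem `f` on Baire space. -/
def invLimit (f : Baire → Set Baire) : Baire → Set Baire := fun q₀ =>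
  {s | (∀ i, stage f q₀ i ⊆ dom (step f)) ∧
    ∃ q : ℕ → Baire, q 0 = q₀ ∧ (∀ i, q (i + 1) ∈ step f (q i)) ∧ s = tuple q}

/-! ### The diamond operator -/

/-- `q 0, ..., q k` is a finite run of the loop on `f` (only these values of `q` matter). -/
def IsFiniteRun (f : Baire → Set Baire) (k : ℕ) (q : ℕ → Baire) : Prop :=
  ∀ i < k, q (i + 1) ∈ step f (q i)

/-- `q 0, q 1, ...` is an infinite run of the loop on `f`. -/
def IsInfiniteRun (f : Baire → Set Baire) (q : ℕ → Baire) : Prop :=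
  ∀ i, q (i + 1) ∈ step f (q i)

/-- The finite run `q 0, ..., q k` is successful. -/
def IsSuccessful (k : ℕ) (q : ℕ → Baire) : Prop :=
  q k 0 = 0 ∧ ∀ i < k, q i 0 ≠ 0

/-- The finite run `q 0, ..., q k` stalls. -/
def Stalls (f : Baire → Set Baire) (k : ℕ) (q : ℕ → Baire) : Prop :=
  q k ∉ dom (step f) ∧ ∀ i ≤ k, q i 0 ≠ 0

/-- The domain of the diamond operator: no run from `q₀` stalls or is infinite and unsuccessful. -/
def diamondDom (f : Baire → Set Baire) : Set Baire :=
  {q₀ | (∀ (k : ℕ) (q : ℕ → Baire), q 0 = q₀ → IsFiniteRun f k q → ¬ Stalls f k q) ∧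
    ∀ q : ℕ → Baire, q 0 = q₀ → IsInfiniteRun f q → ¬ ∀ i, q i 0 ≠ 0}

/-- The diamond operator `f^⋄` applied to a problem `f` on Baire space. -/
def diamond (f : Baire → Set Baire) : Baire → Set Baire := fun q₀ =>
  {r | q₀ ∈ diamondDom f ∧ ∃ (k : ℕ) (q : ℕ → Baire),
    q 0 = q₀ ∧ IsFiniteRun f k q ∧ IsSuccessful k q ∧ r = q k}

/-! ### Parallelization and the omega operation -/

/-- The parallelization of `f`: a value on `⟨p₀, p₁, ...⟩` is any `⟨q₀, q₁, ...⟩`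
with `q_i ∈ f p_i` for all `i`. -/
def parallel (f : Baire → Set Baire) : Baire → Set Baire := fun z =>
  {s | ∃ q : ℕ → Baire, (∀ i, q i ∈ f (component z i)) ∧ s = tuple q}

/-- The repeated compositional products: `f^[0] = id`, `f^[1] = ⟨id × f⟩` and
`f^[n+1] = ⟨id × f⟩ ∘ U ∘ f^[n]` for `n ≥ 1`. -/
def power (f : Baire → Set Baire) : ℕ → Baire → Set Baire
  | 0 => fun p => {p}
  | 1 => idTimes f
  | n + 2 => comp (idTimes f) (comp univ (power f (n + 1)))

/-- The omega operation `f^ω(p) = ⟨f^[0](p), f^[1](p), f^[2](p), ...⟩`. -/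
def omega (f : Baire → Set Baire) : Baire → Set Baire := fun p =>
  {s | ∃ q : ℕ → Baire, (∀ n, q n ∈ power f n p) ∧ s = tuple q}

/-! ### Represented spaces and Weihrauch reducibility -/

/-- A represented space: a set `X` with a surjective partial map from Baire space onto `X`. -/
class RepresentedSpace (X : Type*) where
  /-- the representation of `X` -/
  rep : Baire →. X
  rep_surjective : ∀ x : X, ∃ p : Baire, x ∈ rep p

/-- Baire space is represented by the identity. -/
instance : RepresentedSpace Baire where
  rep := fun p => Part.some p
  rep_surjective := fun x => ⟨x, Part.mem_some x⟩

/-- `F` is a realizer of `f`: for every name `p` of some `x ∈ dom f`, the value `F p` is defined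
and is a name of some `y ∈ f x`. -/
def IsRealizer {X Y : Type*} [RepresentedSpace X] [RepresentedSpace Y]
    (F : Baire →. Baire) (f : X → Set Y) : Prop :=
  ∀ (p : Baire) (x : X), x ∈ RepresentedSpace.rep (X := X) p → x ∈ dom f →
    ∃ q ∈ F p, ∃ y ∈ RepresentedSpace.rep (X := Y) q, y ∈ f x

/-- The realizer version of `f`: the names of values of `f`, given a name of the input. -/
def realizerVersion {X Y : Type*} [RepresentedSpace X] [RepresentedSpace Y]
    (f : X → Set Y) : Baire → Set Baire := fun p =>
  {q | ∃ x ∈ RepresentedSpace.rep (X := X) p, ∃ y ∈ RepresentedSpace.rep (X := Y) q, y ∈ f x}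

/-- Weihrauch reducibility: there are computable `H`, `K` such that `H⟨id, G K⟩` realizes `f`
for every realizer `G` of `g`. -/
def WeihrauchLE {X Y Z W : Type*} [RepresentedSpace X] [RepresentedSpace Y]
    [RepresentedSpace Z] [RepresentedSpace W] (f : X → Set Y) (g : Z → Set W) : Prop :=
  ∃ H K : Baire →. Baire, ComputableFun H ∧ ComputableFun K ∧
    ∀ G : Baire →. Baire, IsRealizer G g →
      IsRealizer (fun p => (K p).bind fun k => (G k).bind fun r => H (pair p r)) f

/-- Strong Weihrauch reducibility: there are computable `H`, `K` such that `H G K` realizes `f`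
for every realizer `G` of `g`. -/
def StrongWeihrauchLE {X Y Z W : Type*} [RepresentedSpace X] [RepresentedSpace Y]
    [RepresentedSpace Z] [RepresentedSpace W] (f : X → Set Y) (g : Z → Set W) : Prop :=
  ∃ H K : Baire →. Baire, ComputableFun H ∧ ComputableFun K ∧
    ∀ G : Baire →. Baire, IsRealizer G g →
      IsRealizer (fun p => (K p).bind fun k => (G k).bind fun r => H r) f

/-- Strong Weihrauch equivalence. -/
def StrongWeihrauchEquiv {X Y Z W : Type*} [RepresentedSpace X] [RepresentedSpace Y]
    [RepresentedSpace Z] [RepresentedSpace W] (f : X → Set Y) (g : Z → Set W) : Prop :=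
  StrongWeihrauchLE f g ∧ StrongWeihrauchLE g f

/-! ### Turing degrees -/

/-- Turing reducibility of elements of Baire space. -/
def TuringLE (p q : Baire) : Prop :=
  TuringReducible (fun n => Part.some (p n)) (fun n => Part.some (q n))

/-- Strict Turing reducibility of elements of Baire space. -/
def TuringLT (p q : Baire) : Prop := TuringLE p q ∧ ¬ TuringLE q p

instance : IsPreorder Baire TuringLE where
  refl _ := TuringReducible.refl _
  trans _ _ _ := TuringReducible.trans

/-- The Turing degrees of (total) elements of Baire space, that is, the equivalence classes with
respect to mutual Turing reducibility. -/
abbrev Degree : Type := Antisymmetrization Baire TuringLE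

/-- The Turing degree of an element of Baire space. -/
def deg (p : Baire) : Degree := toAntisymmetrization TuringLE p

/-- The set of Turing degrees is represented by `deg`. -/
instance : RepresentedSpace Degree where
  rep := fun p => Part.some (deg p)
  rep_surjective := fun x => by
    obtain ⟨p, rfl⟩ := Quotient.exists_rep x
    exact ⟨p, Part.mem_some _⟩

/-! ### The problem -/

/-- A strictly descending sequence with respect to Turing reducibility whose first member is
strictly above the tuple of all the others. -/
def IsDescendingSequence (p : ℕ → Baire) : Prop :=
  (∀ n, TuringLT (p (n + 1)) (p n)) ∧ TuringLT (tuple fun n => p (n + 1)) (p 0)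

/-- The problem on Turing degrees that, with `a n = deg (p n)`, maps `a 0` to `a 0`, maps
`a (n + 1)` to `a n`, maps the degree of the computable sequences to any of the `a n`, and is
undefined elsewhere. -/
def degreeProblem (p : ℕ → Baire) : Degree → Set Degree := fun a =>
  {b | (a = deg (p 0) ∧ b = deg (p 0)) ∨
    (∃ n, a = deg (p (n + 1)) ∧ b = deg (p n)) ∨
    (a = deg (fun _ => 0) ∧ ∃ n, b = deg (p n))}

end Weihrauch

-- Separation. Let `c` be the program that turns every answer of `f` into the next query. A run from
-- `⟨c, 0⟩` receives some `a_n`, then `a_{n-1}`, and so on up to `a_0`, so every value of `f^∞` on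
-- this computable input computes `p 0`. The components of `f^ω`, in contrast, may come from
-- unrelated runs, each of bounded length. For `f^[n+1]` on a computable input the answers can be
-- chosen with the one in round `i` below `p (n+1-i)`, hence all below `P = ⟨p 1, p 2, …⟩`, which
-- does not compute `p 0`. The join of infinitely many such answers need not lie below `P`, but a
-- Turing degree does not fix any finite prefix, so a finite extension argument
-- (`exists_tuple_not_turingLE`) chooses answers whose tuple does not compute `p 0`. The value of
-- `f^ω` is computable from the answers (`tuple_turingLE_tuple_answers`). A realizer of `f^ω` that
-- takes such values on computable inputs defeats every reduction (`not_invLimit_le_omega`).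
--
-- Equivalence. `f^ω` reduces to the parallelized diamond for every `f`: the `n`-th diamond runs the
-- loop with a counter. For the converse, a successful run of a diamond depends only on finite
-- prefixes of its answers, and such prefixes can be found computably in advance. Since answers of
-- `f` may be overwritten at finitely many places, the loops can be forced to follow these prefixes.
-- Their lengths are then known beforehand, so one infinite loop executes all of them in turn
-- (`parallel_diamond_le_omega`); `f 0 ≠ ∅` supplies an admissible query for the rounds between two
-- loops. Finally `f^ω` reduces to `f^∞` for every `f`, by recording the history.
--
-- All these loops need a state that contains its own program: `exists_program` provides programs
-- with memory that reproduce themselves with an updated memory. Computability on Baire space and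
-- Turing reducibility are both reduced to digitwise approximations on finite words.
--
-- Existence of the sequence. By Baire category there is `x` none of whose columns is computable
-- from the later ones; take `p n` to be the columns from `n` on.

attribute [fun_prop] Computable

namespace Weihrauch

/-! ### Lists of values and bounded search -/

section BoundedSearch

variable {β σ : Type*}

/-- The list `f 0, ..., f (n - 1)`. -/
def listOf (f : ℕ → σ) (n : ℕ) : List σ := (List.range n).map f

theorem listOf_eq_rec (f : ℕ → σ) (n : ℕ) :
    listOf f n = Nat.rec (motive := fun _ => List σ) [] (fun k l => l ++ [f k]) n := by
  induction n with
  | zero => rfl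
  | succ n ih => simp only [← ih]; simp [listOf, List.range_succ]

@[simp] theorem length_listOf (f : ℕ → σ) (n : ℕ) : (listOf f n).length = n := by simp [listOf]

theorem getElem?_listOf (f : ℕ → σ) (n i : ℕ) :
    (listOf f n)[i]? = if i < n then some (f i) else none := by
  simp only [listOf, List.getElem?_map]
  split_ifs with h <;> simp [h]

theorem foldl_eq_rec (f : σ → β → σ) (s : σ) (l : List β) :
    l.foldl f s = Nat.rec (motive := fun _ => σ) s
      (fun k t => (l[k]?).elim t (f t)) l.length := by
  induction l using List.reverseRecOn with
  | nil => rfl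
  | append_singleton l b ih =>
    have key : ∀ n ≤ l.length,
        (Nat.rec (motive := fun _ => σ) s (fun k t => ((l ++ [b])[k]?).elim t (f t)) n : σ) =
        Nat.rec (motive := fun _ => σ) s (fun k t => (l[k]?).elim t (f t)) n := by
      intro n hn
      induction n with
      | zero => rfl
      | succ n ihn =>
        simp only
        rw [ihn (by omega), List.getElem?_append_left (by omega)]
    simp [key l.length le_rfl, ih]

/-- The first defined value among `f 0, ..., f (n - 1)`. -/
def firstSome (f : ℕ → Option σ) : ℕ → Option σ
  | 0 => none
  | n + 1 => (firstSome f n).elim (f n) some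

theorem firstSome_spec {f : ℕ → Option σ} {n : ℕ} {m : σ} (h : firstSome f n = some m) :
    ∃ k < n, f k = some m ∧ ∀ j < k, f j = none := by
  induction n with
  | zero => simp [firstSome] at h
  | succ n ih =>
    rw [firstSome] at h
    rcases ho : firstSome f n with _ | o
    · refine ⟨n, by omega, by simpa [ho] using h, ?_⟩
      clear h ih
      induction n with
      | zero => simp
      | succ n ih =>
        rw [firstSome] at ho
        rcases hp : firstSome f n with _ | o
        · intro j hj
          rcases Nat.lt_succ_iff_lt_or_eq.1 hj with hj | rfl
          · exact ih hp j hj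
          · simpa [hp] using ho
        · simp [hp] at ho
    · obtain ⟨k, hk, h1⟩ := ih (by simpa [ho] using h)
      exact ⟨k, by omega, h1⟩

theorem firstSome_eq {f : ℕ → Option σ} {n k : ℕ} {m : σ} (hk : k < n) (h : f k = some m)
    (hj : ∀ j < k, f j = none) : firstSome f n = some m := by
  have hk0 : firstSome f k = none := by
    rcases ho : firstSome f k with _ | o
    · rfl
    · obtain ⟨l, hl, hl', -⟩ := firstSome_spec ho
      rw [hj l hl] at hl'; cases hl'
  induction n with
  | zero => omega
  | succ n ih =>
    rw [firstSome]
    rcases Nat.lt_succ_iff_lt_or_eq.1 hk with hk | rfl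
    · rw [ih hk]; rfl
    · rw [hk0]; exact h

theorem firstSome_isSome {f : ℕ → Option σ} {n k : ℕ} {m : σ} (hk : k < n) (h : f k = some m) :
    ∃ o, firstSome f n = some o := by
  classical
  have hex : ∃ k, ∃ m, f k = some m := ⟨k, m, h⟩
  obtain ⟨o, ho⟩ := Nat.find_spec hex
  refine ⟨o, firstSome_eq (lt_of_le_of_lt (Nat.find_min' hex ⟨m, h⟩) hk) ho fun j hj => ?_⟩
  rcases hf : f j with _ | x
  · rfl
  · exact absurd ⟨x, hf⟩ (Nat.find_min hex hj)

theorem firstSome_congr {f g : ℕ → Option σ} {n : ℕ} (h : ∀ k < n, f k = g k) :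
    firstSome f n = firstSome g n := by
  induction n with
  | zero => rfl
  | succ n ih => rw [firstSome, firstSome, ih fun k hk => h k (by omega), h n (by omega)]

theorem firstSome_mono {f : ℕ → Option σ} {n n' : ℕ} {m : σ} (hn : n ≤ n')
    (h : firstSome f n = some m) : firstSome f n' = some m := by
  obtain ⟨k, hk, h1, h2⟩ := firstSome_spec h
  exact firstSome_eq (by omega) h1 h2

end BoundedSearch

/-! ### A function calculus for computable functions -/

section ComputableCalculus

variable {α β γ σ τ : Type*} [Primcodable α] [Primcodable β] [Primcodable γ] [Primcodable σ]
  [Primcodable τ]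

@[fun_prop] theorem computable_id' : Computable (fun a : α => a) := Computable.id

@[fun_prop] theorem computable_const' (s : σ) : Computable (fun _ : α => s) := Computable.const s

@[fun_prop] theorem computable_comp' {f : β → σ} {g : α → β} (hf : Computable f)
    (hg : Computable g) : Computable (fun a => f (g a)) := hf.comp hg

@[fun_prop] theorem computable_fst' {f : α → β × γ} (hf : Computable f) :
    Computable (fun a => (f a).1) := Computable.fst.comp hf

@[fun_prop] theorem computable_snd' {f : α → β × γ} (hf : Computable f) :
    Computable (fun a => (f a).2) := Computable.snd.comp hf

@[fun_prop] theorem computable_prodMk {f : α → β} {g : α → γ} (hf : Computable f)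
    (hg : Computable g) : Computable (fun a => (f a, g a)) := hf.pair hg

@[fun_prop] theorem computable_add {f g : α → ℕ} (hf : Computable f) (hg : Computable g) :
    Computable (fun a => f a + g a) := Primrec.nat_add.to_comp.comp hf hg

@[fun_prop] theorem computable_mul {f g : α → ℕ} (hf : Computable f) (hg : Computable g) :
    Computable (fun a => f a * g a) := Primrec.nat_mul.to_comp.comp hf hg

@[fun_prop] theorem computable_sub {f g : α → ℕ} (hf : Computable f) (hg : Computable g) :
    Computable (fun a => f a - g a) := Primrec.nat_sub.to_comp.comp hf hg

@[fun_prop] theorem computable_div {f g : α → ℕ} (hf : Computable f) (hg : Computable g) :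
    Computable (fun a => f a / g a) := Primrec.nat_div.to_comp.comp hf hg

@[fun_prop] theorem computable_mod {f g : α → ℕ} (hf : Computable f) (hg : Computable g) :
    Computable (fun a => f a % g a) := Primrec.nat_mod.to_comp.comp hf hg

@[fun_prop] theorem computable_natPair {f g : α → ℕ} (hf : Computable f) (hg : Computable g) :
    Computable (fun a => Nat.pair (f a) (g a)) := Primrec₂.natPair.to_comp.comp hf hg

@[fun_prop] theorem computable_unpair' {f : α → ℕ} (hf : Computable f) :
    Computable (fun a => Nat.unpair (f a)) := Computable.unpair.comp hf

@[fun_prop] theorem computable_encode' {f : α → β} (hf : Computable f) :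
    Computable (fun a => Encodable.encode (f a)) := Computable.encode.comp hf

@[fun_prop] theorem computable_decode' {f : α → ℕ} (hf : Computable f) :
    Computable (fun a => (Encodable.decode (f a) : Option β)) := Computable.decode.comp hf

@[fun_prop] theorem computable_some' {f : α → β} (hf : Computable f) :
    Computable (fun a => some (f a)) := Computable.option_some.comp hf

@[fun_prop] theorem computable_optionBind {f : α → Option β} {g : α → β → Option σ}
    (hf : Computable f) (hg : Computable (fun p : α × β => g p.1 p.2)) :
    Computable (fun a => (f a).bind (g a)) :=
  Computable.option_bind hf hg

@[fun_prop] theorem computable_optionMap {f : α → Option β} {g : α → β → σ}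
    (hf : Computable f) (hg : Computable (fun p : α × β => g p.1 p.2)) :
    Computable (fun a => (f a).map (g a)) :=
  Computable.option_map hf hg

@[fun_prop] theorem computable_optionElim {f : α → Option β} {c : α → σ} {g : α → β → σ}
    (hf : Computable f) (hc : Computable c) (hg : Computable (fun p : α × β => g p.1 p.2)) :
    Computable (fun a => (f a).elim (c a) (g a)) :=
  (Computable.option_casesOn hf hc hg).of_eq fun a => by cases f a <;> rfl

@[fun_prop] theorem computable_optionGetD {f : α → Option β} {g : α → β}
    (hf : Computable f) (hg : Computable g) : Computable (fun a => (f a).getD (g a)) :=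
  Computable.option_getD hf hg

@[fun_prop] theorem computable_optionIsSome {f : α → Option β} (hf : Computable f) :
    Computable (fun a => (f a).isSome) := Primrec.option_isSome.to_comp.comp hf

@[fun_prop] theorem computable_natRec {f : α → ℕ} {g : α → σ} {h : α → ℕ → σ → σ}
    (hf : Computable f) (hg : Computable g)
    (hh : Computable (fun p : α × ℕ × σ => h p.1 p.2.1 p.2.2)) :
    Computable fun a => Nat.rec (motive := fun _ => σ) (g a) (fun y IH => h a y IH) (f a) :=
  Computable.nat_rec hf hg (h := fun a p => h a p.1 p.2) hh

@[fun_prop] theorem computable_getElem? {f : α → List β} {g : α → ℕ} (hf : Computable f)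
    (hg : Computable g) : Computable (fun a => (f a)[g a]?) :=
  Computable.list_getElem?.comp hf hg

@[fun_prop] theorem computable_length {f : α → List β} (hf : Computable f) :
    Computable (fun a => (f a).length) := Computable.list_length.comp hf

@[fun_prop] theorem computable_append {f g : α → List β} (hf : Computable f)
    (hg : Computable g) : Computable (fun a => f a ++ g a) :=
  Computable.list_append.comp hf hg

@[fun_prop] theorem computable_cons {f : α → β} {g : α → List β} (hf : Computable f)
    (hg : Computable g) : Computable (fun a => f a :: g a) :=
  Computable.list_cons.comp hf hg

@[fun_prop] theorem computable_take {f : α → ℕ} {g : α → List β} (hf : Computable f)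
    (hg : Computable g) : Computable (fun a => (g a).take (f a)) :=
  Primrec.list_take.to_comp.comp hf hg

@[fun_prop] theorem computable_drop {f : α → ℕ} {g : α → List β} (hf : Computable f)
    (hg : Computable g) : Computable (fun a => (g a).drop (f a)) :=
  Primrec.list_drop.to_comp.comp hf hg

@[fun_prop] theorem computable_cond {c : α → Bool} {f g : α → σ} (hc : Computable c)
    (hf : Computable f) (hg : Computable g) : Computable (fun a => bif c a then f a else g a) :=
  Computable.cond hc hf hg

@[fun_prop] theorem computable_beq [BEq β] [LawfulBEq β] {f g : α → β} (hf : Computable f)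
    (hg : Computable g) : Computable (fun a => f a == g a) := by
  classical
  exact (Primrec.beq.to_comp.comp hf hg).of_eq fun a => by
    rw [Bool.eq_iff_iff]; simp

@[fun_prop] theorem computable_ble {f g : α → ℕ} (hf : Computable f)
    (hg : Computable g) : Computable (fun a => Nat.ble (f a) (g a)) :=
  (Primrec.nat_le.decide.to_comp.comp hf hg).of_eq fun a => by
    rw [Bool.eq_iff_iff]; simp

@[fun_prop] theorem computable_and {f g : α → Bool} (hf : Computable f)
    (hg : Computable g) : Computable (fun a => f a && g a) :=
  Primrec.and.to_comp.comp hf hg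

@[fun_prop] theorem computable_or {f g : α → Bool} (hf : Computable f)
    (hg : Computable g) : Computable (fun a => f a || g a) :=
  Primrec.or.to_comp.comp hf hg

@[fun_prop] theorem computable_not {f : α → Bool} (hf : Computable f) :
    Computable (fun a => !f a) :=
  Primrec.not.to_comp.comp hf

@[fun_prop] theorem computable_listOf {f : α → ℕ → σ} {n : α → ℕ} (hn : Computable n)
    (hf : Computable (fun p : α × ℕ => f p.1 p.2)) :
    Computable (fun a => listOf (f a) (n a)) := by
  simp only [listOf_eq_rec]
  fun_prop

@[fun_prop] theorem computable_foldl {f : α → σ → β → σ} {s : α → σ} {l : α → List β}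
    (hf : Computable (fun p : α × σ × β => f p.1 p.2.1 p.2.2)) (hs : Computable s)
    (hl : Computable l) : Computable (fun a => (l a).foldl (f a) (s a)) := by
  simp only [foldl_eq_rec]
  have : Computable (fun p : (α × ℕ × σ) × β => f p.1.1 p.1.2.2 p.2) :=
    hf.comp (g := fun p : (α × ℕ × σ) × β => (p.1.1, p.1.2.2, p.2)) (by fun_prop)
  fun_prop

@[fun_prop] theorem computable_firstSome {f : α → ℕ → Option σ} {n : α → ℕ} (hn : Computable n)
    (hf : Computable (fun p : α × ℕ => f p.1 p.2)) :
    Computable (fun a => firstSome (f a) (n a)) := by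
  have h : ∀ (g : ℕ → Option σ) (n : ℕ), firstSome g n =
      Nat.rec (motive := fun _ => Option σ) none (fun k o => o.elim (g k) some) n := by
    intro g n
    induction n with
    | zero => rfl
    | succ n ih => simp only [firstSome, ih]
  simp only [h]
  have : Computable (fun p : α × ℕ × Option σ => f p.1 p.2.1) :=
    hf.comp (g := fun p : α × ℕ × Option σ => (p.1, p.2.1)) (by fun_prop)
  fun_prop

end ComputableCalculus

/-! ### Prefixes -/

theorem getElem?_of_prefix {α : Type*} {v w : List α} (h : v <+: w) {i : ℕ} {m : α}
    (hm : v[i]? = some m) : w[i]? = some m := by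
  obtain ⟨t, rfl⟩ := h
  obtain ⟨hi, -⟩ := List.getElem?_eq_some_iff.1 hm
  rwa [List.getElem?_append_left hi]

/-- The prefix of length `n` of `p`. -/
def pre (p : Baire) (n : ℕ) : List ℕ := listOf p n

@[simp] theorem length_pre (p : Baire) (n : ℕ) : (pre p n).length = n := length_listOf p n

theorem getElem?_pre (p : Baire) (n i : ℕ) : (pre p n)[i]? = if i < n then some (p i) else none :=
  getElem?_listOf p n i

theorem pre_getElem?_eq {p : Baire} {n i : ℕ} (h : i < n) : (pre p n)[i]? = some (p i) := by
  rw [getElem?_pre, if_pos h]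

theorem eq_of_pre_getElem? {p : Baire} {n i m : ℕ} (h : (pre p n)[i]? = some m) :
    i < n ∧ p i = m := by
  rw [getElem?_pre] at h
  split_ifs at h with hi
  exact ⟨hi, by simpa using h⟩

theorem isPrefixOf_iff_getElem? {w : List ℕ} {p : Baire} :
    IsPrefixOf w p ↔ ∀ i m, w[i]? = some m → p i = m := by
  constructor
  · intro h i m him
    obtain ⟨hi, rfl⟩ := List.getElem?_eq_some_iff.1 him
    exact (h i hi).symm
  · intro h i hi
    exact (h i _ (List.getElem?_eq_getElem hi)).symm

theorem isPrefixOf_pre (p : Baire) (n : ℕ) : IsPrefixOf (pre p n) p :=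
  isPrefixOf_iff_getElem?.2 fun _ _ h => (eq_of_pre_getElem? h).2

theorem IsPrefixOf.eq_pre {w : List ℕ} {p : Baire} (h : IsPrefixOf w p) : w = pre p w.length := by
  apply List.ext_getElem?
  intro i
  rw [getElem?_pre]
  split_ifs with hi
  · rw [List.getElem?_eq_getElem hi, h i hi]
  · simpa using hi

theorem pre_prefix_pre (p : Baire) {m n : ℕ} (h : m ≤ n) : pre p m <+: pre p n := by
  rw [List.prefix_iff_eq_take]
  apply List.ext_getElem?
  intro i
  rw [List.getElem?_take, getElem?_pre, getElem?_pre, length_pre]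
  split_ifs <;> first | rfl | omega

theorem IsPrefixOf.mono {v w : List ℕ} {p : Baire} (h : IsPrefixOf w p) (hv : v <+: w) :
    IsPrefixOf v p :=
  isPrefixOf_iff_getElem?.2 fun i m him =>
    isPrefixOf_iff_getElem?.1 h i m (getElem?_of_prefix hv him)

theorem take_pre (p : Baire) {m n : ℕ} (h : m ≤ n) : (pre p n).take m = pre p m := by
  have h1 : IsPrefixOf ((pre p n).take m) p := (isPrefixOf_pre p n).mono (List.take_prefix m _)
  have h2 := h1.eq_pre
  rwa [List.length_take, length_pre, min_eq_left h] at h2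

theorem IsPrefixOf.prefix_of_le {v w : List ℕ} {p : Baire} (hv : IsPrefixOf v p)
    (hw : IsPrefixOf w p) (h : v.length ≤ w.length) : v <+: w := by
  rw [hv.eq_pre, hw.eq_pre]
  exact pre_prefix_pre p h

@[simp] theorem pre_zero (p : Baire) : pre p 0 = [] := rfl

theorem pre_succ (p : Baire) (n : ℕ) : pre p (n + 1) = pre p n ++ [p n] := by
  simp [pre, listOf, List.range_succ]

theorem pre_congr {p q : Baire} {n : ℕ} (h : ∀ i < n, p i = q i) : pre p n = pre q n := by
  simp only [pre, listOf]
  exact List.map_congr_left fun i hi => h i (List.mem_range.1 hi)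

theorem IsSupOf.unique {S : Set (List ℕ)} {p q : Baire} (hp : IsSupOf S p) (hq : IsSupOf S q) :
    p = q := by
  funext i
  obtain ⟨w, hw, hl⟩ := hp.2 (i + 1)
  have h1 := hp.1 w hw i (by omega)
  have h2 := hq.1 w hw i (by omega)
  rw [← h1, ← h2]

/-! ### Words from partially known digits -/

/-- The longest word of length at most `n` all of whose digits are known. -/
def knownWord (h : ℕ → Option ℕ) : ℕ → List ℕ
  | 0 => []
  | n + 1 => bif (knownWord h n).length == n then
      (h n).elim (knownWord h n) fun m => knownWord h n ++ [m] else knownWord h n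

@[fun_prop] theorem computable_knownWord {α : Type*} [Primcodable α] {h : α → ℕ → Option ℕ}
    {n : α → ℕ} (hn : Computable n) (hh : Computable (fun p : α × ℕ => h p.1 p.2)) :
    Computable (fun a => knownWord (h a) (n a)) := by
  have key : ∀ (g : ℕ → Option ℕ) (n : ℕ), knownWord g n =
      Nat.rec (motive := fun _ => List ℕ) [] (fun k l => bif l.length == k then
        (g k).elim l fun m => l ++ [m] else l) n := by
    intro g n
    induction n with
    | zero => rfl
    | succ n ih => simp only [knownWord, ih]
  simp only [key]
  have : Computable (fun p : α × ℕ × List ℕ => h p.1 p.2.1) :=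
    hh.comp (g := fun p : α × ℕ × List ℕ => (p.1, p.2.1)) (by fun_prop)
  fun_prop

theorem knownWord_length_le (h : ℕ → Option ℕ) (n : ℕ) : (knownWord h n).length ≤ n := by
  induction n with
  | zero => simp [knownWord]
  | succ n ih =>
    rw [knownWord]
    rcases h n with _ | m <;> rcases hb : ((knownWord h n).length == n) with _ | _ <;>
      simp at hb ⊢ <;> omega

theorem knownWord_getElem? {h : ℕ → Option ℕ} {n i m : ℕ} (hi : (knownWord h n)[i]? = some m) :
    h i = some m := by
  induction n with
  | zero => simp [knownWord] at hi
  | succ n ih =>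
    rw [knownWord] at hi
    rcases hb : ((knownWord h n).length == n) with _ | _
    · rw [hb] at hi; exact ih hi
    · rw [hb] at hi
      have hl : (knownWord h n).length = n := by simpa using hb
      rcases hm : h n with _ | k
      · rw [hm] at hi; exact ih hi
      · rw [hm] at hi
        simp only [cond_true, Option.elim] at hi
        rcases lt_trichotomy i n with h1 | h1 | h1
        · rw [List.getElem?_append_left (by omega)] at hi; exact ih hi
        · subst h1
          rw [List.getElem?_append_right (by omega)] at hi
          simp [hl] at hi
          rw [hm, hi]
        · rw [List.getElem?_append_right (by omega)] at hi
          rw [List.getElem?_eq_none (by simp; omega)] at hi; cases hi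

theorem knownWord_length_eq {h : ℕ → Option ℕ} {n : ℕ} (hn : ∀ i < n, ∃ m, h i = some m) :
    (knownWord h n).length = n := by
  induction n with
  | zero => rfl
  | succ n ih =>
    obtain ⟨m, hm⟩ := hn n (by omega)
    have := ih fun i hi => hn i (by omega)
    rw [knownWord, hm]
    simp [this]

theorem knownWord_prefix {h h' : ℕ → Option ℕ} {n n' : ℕ} (hn : n ≤ n')
    (hh : ∀ i m, h i = some m → h' i = some m) : knownWord h n <+: knownWord h' n' := by
  set l := (knownWord h n).length with hl
  have h1 : ∀ i < l, ∃ m, h i = some m := fun i hi =>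
    ⟨_, knownWord_getElem? (List.getElem?_eq_getElem hi)⟩
  have h2 : ∀ k, l ≤ k → l ≤ (knownWord h' k).length := by
    intro k hk
    induction k with
    | zero => omega
    | succ k ih =>
      rcases Nat.lt_or_ge k l with hkl | hkl
      · rw [knownWord_length_eq]
        · exact hk
        · intro i hi
          obtain ⟨m, hm⟩ := h1 i (by omega)
          exact ⟨m, hh i m hm⟩
      · have := ih hkl
        rw [knownWord]
        rcases h' k with _ | m <;> rcases (knownWord h' k).length == k with _ | _ <;> simp <;> omega
  have hln : l ≤ n := knownWord_length_le h n
  have h3 := h2 n' (by omega)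
  rw [List.prefix_iff_getElem?]
  intro i hi
  have h4 : i < (knownWord h' n').length := by omega
  rw [List.getElem?_eq_getElem h4]
  have h5 := knownWord_getElem? (List.getElem?_eq_getElem h4)
  have h6 := hh _ _ (knownWord_getElem? (List.getElem?_eq_getElem hi))
  rw [← h5, h6]

theorem knownWord_isPrefixOf {h : ℕ → Option ℕ} {n : ℕ} {q : Baire}
    (hh : ∀ i m, h i = some m → q i = m) : IsPrefixOf (knownWord h n) q :=
  isPrefixOf_iff_getElem?.2 fun i m him => hh i m (knownWord_getElem? him)

/-! ### Digitwise approximations -/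

/-- The function `h`, given longer and longer prefixes of `p`, determines the digits of `q`. -/
def Approximates (h : List ℕ → ℕ → Option ℕ) (p q : Baire) : Prop :=
  (∀ n i m, h (pre p n) i = some m → q i = m) ∧ ∀ i, ∃ n m, h (pre p n) i = some m

/-- Values, once given, are kept on longer words. -/
def IsMonotoneApprox {α β : Type*} (h : List ℕ → α → Option β) : Prop :=
  ∀ u v : List ℕ, u <+: v → ∀ i m, h u i = some m → h v i = some m

/-- The digits found by `h` on prefixes of the given word. -/
def settle (h : List ℕ → ℕ → Option ℕ) (u : List ℕ) (i : ℕ) : Option ℕ :=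
  firstSome (fun n => h (u.take n) i) (u.length + 1)

theorem computable_settle {h : List ℕ → ℕ → Option ℕ}
    (hh : Computable (fun p : List ℕ × ℕ => h p.1 p.2)) :
    Computable (fun p : List ℕ × ℕ => settle h p.1 p.2) := by
  unfold settle
  have : Computable (fun p : (List ℕ × ℕ) × ℕ => h (p.1.1.take p.2) p.1.2) :=
    hh.comp (g := fun p : (List ℕ × ℕ) × ℕ => (p.1.1.take p.2, p.1.2)) (by fun_prop)
  fun_prop

/-- Prefixes are searched in order of length, and a longer word only adds candidates at the end, so
the first value found is never revised. -/
theorem settle_mono (h : List ℕ → ℕ → Option ℕ) : IsMonotoneApprox (settle h) := by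
  intro u v huv i m hm
  have hl := huv.length_le
  refine firstSome_mono (n := u.length + 1) (by omega) ?_
  rw [← hm]
  refine firstSome_congr fun k hk => ?_
  have : u.take k = v.take k := by
    obtain ⟨t, rfl⟩ := huv
    rw [List.take_append_of_le_length (by omega)]
  simp only [this]

theorem Approximates.settle {h : List ℕ → ℕ → Option ℕ} {p q : Baire} (H : Approximates h p q) :
    Approximates (settle h) p q := by
  constructor
  · intro n i m hm
    obtain ⟨k, hk, h1, -⟩ := firstSome_spec hm
    rw [length_pre] at hk
    rw [take_pre p (by omega)] at h1
    exact H.1 k i m h1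
  · intro i
    obtain ⟨n, m, hm⟩ := H.2 i
    refine ⟨n, firstSome_isSome (k := n) (m := m) (by simp) ?_⟩
    simpa [take_pre] using hm

theorem Approximates.eventually {h : List ℕ → ℕ → Option ℕ} {p q : Baire}
    (hm : IsMonotoneApprox h) (H : Approximates h p q) (i : ℕ) :
    ∃ N, ∀ n ≥ N, h (pre p n) i = some (q i) := by
  obtain ⟨N, m, h1⟩ := H.2 i
  refine ⟨N, fun n hn => ?_⟩
  rw [H.1 N i m h1]
  exact hm _ _ (pre_prefix_pre p hn) i m h1

theorem Approximates.eventually_lt {h : List ℕ → ℕ → Option ℕ} {p q : Baire}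
    (hm : IsMonotoneApprox h) (H : Approximates h p q) (l : ℕ) :
    ∃ N, ∀ n ≥ N, ∀ i < l, h (pre p n) i = some (q i) := by
  induction l with
  | zero => exact ⟨0, fun n _ i hi => by omega⟩
  | succ l ih =>
    obtain ⟨N, hN⟩ := ih
    obtain ⟨N', hN'⟩ := H.eventually hm l
    refine ⟨max N N', fun n hn i hi => ?_⟩
    rcases Nat.lt_succ_iff_lt_or_eq.1 hi with h1 | rfl
    · exact hN n (le_trans (le_max_left _ _) hn) i h1
    · exact hN' n (le_trans (le_max_right _ _) hn)

/-- A partial function all of whose values are approximated digitwise is computable. -/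
theorem ComputableFun.of_approximates {F : Baire →. Baire} {h : List ℕ → ℕ → Option ℕ}
    (hh : Computable (fun p : List ℕ × ℕ => h p.1 p.2))
    (H : ∀ p q, q ∈ F p → Approximates h p q) : ComputableFun F := by
  -- `settle` makes the approximation monotone; its known initial segments then form a monotone word
  -- function.
  have hs := computable_settle hh
  refine ⟨fun u => knownWord (settle h u) u.length, by fun_prop, fun v w hvw =>
    knownWord_prefix hvw.length_le fun i m => settle_mono h v w hvw i m, fun p q hq => ?_⟩
  have Hq := (H p q hq).settle
  constructor
  · rintro _ ⟨w, hw, rfl⟩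
    refine knownWord_isPrefixOf fun i m him => ?_
    rw [hw.eq_pre] at him
    exact Hq.1 _ i m him
  · intro l
    obtain ⟨N, hN⟩ := Hq.eventually_lt (settle_mono h) l
    refine ⟨_, ⟨pre p (max N l), isPrefixOf_pre _ _, rfl⟩, ?_⟩
    have := (knownWord_prefix (h := settle h (pre p (max N l))) (h' := settle h (pre p (max N l)))
      (n := l) (n' := (pre p (max N l)).length) (by simp) fun i m h => h).length_le
    rwa [knownWord_length_eq fun i hi => ⟨_, hN _ (le_max_left _ _) i hi⟩] at this

/-- The word function of a computable partial function, as a digitwise approximation. -/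
theorem ComputableFun.exists_approximates {F : Baire →. Baire} (hF : ComputableFun F) :
    ∃ h : List ℕ → ℕ → Option ℕ, Computable (fun p : List ℕ × ℕ => h p.1 p.2) ∧
      IsMonotoneApprox h ∧ ∀ p q, q ∈ F p → Approximates h p q := by
  obtain ⟨f, hf, hmono, hsup⟩ := hF
  refine ⟨fun u i => (f u)[i]?, by fun_prop, fun u v huv i m hm =>
    getElem?_of_prefix (hmono u v huv) hm, fun p q hq => ⟨fun n i m hm => ?_, fun i => ?_⟩⟩
  · exact isPrefixOf_iff_getElem?.1
      ((hsup p q hq).1 _ ⟨pre p n, isPrefixOf_pre p n, rfl⟩) i m hm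
  · obtain ⟨_, ⟨w, hw, rfl⟩, hl⟩ := (hsup p q hq).2 (i + 1)
    refine ⟨w.length, (f w)[i], ?_⟩
    rw [← hw.eq_pre]
    exact List.getElem?_eq_getElem (by omega)

/-! ### Bounded minimization of partially known functions -/

/-- The least `c < n` with `g c = some 0`, provided that all earlier values are known. -/
def searchZero (g : ℕ → Option ℕ) (n : ℕ) : Option ℕ :=
  (firstSome (fun c => (g c).elim (some none) fun m => bif m == 0 then some (some c) else none)
    n).bind fun o => o

@[fun_prop] theorem computable_searchZero {α : Type*} [Primcodable α] {g : α → ℕ → Option ℕ}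
    {n : α → ℕ} (hn : Computable n) (hg : Computable (fun p : α × ℕ => g p.1 p.2)) :
    Computable (fun a => searchZero (g a) (n a)) := by
  unfold searchZero
  fun_prop

/-- An unknown value before the zero stops the search with `some none`. Without this, a zero could
be reported that is no longer the least one once more values are known. -/
theorem searchZero_eq_some {g : ℕ → Option ℕ} {n c : ℕ} :
    searchZero g n = some c ↔ c < n ∧ g c = some 0 ∧ ∀ j < c, ∃ m, g j = some (m + 1) := by
  constructor
  · intro h
    rw [searchZero, Option.bind_eq_some_iff] at h
    obtain ⟨_, h, rfl⟩ := h
    obtain ⟨k, hk, h1, h2⟩ := firstSome_spec h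
    rcases hg : g k with _ | m
    · simp [hg] at h1
    · rcases m with _ | m
      · have : k = c := by simpa [hg] using h1
        subst this
        refine ⟨hk, hg, fun j hj => ?_⟩
        have := h2 j hj
        rcases hgj : g j with _ | m
        · simp [hgj] at this
        · rcases m with _ | m
          · simp [hgj] at this
          · exact ⟨m, rfl⟩
      · simp [hg] at h1
  · rintro ⟨hc, h0, h1⟩
    rw [searchZero, firstSome_eq (k := c) (m := some c) hc (by simp [h0])]
    · rfl
    · intro j hj
      obtain ⟨m, hm⟩ := h1 j hj
      simp [hm]

/-! ### Turing reducibility by approximations -/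

/-- The partial function `g` is the limit of the monotone computable approximation `h`
along the prefixes of `p`. -/
def IsLimitOf (g : ℕ →. ℕ) (h : List ℕ → ℕ → Option ℕ) (p : Baire) : Prop :=
  Computable (fun p : List ℕ × ℕ => h p.1 p.2) ∧ IsMonotoneApprox h ∧
    ∀ n m, m ∈ g n ↔ ∃ k, h (pre p k) n = some m

theorem IsLimitOf.of_le {g : ℕ →. ℕ} {h : List ℕ → ℕ → Option ℕ} {p : Baire}
    (H : IsLimitOf g h p) {n m k l : ℕ} (hk : h (pre p k) n = some m) (hl : k ≤ l) :
    h (pre p l) n = some m :=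
  H.2.1 _ _ (pre_prefix_pre p hl) _ _ hk

theorem isLimitOf_computable {c : ℕ → ℕ} (hc : Computable c) (p : Baire) :
    IsLimitOf (fun n => Part.some (c n)) (fun _ n => some (c n)) p :=
  ⟨by fun_prop, fun _ _ _ _ _ h => h, fun n m => by simp [eq_comm]⟩

theorem exists_isLimitOf_of_recursiveIn {p : Baire} {g : ℕ →. ℕ}
    (hg : Nat.RecursiveIn {fun n => Part.some (p n)} g) : ∃ h, IsLimitOf g h p := by
  induction hg with
  | zero => exact ⟨_, isLimitOf_computable (Computable.const 0) p⟩
  | succ => exact ⟨_, isLimitOf_computable Computable.succ p⟩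
  | left => exact ⟨_, isLimitOf_computable (Computable.fst.comp Computable.unpair) p⟩
  | right => exact ⟨_, isLimitOf_computable (Computable.snd.comp Computable.unpair) p⟩
  | oracle g hg =>
    obtain rfl := Set.mem_singleton_iff.1 hg
    refine ⟨fun u n => u[n]?, by fun_prop, fun u v huv i m => getElem?_of_prefix huv,
      fun n m => ?_⟩
    rw [Part.mem_some_iff]
    exact ⟨fun h => ⟨n + 1, by simp only; rw [pre_getElem?_eq (by omega), h]⟩,
      fun ⟨k, hk⟩ => (eq_of_pre_getElem? hk).2.symm⟩
  | pair _ _ ihf ihg =>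
    obtain ⟨f', hf'⟩ := ihf
    obtain ⟨g', hg'⟩ := ihg
    have cf := hf'.1
    have cg := hg'.1
    refine ⟨fun u n => (f' u n).bind fun a => (g' u n).map fun b => Nat.pair a b, ?_, ?_, ?_⟩
    · fun_prop
    · intro u v huv n m hm
      simp only [Option.bind_eq_some_iff, Option.map_eq_some_iff] at hm ⊢
      obtain ⟨a, ha, b, hb, rfl⟩ := hm
      exact ⟨a, hf'.2.1 u v huv n a ha, b, hg'.2.1 u v huv n b hb, rfl⟩
    · intro n m
      simp only [Option.bind_eq_some_iff, Option.map_eq_some_iff]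
      constructor
      · intro h
        simp only [Seq.seq, Part.map_eq_map, Part.mem_bind_iff, Part.mem_map_iff] at h
        obtain ⟨_, ⟨a, ha, rfl⟩, b, hb, rfl⟩ := h
        obtain ⟨k, hk⟩ := (hf'.2.2 n a).1 ha
        obtain ⟨l, hl⟩ := (hg'.2.2 n b).1 hb
        exact ⟨max k l, a, hf'.of_le hk (le_max_left _ _), b, hg'.of_le hl (le_max_right _ _), rfl⟩
      · rintro ⟨k, a, ha, b, hb, rfl⟩
        simp only [Seq.seq, Part.map_eq_map, Part.mem_bind_iff, Part.mem_map_iff]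
        exact ⟨_, ⟨a, (hf'.2.2 n a).2 ⟨k, ha⟩, rfl⟩, b, (hg'.2.2 n b).2 ⟨k, hb⟩, rfl⟩
  | @comp f g _ _ ihf ihg =>
    obtain ⟨f', hf'⟩ := ihf
    obtain ⟨g', hg'⟩ := ihg
    have cf := hf'.1
    have cg := hg'.1
    refine ⟨fun u n => (g' u n).bind fun a => f' u a, ?_, ?_, ?_⟩
    · have : Computable (fun p : (List ℕ × ℕ) × ℕ => f' p.1.1 p.2) :=
        cf.comp (g := fun p : (List ℕ × ℕ) × ℕ => (p.1.1, p.2)) (by fun_prop)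
      fun_prop
    · intro u v huv n m hm
      simp only [Option.bind_eq_some_iff] at hm ⊢
      obtain ⟨a, ha, hb⟩ := hm
      exact ⟨a, hg'.2.1 u v huv n a ha, hf'.2.1 u v huv a m hb⟩
    · intro n m
      refine Part.mem_bind_iff.trans ?_
      simp only [Option.bind_eq_some_iff]
      constructor
      · rintro ⟨a, ha, hb⟩
        obtain ⟨k, hk⟩ := (hg'.2.2 n a).1 ha
        obtain ⟨l, hl⟩ := (hf'.2.2 a m).1 hb
        exact ⟨max k l, a, hg'.of_le hk (le_max_left _ _), hf'.of_le hl (le_max_right _ _)⟩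
      · rintro ⟨k, a, ha, hb⟩
        exact ⟨a, (hg'.2.2 n a).2 ⟨k, ha⟩, (hf'.2.2 a m).2 ⟨k, hb⟩⟩
  | @prec f g _ _ ihf ihg =>
    obtain ⟨f', hf'⟩ := ihf
    obtain ⟨g', hg'⟩ := ihg
    have cf := hf'.1
    have cg := hg'.1
    let r (u : List ℕ) (a n : ℕ) : Option ℕ := Nat.rec (motive := fun _ => Option ℕ) (f' u a)
      (fun y o => o.bind fun i => g' u (Nat.pair a (Nat.pair y i))) n
    have rmono : ∀ u v : List ℕ, u <+: v → ∀ a n m, r u a n = some m → r v a n = some m := by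
      intro u v huv a n
      induction n with
      | zero => exact fun m => hf'.2.1 u v huv a m
      | succ n ih =>
        intro m hm
        obtain ⟨i, hi, hm⟩ := Option.bind_eq_some_iff.1 hm
        exact Option.bind_eq_some_iff.2 ⟨i, ih i hi, hg'.2.1 u v huv _ m hm⟩
    refine ⟨fun u n => r u n.unpair.1 n.unpair.2, ?_, ?_, ?_⟩
    · have h1 : Computable (fun p : (List ℕ × ℕ) => f' p.1 p.2.unpair.1) :=
        cf.comp (g := fun p : List ℕ × ℕ => (p.1, p.2.unpair.1)) (by fun_prop)
      have h2 : Computable (fun p : ((List ℕ × ℕ) × ℕ × Option ℕ) × ℕ =>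
          g' p.1.1.1 (Nat.pair p.1.1.2.unpair.1 (Nat.pair p.1.2.1 p.2))) :=
        cg.comp (g := fun p : ((List ℕ × ℕ) × ℕ × Option ℕ) × ℕ =>
          (p.1.1.1, Nat.pair p.1.1.2.unpair.1 (Nat.pair p.1.2.1 p.2))) (by fun_prop)
      fun_prop
    · exact fun u v huv n m hm => rmono u v huv _ _ m hm
    · intro n m
      simp only
      generalize n.unpair.1 = a
      generalize n.unpair.2 = n
      induction n generalizing m with
      | zero => exact hf'.2.2 a m
      | succ n ih =>
        simp only [Part.bind_eq_bind, Part.mem_bind_iff]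
        constructor
        · rintro ⟨i, hi, hm⟩
          obtain ⟨k, hk⟩ := (ih i).1 hi
          obtain ⟨l, hl⟩ := (hg'.2.2 _ m).1 hm
          exact ⟨max k l, Option.bind_eq_some_iff.2
            ⟨i, rmono _ _ (pre_prefix_pre p (le_max_left k l)) _ _ _ hk,
              hg'.of_le hl (le_max_right _ _)⟩⟩
        · rintro ⟨k, hk⟩
          obtain ⟨i, hi, hm⟩ := Option.bind_eq_some_iff.1 hk
          exact ⟨i, (ih i).2 ⟨k, hi⟩, (hg'.2.2 _ m).2 ⟨k, hm⟩⟩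
  | rfind _ ihf =>
    obtain ⟨f', hf'⟩ := ihf
    have cf := hf'.1
    have key : ∀ u v : List ℕ, u <+: v → ∀ a m N N', N ≤ N' →
        searchZero (fun n => f' u (Nat.pair a n)) N = some m →
        searchZero (fun n => f' v (Nat.pair a n)) N' = some m := by
      intro u v huv a m N N' hN h
      rw [searchZero_eq_some] at h ⊢
      refine ⟨by omega, hf'.2.1 u v huv _ _ h.2.1, fun j hj => ?_⟩
      obtain ⟨k, hk⟩ := h.2.2 j hj
      exact ⟨k, hf'.2.1 u v huv _ _ hk⟩
    refine ⟨fun u a => searchZero (fun n => f' u (Nat.pair a n)) u.length, ?_, ?_, ?_⟩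
    · have h1 : Computable (fun p : (List ℕ × ℕ) × ℕ => f' p.1.1 (Nat.pair p.1.2 p.2)) :=
        cf.comp (g := fun p : (List ℕ × ℕ) × ℕ => (p.1.1, Nat.pair p.1.2 p.2)) (by fun_prop)
      fun_prop
    · exact fun u v huv a m => key u v huv a m _ _ huv.length_le
    · intro a m
      simp only [Part.map_eq_map]
      constructor
      · intro h
        obtain ⟨h0, h1⟩ := Nat.mem_rfind.1 h
        obtain ⟨x, hx, hx0⟩ := (Part.mem_map_iff _).1 h0
        obtain rfl : x = 0 := by simpa using hx0
        obtain ⟨k, hk⟩ := (hf'.2.2 _ _).1 hx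
        -- A single prefix of `p` decides all the finitely many nonzero values before the zero.
        have h2 : ∀ c ≤ m, ∃ K, ∀ j < c, ∃ y, f' (pre p K) (Nat.pair a j) = some (y + 1) := by
          intro c
          induction c with
          | zero => exact fun _ => ⟨0, fun j hj => by omega⟩
          | succ c ih =>
            intro hc
            obtain ⟨K, hK⟩ := ih (by omega)
            obtain ⟨x, hx, hx0⟩ := (Part.mem_map_iff _).1 (h1 (m := c) (by omega))
            obtain ⟨y, rfl⟩ := Nat.exists_eq_succ_of_ne_zero (show x ≠ 0 by simpa using hx0)
            obtain ⟨l, hl⟩ := (hf'.2.2 _ _).1 hx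
            refine ⟨max K l, fun j hj => ?_⟩
            rcases Nat.lt_succ_iff_lt_or_eq.1 hj with hj | rfl
            · obtain ⟨y, hy⟩ := hK j hj
              exact ⟨y, hf'.of_le hy (le_max_left _ _)⟩
            · exact ⟨y, hf'.of_le hl (le_max_right _ _)⟩
        obtain ⟨K, hK⟩ := h2 m le_rfl
        refine ⟨max (m + 1) (max k K), searchZero_eq_some.2 ⟨by simp, ?_, fun j hj => ?_⟩⟩
        · exact hf'.of_le hk (le_trans (le_max_left _ _) (le_max_right _ _))
        · obtain ⟨y, hy⟩ := hK j hj
          exact ⟨y, hf'.of_le hy (le_trans (le_max_right _ _) (le_max_right _ _))⟩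
      · rintro ⟨k, hk⟩
        obtain ⟨-, h0, h1⟩ := searchZero_eq_some.1 hk
        refine Nat.mem_rfind.2 ⟨(Part.mem_map_iff _).2 ⟨0, (hf'.2.2 _ _).2 ⟨k, h0⟩, by simp⟩,
          fun {j} hj => ?_⟩
        obtain ⟨y, hy⟩ := h1 j hj
        exact (Part.mem_map_iff _).2 ⟨y + 1, (hf'.2.2 _ _).2 ⟨k, hy⟩, by simp⟩

theorem TuringLE.exists_approximates {p q : Baire} (h : TuringLE q p) :
    ∃ h : List ℕ → ℕ → Option ℕ, Computable (fun p : List ℕ × ℕ => h p.1 p.2) ∧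
      IsMonotoneApprox h ∧ Approximates h p q := by
  obtain ⟨g, hg⟩ := exists_isLimitOf_of_recursiveIn (RecursiveIn.iff_nat.1 h)
  refine ⟨g, hg.1, hg.2.1, fun n i m hm => ?_, fun i => ?_⟩
  · exact ((Part.mem_some_iff.1 ((hg.2.2 i m).2 ⟨n, hm⟩))).symm
  · obtain ⟨k, hk⟩ := (hg.2.2 i (q i)).1 (Part.mem_some _)
    exact ⟨k, _, hk⟩

/-- Primitive recursion with one oracle call per step; it lets an oracle computation feed prefixes
of `p` to a word function. -/
theorem recursiveIn_encode_pre (p : Baire) : Nat.RecursiveIn {fun n => Part.some (p n)}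
    (fun n => Part.some (Encodable.encode (pre p n))) := by
  set O : Set (ℕ →. ℕ) := {fun n => Part.some (p n)}
  have cst : ∀ c : ℕ → ℕ, Computable c → Nat.RecursiveIn O (fun n => Part.some (c n)) :=
    fun c hc => Nat.Partrec.recursiveIn (Partrec.nat_iff.1 hc)
  have ho : Nat.RecursiveIn O (fun n => Part.some (p n)) := .oracle _ rfl
  have hK := cst (fun z => Encodable.encode
    ((((Encodable.decode z.unpair.1 : Option (List ℕ)).getD []) ++ [z.unpair.2]))) (by fun_prop)
  have hr := cst (fun z => z.unpair.2.unpair.2) (by fun_prop)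
  have hl := ho.comp (cst (fun z => z.unpair.2.unpair.1) (by fun_prop))
  have h1 := (cst (fun _ => Encodable.encode ([] : List ℕ)) (by fun_prop)).prec
    (hK.comp (hr.pair hl))
  have h2 := h1.comp (cst (fun n => Nat.pair 0 n) (by fun_prop))
  refine h2.of_eq_tot fun n => ?_
  simp only [Part.bind_eq_bind, Part.bind_some, Nat.unpair_pair]
  induction n with
  | zero => simp
  | succ n ih =>
    simp only [Part.mem_bind_iff]
    exact ⟨_, ih, Nat.pair (Encodable.encode (pre p n)) (p n), by simp [Seq.seq],
      by simp [pre_succ]⟩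

/-- Converse of the use principle: search with the oracle for a prefix of `p` on which `h` answers,
and return that answer. Any answer found is correct, so `h` need not be monotone. -/
theorem turingLE_of_approximates {p q : Baire} {h : List ℕ → ℕ → Option ℕ}
    (hh : Computable (fun p : List ℕ × ℕ => h p.1 p.2)) (H : Approximates h p q) :
    TuringLE q p := by
  refine RecursiveIn.iff_nat.2 ?_
  set O : Set (ℕ →. ℕ) := {fun n => Part.some (p n)}
  have cst : ∀ c : ℕ → ℕ, Computable c → Nat.RecursiveIn O (fun n => Part.some (c n)) :=
    fun c hc => Nat.Partrec.recursiveIn (Partrec.nat_iff.1 hc)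
  have hp : Nat.RecursiveIn O (fun n => Part.some (Encodable.encode (pre p n))) :=
    recursiveIn_encode_pre p
  let val (c i : ℕ) : Option ℕ := h ((Encodable.decode c : Option (List ℕ)).getD []) i
  have hval : Computable (fun z : ℕ => val z.unpair.2 z.unpair.1) :=
    hh.comp (g := fun z : ℕ => ((Encodable.decode z.unpair.2 : Option (List ℕ)).getD [],
      z.unpair.1)) (by fun_prop)
  have hcode : Nat.RecursiveIn O fun z =>
      Part.some (Nat.pair z.unpair.1 (Encodable.encode (pre p z.unpair.2))) :=
    ((cst (fun z => z.unpair.1) (by fun_prop)).pair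
      (hp.comp (cst (fun z => z.unpair.2) (by fun_prop)))).of_eq fun z => by simp [Seq.seq]
  have htest := ((cst (fun z => bif (val z.unpair.2 z.unpair.1).isSome then 0 else 1)
    (by fun_prop)).comp hcode).rfind
  have hout := (cst (fun z => (val z.unpair.2 z.unpair.1).getD 0) (by fun_prop)).comp
    (hcode.comp ((cst (fun i => i) (by fun_prop)).pair htest))
  refine hout.of_eq_tot fun i => ?_
  have hex : ∃ n, (h (pre p n) i).isSome := by
    obtain ⟨n, m, hm⟩ := H.2 i
    exact ⟨n, by simp [hm]⟩
  have hfind : Nat.find hex ∈ Nat.rfind fun n => (fun m => decide (m = 0)) <$>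
      (do
        let a ← Part.some (Nat.pair (Nat.pair i n).unpair.1
          (Encodable.encode (pre p (Nat.pair i n).unpair.2)))
        Part.some (bif (val a.unpair.2 a.unpair.1).isSome then 0 else 1) : Part ℕ) := by
    refine Nat.mem_rfind.2 ⟨?_, fun {j} hj => ?_⟩
    · simp [val, Nat.find_spec hex]
    · have := Nat.find_min hex hj
      simp only [Bool.not_eq_true] at this
      simp [val, this]
  obtain ⟨m, hm⟩ := Option.isSome_iff_exists.1 (Nat.find_spec hex)
  have hq := H.1 _ _ _ hm
  simp only [Part.bind_eq_bind, Part.mem_bind_iff]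
  refine ⟨_, ⟨Nat.pair i (Nat.find hex), ?_, Part.mem_some _⟩, ?_⟩
  · simp only [Seq.seq, Part.map_eq_map, Part.mem_bind_iff, Part.mem_map_iff]
    exact ⟨_, ⟨i, Part.mem_some _, rfl⟩, _, hfind, rfl⟩
  · simp [val, hm, hq]

/-! ### Closure properties of computable partial functions on Baire space -/

@[simp] theorem first_pair (q p : Baire) : first (pair q p) = q := by
  funext n; simp [first, pair]

@[simp] theorem second_pair (q p : Baire) : second (pair q p) = p := by
  funext n
  have h : (2 * n + 1) / 2 = n := by omega
  simp [second, pair, h]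

@[simp] theorem component_tuple (p : ℕ → Baire) (i : ℕ) : component (tuple p) i = p i := by
  funext k; simp [component, tuple]

@[simp] theorem tuple_component (z : Baire) : tuple (component z) = z := by
  funext k; simp [component, tuple]

/-- Computability only constrains the values taken on the domain, so it passes to restrictions. -/
theorem ComputableFun.mono {F G : Baire →. Baire} (hG : ComputableFun G)
    (h : ∀ p q, q ∈ F p → q ∈ G p) : ComputableFun F := by
  obtain ⟨g, hg, hm, H⟩ := hG
  exact ⟨g, hg, hm, fun p q hq => H p q (h p q hq)⟩

theorem ComputableFun.turingLE {F : Baire →. Baire} (hF : ComputableFun F) {p q : Baire}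
    (h : q ∈ F p) : TuringLE q p := by
  obtain ⟨g, hg, -, H⟩ := hF.exists_approximates
  exact turingLE_of_approximates hg (H p q h)

theorem ComputableFun.bind {F G : Baire →. Baire} (hF : ComputableFun F) (hG : ComputableFun G) :
    ComputableFun (fun p => (F p).bind G) := by
  obtain ⟨f, hf, hfm, Hf⟩ := hF
  obtain ⟨g, hg, hgm, Hg⟩ := hG
  refine ⟨fun u => g (f u), by fun_prop, fun v w hvw => hgm _ _ (hfm _ _ hvw), fun p q hq => ?_⟩
  obtain ⟨r, hr, hq⟩ := Part.mem_bind_iff.1 hq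
  constructor
  · rintro _ ⟨w, hw, rfl⟩
    exact (Hg r q hq).1 _ ⟨f w, (Hf p r hr).1 _ ⟨w, hw, rfl⟩, rfl⟩
  · intro n
    obtain ⟨_, ⟨v, hv, rfl⟩, hl⟩ := (Hg r q hq).2 n
    obtain ⟨_, ⟨w, hw, rfl⟩, hl'⟩ := (Hf p r hr).2 v.length
    refine ⟨_, ⟨w, hw, rfl⟩, hl.trans ?_⟩
    exact (hgm _ _ (hv.prefix_of_le ((Hf p r hr).1 _ ⟨w, hw, rfl⟩) hl')).length_le

/-- A total function on Baire space is computable. -/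
def ComputableMap (T : Baire → Baire) : Prop := ComputableFun fun p => Part.some (T p)

theorem ComputableMap.turingLE {T : Baire → Baire} (hT : ComputableMap T) (p : Baire) :
    TuringLE (T p) p := ComputableFun.turingLE hT (Part.mem_some _)

theorem ComputableMap.comp {S T : Baire → Baire} (hS : ComputableMap S) (hT : ComputableMap T) :
    ComputableMap fun p => S (T p) :=
  (ComputableFun.bind hT hS).mono fun p q h => by simpa using h

theorem ComputableFun.comp_map {F : Baire →. Baire} {T : Baire → Baire} (hF : ComputableFun F)
    (hT : ComputableMap T) : ComputableFun fun p => F (T p) :=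
  (ComputableFun.bind hT hF).mono fun _ _ h => Part.mem_bind_iff.2 ⟨_, Part.mem_some _, h⟩

theorem ComputableFun.map {F : Baire →. Baire} {T : Baire → Baire} (hF : ComputableFun F)
    (hT : ComputableMap T) : ComputableFun fun p => (F p).map T :=
  (ComputableFun.bind hF hT).mono fun p q h => by
    simpa [Part.mem_map_iff, Part.mem_bind_iff, eq_comm] using h

/-- The total function `p ↦ ⟨F p, G p⟩`. -/
theorem ComputableFun.pair {F G : Baire →. Baire} (hF : ComputableFun F) (hG : ComputableFun G) :
    ComputableFun (fun p => (F p).bind fun a => (G p).map fun b => pair a b) := by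
  obtain ⟨f, hf, -, Hf⟩ := hF.exists_approximates
  obtain ⟨g, hg, -, Hg⟩ := hG.exists_approximates
  refine ComputableFun.of_approximates
    (h := fun u i => bif i % 2 == 0 then f u (i / 2) else g u (i / 2)) ?_ ?_
  · have h1 : Computable (fun p : List ℕ × ℕ => f p.1 (p.2 / 2)) :=
      hf.comp (g := fun p : List ℕ × ℕ => (p.1, p.2 / 2)) (by fun_prop)
    have h2 : Computable (fun p : List ℕ × ℕ => g p.1 (p.2 / 2)) :=
      hg.comp (g := fun p : List ℕ × ℕ => (p.1, p.2 / 2)) (by fun_prop)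
    fun_prop
  · intro p q hq
    obtain ⟨a, ha, hq⟩ := Part.mem_bind_iff.1 hq
    obtain ⟨b, hb, rfl⟩ := (Part.mem_map_iff _).1 hq
    have Ha := Hf p a ha
    have Hb := Hg p b hb
    have : ∀ i, (i % 2 == 0) = true ∧ Weihrauch.pair a b i = a (i / 2) ∨
        (i % 2 == 0) = false ∧ Weihrauch.pair a b i = b (i / 2) := by
      intro i
      by_cases hi : i % 2 = 0 <;> simp [hi, Weihrauch.pair]
    constructor
    · intro n i m hm
      rcases this i with ⟨h1, h2⟩ | ⟨h1, h2⟩ <;> simp only [h1, h2, cond_true, cond_false] at hm ⊢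
      · exact Ha.1 _ _ _ hm
      · exact Hb.1 _ _ _ hm
    · intro i
      rcases this i with ⟨h1, h2⟩ | ⟨h1, h2⟩ <;> simp only [h1, cond_true, cond_false]
      · exact Ha.2 _
      · exact Hb.2 _

theorem ComputableMap.pair {S T : Baire → Baire} (hS : ComputableMap S) (hT : ComputableMap T) :
    ComputableMap fun p => Weihrauch.pair (S p) (T p) :=
  (ComputableFun.pair hS hT).mono fun p q h => by simpa using h

/-- Each digit of the value depends on one digit of the argument, at a computable position. -/
theorem ComputableMap.of_digit {T : Baire → Baire} (a : ℕ → ℕ) (φ : ℕ → ℕ → ℕ)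
    (ha : Computable a) (hφ : Computable fun z : ℕ × ℕ => φ z.1 z.2)
    (hT : ∀ p i, T p i = φ i (p (a i))) : ComputableMap T := by
  refine ComputableFun.of_approximates (h := fun u i => (u[a i]?).map fun m => φ i m) ?_ ?_
  · have : Computable (fun p : (List ℕ × ℕ) × ℕ => φ p.1.2 p.2) :=
      hφ.comp (g := fun p : (List ℕ × ℕ) × ℕ => (p.1.2, p.2)) (by fun_prop)
    fun_prop
  · intro p q hq
    obtain rfl := Part.mem_some_iff.1 hq
    constructor
    · intro n i m hm
      obtain ⟨k, hk, rfl⟩ := Option.map_eq_some_iff.1 hm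
      rw [hT, (eq_of_pre_getElem? hk).2]
    · intro i
      exact ⟨a i + 1, φ i (p (a i)), by simp only [pre_getElem?_eq (Nat.lt_succ_self _)]; rfl⟩

/-- Each digit of the value depends on two digits of the argument, at computable positions, the
second one being determined by the first digit. -/
theorem ComputableMap.of_two_digits {T : Baire → Baire} (a : ℕ → ℕ) (b : ℕ → ℕ → ℕ)
    (φ : ℕ → ℕ → ℕ → ℕ) (ha : Computable a) (hb : Computable fun z : ℕ × ℕ => b z.1 z.2)
    (hφ : Computable fun z : ℕ × ℕ × ℕ => φ z.1 z.2.1 z.2.2)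
    (hT : ∀ p i, T p i = φ i (p (a i)) (p (b i (p (a i))))) : ComputableMap T := by
  refine ComputableFun.of_approximates
    (h := fun u i => (u[a i]?).bind fun m => (u[b i m]?).map fun k => φ i m k) ?_ ?_
  · have h1 : Computable (fun p : (List ℕ × ℕ) × ℕ => b p.1.2 p.2) :=
      hb.comp (g := fun p : (List ℕ × ℕ) × ℕ => (p.1.2, p.2)) (by fun_prop)
    have h2 : Computable (fun p : ((List ℕ × ℕ) × ℕ) × ℕ => φ p.1.1.2 p.1.2 p.2) :=
      hφ.comp (g := fun p : ((List ℕ × ℕ) × ℕ) × ℕ => (p.1.1.2, p.1.2, p.2)) (by fun_prop)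
    fun_prop
  · intro p q hq
    obtain rfl := Part.mem_some_iff.1 hq
    constructor
    · intro n i m hm
      obtain ⟨k, hk, hm⟩ := Option.bind_eq_some_iff.1 hm
      obtain ⟨l, hl, rfl⟩ := Option.map_eq_some_iff.1 hm
      rw [hT, (eq_of_pre_getElem? hk).2, (eq_of_pre_getElem? hl).2]
    · intro i
      refine ⟨max (a i + 1) (b i (p (a i)) + 1), φ i (p (a i)) (p (b i (p (a i)))), ?_⟩
      simp only
      rw [pre_getElem?_eq (lt_of_lt_of_le (Nat.lt_succ_self _) (le_max_left _ _)), Option.bind_some,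
        pre_getElem?_eq (lt_of_lt_of_le (Nat.lt_succ_self _) (le_max_right _ _)), Option.map_some]

theorem computableMap_id : ComputableMap fun p => p :=
  ComputableMap.of_digit (fun i => i) (fun _ m => m) (by fun_prop) (by fun_prop) fun _ _ => rfl

theorem computableMap_const {c : Baire} (hc : Computable c) : ComputableMap fun _ => c :=
  ComputableMap.of_digit (fun i => i) (fun i _ => c i) (by fun_prop)
    (hc.comp Computable.fst) fun _ _ => rfl

theorem computableMap_first : ComputableMap first :=
  ComputableMap.of_digit (fun i => 2 * i) (fun _ m => m) (by fun_prop) (by fun_prop)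
    fun _ _ => rfl

theorem computableMap_second : ComputableMap second :=
  ComputableMap.of_digit (fun i => 2 * i + 1) (fun _ m => m) (by fun_prop) (by fun_prop)
    fun _ _ => rfl

theorem computableMap_component (i : ℕ) : ComputableMap fun p => component p i :=
  ComputableMap.of_digit (fun k => Nat.pair i k) (fun _ m => m) (by fun_prop) (by fun_prop)
    fun _ _ => rfl

/-- The sequence `n, p 0, p 1, ...`. -/
def cons (n : ℕ) (p : Baire) : Baire
  | 0 => n
  | i + 1 => p i

/-- The sequence `p 1, p 2, ...`. -/
def tail (p : Baire) : Baire := fun i => p (i + 1)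

@[simp] theorem cons_zero (n : ℕ) (p : Baire) : cons n p 0 = n := rfl

@[simp] theorem tail_cons (n : ℕ) (p : Baire) : tail (cons n p) = p := rfl

theorem pre_cons (n : ℕ) (p : Baire) (k : ℕ) : pre (cons n p) (k + 1) = n :: pre p k := by
  simp [pre, listOf, List.range_succ_eq_map, cons]

theorem computableMap_tail : ComputableMap tail :=
  ComputableMap.of_digit (fun i => i + 1) (fun _ m => m) (by fun_prop) (by fun_prop)
    fun _ _ => rfl

theorem computableMap_cons (n : ℕ) : ComputableMap (cons n) :=
  ComputableMap.of_digit (fun i => i - 1) (fun i m => bif i == 0 then n else m)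
    (by fun_prop) (by fun_prop) fun p i => by cases i <;> simp [cons]

/-- Uniformity in `n`: the index is passed as an extra first digit of the argument. This prepares
infinitely many counters for the parallelized diamond. -/
theorem ComputableMap.tuple_cons {T : Baire → Baire} (hT : ComputableMap T) :
    ComputableMap fun p => tuple fun n => T (cons n p) := by
  obtain ⟨h, hh, hm', H⟩ := ComputableFun.exists_approximates hT
  refine ComputableFun.of_approximates
    (h := fun u i => h (i.unpair.1 :: u) i.unpair.2) ?_ fun p q hq => ?_
  · exact hh.comp (g := fun p : List ℕ × ℕ => (p.2.unpair.1 :: p.1, p.2.unpair.2)) (by fun_prop)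
  · obtain rfl := Part.mem_some_iff.1 hq
    have key := fun n => H (cons n p) _ (Part.mem_some _)
    constructor
    · intro n i m hm
      simp only [← pre_cons] at hm
      exact (key _).1 _ _ _ hm
    · intro i
      obtain ⟨N, hN⟩ := (key i.unpair.1).eventually hm' i.unpair.2
      refine ⟨N, T (cons i.unpair.1 p) i.unpair.2, ?_⟩
      simpa only [← pre_cons] using hN (N + 1) (Nat.le_succ N)

/-- A case distinction on a digit. -/
theorem ComputableFun.ite {F G : Baire →. Baire} (hF : ComputableFun F) (hG : ComputableFun G)
    (a : ℕ) {c : ℕ → Bool} (hc : Computable c) :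
    ComputableFun fun p => if c (p a) = true then F p else G p := by
  obtain ⟨f, hf, hfm, Hf⟩ := hF.exists_approximates
  obtain ⟨g, hg, hgm, Hg⟩ := hG.exists_approximates
  refine ComputableFun.of_approximates
    (h := fun u i => (u[a]?).bind fun m => bif c m then f u i else g u i) ?_ fun p q hq => ?_
  · fun_prop
  · have hn : ∀ n > a, (pre p n)[a]? = some (p a) := fun n hn => pre_getElem?_eq hn
    by_cases hb : c (p a) = true
    · rw [if_pos hb] at hq
      refine ⟨fun n i m hm => ?_, fun i => ?_⟩
      · obtain ⟨k, hk, hm⟩ := Option.bind_eq_some_iff.1 hm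
        obtain ⟨-, rfl⟩ := eq_of_pre_getElem? hk
        rw [hb] at hm
        exact (Hf p q hq).1 n i m hm
      · obtain ⟨N, hN⟩ := (Hf p q hq).eventually hfm i
        refine ⟨max N (a + 1), q i, ?_⟩
        simp only
        rw [hn _ (by omega), Option.bind_some, hb]
        exact hN _ (by omega)
    · rw [if_neg hb] at hq
      rw [Bool.not_eq_true] at hb
      refine ⟨fun n i m hm => ?_, fun i => ?_⟩
      · obtain ⟨k, hk, hm⟩ := Option.bind_eq_some_iff.1 hm
        obtain ⟨-, rfl⟩ := eq_of_pre_getElem? hk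
        rw [hb] at hm
        exact (Hg p q hq).1 n i m hm
      · obtain ⟨N, hN⟩ := (Hg p q hq).eventually hgm i
        refine ⟨max N (a + 1), q i, ?_⟩
        simp only
        rw [hn _ (by omega), Option.bind_some, hb]
        exact hN _ (by omega)

/-- Minimization: the sequence of the least `c` with `p ⟨i, c⟩ = 0`. -/
noncomputable def minimize : Baire →. Baire := fun p =>
  ⟨∀ i, ∃ c, p (Nat.pair i c) = 0, fun h i => by classical exact Nat.find (h i)⟩

theorem mem_minimize {p q : Baire} : q ∈ minimize p ↔
    ∀ i, p (Nat.pair i (q i)) = 0 ∧ ∀ c < q i, p (Nat.pair i c) ≠ 0 := by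
  classical
  constructor
  · rintro ⟨h, rfl⟩ i
    exact ⟨Nat.find_spec (h i), fun c hc => Nat.find_min (h i) hc⟩
  · intro H
    refine ⟨fun i => ⟨_, (H i).1⟩, funext fun i => ?_⟩
    exact (Nat.find_eq_iff _).2 (H i)

theorem computableFun_minimize : ComputableFun minimize := by
  refine ComputableFun.of_approximates
    (h := fun u i => searchZero (fun c => u[Nat.pair i c]?) u.length) (by fun_prop) fun p q hq => ?_
  rw [mem_minimize] at hq
  constructor
  · intro n i m hm
    obtain ⟨-, h0, h1⟩ := searchZero_eq_some.1 hm
    have h2 := (eq_of_pre_getElem? h0).2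
    rcases lt_trichotomy (q i) m with h | h | h
    · obtain ⟨k, hk⟩ := h1 _ h
      have := (eq_of_pre_getElem? hk).2
      rw [(hq i).1] at this; omega
    · exact h
    · exact absurd h2 ((hq i).2 m h)
  · intro i
    -- The pairing is increasing in its second argument, so the prefix ending at `Nat.pair i (q i)`
    -- contains every value inspected by the search.
    have hlt : ∀ c ≤ q i, Nat.pair i c < Nat.pair i (q i) + 1 := fun c hc => by
      rcases hc.lt_or_eq with h | rfl
      · have := Nat.pair_lt_pair_right i h; omega
      · omega
    refine ⟨Nat.pair i (q i) + 1, q i, searchZero_eq_some.2 ⟨?_, ?_, fun j hj => ?_⟩⟩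
    · have := Nat.right_le_pair i (q i)
      simp; omega
    · rw [pre_getElem?_eq (hlt _ le_rfl), (hq i).1]
    · obtain ⟨k, hk⟩ := Nat.exists_eq_succ_of_ne_zero ((hq i).2 j hj)
      exact ⟨k, by rw [pre_getElem?_eq (hlt _ hj.le), hk]⟩

/-! ### The universal function is computable -/

/-- The universal function as a partial function. -/
noncomputable def univFun : Baire →. Baire := fun z => ⟨∃ r, r ∈ univ z, fun h => h.choose⟩

theorem mem_univ_unique {z r s : Baire} (hr : r ∈ univ z) (hs : s ∈ univ z) : r = s :=
  IsSupOf.unique hr hs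

theorem mem_univFun {z r : Baire} : r ∈ univFun z ↔ r ∈ univ z := by
  constructor
  · rintro ⟨h, rfl⟩
    exact h.choose_spec
  · intro h
    exact ⟨⟨r, h⟩, mem_univ_unique (Exists.choose_spec (⟨r, h⟩ : ∃ r, r ∈ univ z)) h⟩

/-- Whether the word `v` is known to be a prefix of `second z`, given the prefix `u` of `z`. -/
def secondStartsWith (u v : List ℕ) : Bool :=
  knownWord (fun i => u[2 * i + 1]?) v.length == v

theorem computable_secondStartsWith :
    Computable fun p : List ℕ × List ℕ => secondStartsWith p.1 p.2 := by
  unfold secondStartsWith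
  fun_prop

theorem isPrefixOf_of_secondStartsWith {z : Baire} {n : ℕ} {v : List ℕ}
    (h : secondStartsWith (pre z n) v = true) : IsPrefixOf v (second z) := by
  have := knownWord_isPrefixOf (h := fun i => (pre z n)[2 * i + 1]?) (n := v.length)
    (q := second z) fun i m h => (eq_of_pre_getElem? h).2
  rwa [beq_iff_eq.1 h] at this

theorem secondStartsWith_of_isPrefixOf {z : Baire} {n : ℕ} {v : List ℕ}
    (h : IsPrefixOf v (second z)) (hn : 2 * v.length ≤ n) :
    secondStartsWith (pre z n) v = true := by
  have h1 : ∀ i < v.length, (pre z n)[2 * i + 1]? = some (second z i) := fun i hi =>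
    pre_getElem?_eq (by omega)
  refine beq_iff_eq.2 (List.ext_getElem? fun i => ?_)
  have h2 : (knownWord (fun i => (pre z n)[2 * i + 1]?) v.length).length = v.length :=
    knownWord_length_eq fun i hi => ⟨_, h1 i hi⟩
  rcases Nat.lt_or_ge i v.length with hi | hi
  · rw [List.getElem?_eq_getElem (by omega : i < (knownWord _ v.length).length),
      ← knownWord_getElem? (List.getElem?_eq_getElem (h2.symm ▸ hi)), h1 i hi,
      List.getElem?_eq_getElem hi, h i hi]
  · rw [List.getElem?_eq_none (by omega), List.getElem?_eq_none hi]

/-- The digit `i` of the word listed by the entry `e`, if this entry is known to apply. -/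
def entryDigit (u : List ℕ) (i e : ℕ) : Option ℕ :=
  (Encodable.decode (e - 3) : Option (List ℕ × List ℕ)).bind fun vw =>
    -- Subtraction truncates, so the dummy digits `0, 1, 2` would decode like `3`; comparing with
    -- the code rejects them.
    bif Encodable.encode vw + 3 == e && secondStartsWith u vw.1 then vw.2[i]? else none

theorem computable_entryDigit :
    Computable fun p : List ℕ × ℕ × ℕ => entryDigit p.1 p.2.1 p.2.2 := by
  unfold entryDigit
  have h : Computable fun p : (List ℕ × ℕ × ℕ) × (List ℕ × List ℕ) =>
      secondStartsWith p.1.1 p.2.1 :=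
    computable_secondStartsWith.comp
      (g := fun p : (List ℕ × ℕ × ℕ) × (List ℕ × List ℕ) => (p.1.1, p.2.1)) (by fun_prop)
  refine computable_optionBind (by fun_prop) (computable_cond (computable_and ?_ h)
    (by fun_prop) (by fun_prop))
  refine computable_beq (computable_add (computable_encode' ?_) ?_) ?_ <;> fun_prop

/-- The digits of the value of the universal function. -/
def univApprox (u : List ℕ) (i : ℕ) : Option ℕ :=
  firstSome (fun j => (u[2 * j]?).bind fun e => entryDigit u i e) u.length

theorem computable_univApprox : Computable fun p : List ℕ × ℕ => univApprox p.1 p.2 := by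
  unfold univApprox
  have h : Computable fun p : ((List ℕ × ℕ) × ℕ) × ℕ => entryDigit p.1.1.1 p.1.1.2 p.2 :=
    computable_entryDigit.comp
      (g := fun p : ((List ℕ × ℕ) × ℕ) × ℕ => (p.1.1.1, p.1.1.2, p.2)) (by fun_prop)
  fun_prop

/-- All words listed together with a prefix of `second z` are prefixes of the same `r`, so it does
not matter which applicable entry is found first. -/
theorem approximates_univApprox {z r : Baire} (hr : r ∈ univ z) :
    Approximates univApprox z r := by
  constructor
  · intro n i m hm
    obtain ⟨j, -, hj, -⟩ := firstSome_spec hm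
    obtain ⟨e, he, hj⟩ := Option.bind_eq_some_iff.1 hj
    obtain ⟨⟨v, w⟩, -, hj⟩ := Option.bind_eq_some_iff.1 hj
    rcases hb : (Encodable.encode (v, w) + 3 == e && secondStartsWith (pre z n) v) with _ | _
    · rw [hb] at hj; cases hj
    · rw [hb] at hj
      obtain ⟨h1, h2⟩ := Bool.and_eq_true_iff.1 hb
      have h3 : first z j = Encodable.encode (v, w) + 3 :=
        (eq_of_pre_getElem? he).2.trans (beq_iff_eq.1 h1).symm
      exact isPrefixOf_iff_getElem?.1
        (hr.1 w ⟨v, j, isPrefixOf_of_secondStartsWith h2, h3⟩) i m hj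
  · intro i
    obtain ⟨w, ⟨v, j, hv, hj⟩, hl⟩ := hr.2 (i + 1)
    refine ⟨2 * j + 2 * v.length + 1, firstSome_isSome (k := j) (m := w[i]) (by simp; omega) ?_⟩
    have h1 : z (2 * j) = Encodable.encode (v, w) + 3 := hj
    rw [pre_getElem?_eq (by omega), Option.bind_some, h1, entryDigit, Nat.add_sub_cancel,
      Encodable.encodek, Option.bind_some, secondStartsWith_of_isPrefixOf hv (by omega)]
    simp only [beq_self_eq_true, Bool.and_self, cond_true]
    exact List.getElem?_eq_getElem (by omega)

theorem computableFun_univFun : ComputableFun univFun :=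
  ComputableFun.of_approximates computable_univApprox fun _ _ hr =>
    approximates_univApprox (mem_univFun.1 hr)

/-! ### Interleaving words -/

/-- The word of the digits of `u` at even positions. -/
def evenPart (u : List ℕ) : List ℕ := knownWord (fun i => u[2 * i]?) u.length

/-- The word of the digits of `u` at odd positions. -/
def oddPart (u : List ℕ) : List ℕ := knownWord (fun i => u[2 * i + 1]?) u.length

/-- The longest word with the given words as even and odd parts. -/
def interleave (u v : List ℕ) : List ℕ :=
  knownWord (fun n => bif n % 2 == 0 then u[n / 2]? else v[n / 2]?) (u.length + v.length)

@[fun_prop] theorem computable_evenPart {α : Type*} [Primcodable α] {f : α → List ℕ}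
    (hf : Computable f) : Computable fun a => evenPart (f a) := by
  unfold evenPart
  fun_prop

@[fun_prop] theorem computable_oddPart {α : Type*} [Primcodable α] {f : α → List ℕ}
    (hf : Computable f) : Computable fun a => oddPart (f a) := by
  unfold oddPart
  fun_prop

@[fun_prop] theorem computable_interleave {α : Type*} [Primcodable α] {f g : α → List ℕ}
    (hf : Computable f) (hg : Computable g) : Computable fun a => interleave (f a) (g a) := by
  unfold interleave
  fun_prop

theorem isPrefixOf_evenPart {u : List ℕ} {z : Baire} (h : IsPrefixOf u z) :
    IsPrefixOf (evenPart u) (first z) :=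
  knownWord_isPrefixOf fun i m him => isPrefixOf_iff_getElem?.1 h (2 * i) m him

theorem isPrefixOf_oddPart {u : List ℕ} {z : Baire} (h : IsPrefixOf u z) :
    IsPrefixOf (oddPart u) (second z) :=
  knownWord_isPrefixOf fun i m him => isPrefixOf_iff_getElem?.1 h (2 * i + 1) m him

theorem isPrefixOf_interleave {u v : List ℕ} {p q : Baire} (hu : IsPrefixOf u p)
    (hv : IsPrefixOf v q) : IsPrefixOf (interleave u v) (pair p q) := by
  refine knownWord_isPrefixOf fun i m him => ?_
  simp only [pair]
  by_cases hi : i % 2 = 0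
  · rw [if_pos hi]
    exact isPrefixOf_iff_getElem?.1 hu _ m (by simpa [hi] using him)
  · rw [if_neg hi]
    have hb : (i % 2 == 0) = false := by simpa using hi
    rw [hb] at him
    exact isPrefixOf_iff_getElem?.1 hv _ m him

theorem le_length_knownWord {h : ℕ → Option ℕ} {n N : ℕ} (hn : ∀ i < n, ∃ m, h i = some m)
    (hN : n ≤ N) : n ≤ (knownWord h N).length := by
  rw [← knownWord_length_eq hn]
  exact (knownWord_prefix hN fun i m h => h).length_le

theorem exists_getElem? {α : Type*} {u : List α} {i : ℕ} (h : i < u.length) :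
    ∃ m, u[i]? = some m := ⟨_, List.getElem?_eq_getElem h⟩

theorem le_length_evenPart {u : List ℕ} {n : ℕ} (h : 2 * n ≤ u.length) :
    n ≤ (evenPart u).length :=
  le_length_knownWord (fun i hi => exists_getElem? (by omega)) (by omega)

theorem le_length_oddPart {u : List ℕ} {n : ℕ} (h : 2 * n ≤ u.length) :
    n ≤ (oddPart u).length :=
  le_length_knownWord (fun i hi => exists_getElem? (by omega)) (by omega)

theorem le_length_interleave {u v : List ℕ} {n : ℕ} (hu : n ≤ u.length) (hv : n ≤ v.length) :
    n ≤ (interleave u v).length := by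
  refine le_length_knownWord (fun i hi => ?_) (by omega)
  by_cases h : i % 2 = 0
  · simpa [h] using exists_getElem? (u := u) (i := i / 2) (by omega)
  · have hb : (i % 2 == 0) = false := by simpa using h
    rw [hb]
    exact exists_getElem? (u := v) (i := i / 2) (by omega)

/-! ### Programs with memory that reproduce themselves -/

/-- The code of a digit of the memory of a program: a dummy symbol or a pair `(v, w)` without
influence on the computation. -/
def codeDigit (a : ℕ) : ℕ := bif a == 0 then 0 else Encodable.encode ([a], ([] : List ℕ)) + 3

/-- The inverse of `codeDigit`. -/
def decodeDigit (e : ℕ) : ℕ := bif e == 0 then 0 else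
  (Encodable.decode (e - 3) : Option (List ℕ × List ℕ)).elim 0 fun vw => (vw.1[0]?).getD 0

@[fun_prop] theorem computable_codeDigit {α : Type*} [Primcodable α] {f : α → ℕ}
    (hf : Computable f) : Computable fun a => codeDigit (f a) := by
  unfold codeDigit
  fun_prop

@[fun_prop] theorem computable_decodeDigit {α : Type*} [Primcodable α] {f : α → ℕ}
    (hf : Computable f) : Computable fun a => decodeDigit (f a) := by
  unfold decodeDigit
  fun_prop

@[simp] theorem decodeDigit_codeDigit (a : ℕ) : decodeDigit (codeDigit a) = a := by
  rcases Nat.eq_zero_or_pos a with rfl | h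
  · rfl
  · have h1 : (a == 0) = false := by simp; omega
    simp only [codeDigit, h1, cond_false, decodeDigit, Nat.add_sub_cancel, Encodable.encodek]
    rfl

/-- Zero is preserved because the diamond tests the first digit of the state, which codes the first
digit of the memory. -/
theorem codeDigit_eq_zero_iff {a : ℕ} : codeDigit a = 0 ↔ a = 0 := by
  constructor
  · intro h
    rw [← decodeDigit_codeDigit a, h]; rfl
  · rintro rfl; rfl

/-- Digits storing memory list at most the empty word, which is harmless in a supremum. -/
theorem eq_nil_of_codeDigit {a : ℕ} {v w : List ℕ}
    (h : codeDigit a = Encodable.encode (v, w) + 3) : w = [] := by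
  rw [codeDigit] at h
  rcases hb : a == 0 with _ | _
  · rw [hb] at h
    have := Encodable.encode_injective (Nat.add_right_cancel h)
    exact (Prod.mk.inj this).2.symm
  · rw [hb] at h
    simp at h

section Program

variable (nw : List ℕ → List ℕ)

/-- The word `v` of the pair `(v, w)` listed at position `k`. -/
def entryInput (k : ℕ) : List ℕ :=
  -- The other half of `k / 2` is padding: every `v` recurs at arbitrarily large positions, where
  -- longer outputs are listed.
  (Encodable.decode (k / 2).unpair.1 : Option (List ℕ)).getD []

/-- The word known about the next memory and query, when the pair at position `k` is listed. -/
def entryOutput (k : ℕ) (u : List ℕ) : List ℕ := nw (interleave (u.take k) (entryInput k))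

/-- The digit at position `k` of the program with memory prefix `u`, where the word `a` is a
prefix of the program with the next memory. -/
def programDigit (k : ℕ) (u a : List ℕ) : ℕ :=
  bif k % 2 == 0 then codeDigit ((u[k / 2]?).getD 0) else
    Encodable.encode (entryInput k, interleave a (oddPart (entryOutput nw k u))) + 3

/-- The prefix of length `k` of the program with memory prefix `u`. -/
def programWord : ℕ → List ℕ → List ℕ
  | 0, _ => []
  | k + 1, u => bif Nat.ble u.length k then programWord k u else
      programWord k u ++ [programDigit nw k u (programWord k (evenPart (entryOutput nw k u)))]

/-- The program with memory `m`. -/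
def program (m : Baire) : Baire := fun n =>
  programDigit nw n (pre m (n + 1)) (programWord nw n (evenPart (entryOutput nw n (pre m (n + 1)))))

variable {nw}

/-- The digit at position `k` uses at most `k + 1` digits of memory, and the part of the successor
program quoted in it has length at most `k`. Hence the self-reference is well-founded, and `l`
digits of memory determine `l` digits of program. -/
theorem programWord_pre (m : Baire) (k l : ℕ) :
    programWord nw k (pre m l) = pre (program nw m) (min k l) := by
  induction k with
  | zero => simp [programWord]
  | succ k ih =>
    rw [programWord, ih]
    rcases Nat.lt_or_ge k l with h | h
    · have hb : Nat.ble (pre m l).length k = false := by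
        rw [← Bool.not_eq_true, Nat.ble_eq, length_pre]; omega
      have ho : entryOutput nw k (pre m l) = entryOutput nw k (pre m (k + 1)) := by
        simp only [entryOutput]
        rw [take_pre m h.le, take_pre m (Nat.le_succ k)]
      have hg : (pre m l)[k / 2]? = (pre m (k + 1))[k / 2]? := by
        rw [pre_getElem?_eq (by omega), pre_getElem?_eq (by omega)]
      rw [hb, cond_false, min_eq_left (by omega), min_eq_left (by omega), pre_succ]
      simp only [program, programDigit, ho, hg]
    · have hb : Nat.ble (pre m l).length k = true := by rw [Nat.ble_eq]; simpa using h
      rw [hb, cond_true, min_eq_right h, min_eq_right (by omega)]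

theorem programWord_eq {m : Baire} {u : List ℕ} (hu : IsPrefixOf u m) (k : ℕ) :
    programWord nw k u = pre (program nw m) (min k u.length) := by
  rw [hu.eq_pre, programWord_pre, length_pre]

theorem program_two_mul (m : Baire) (i : ℕ) : program nw m (2 * i) = codeDigit (m i) := by
  have h1 : 2 * i / 2 = i := by omega
  have h2 : (2 * i % 2 == 0) = true := by simp
  rw [program, programDigit, h2, cond_true, h1, pre_getElem?_eq (by omega)]
  rfl

theorem program_odd (m : Baire) {k : ℕ} (hk : k % 2 ≠ 0) : program nw m k =
    Encodable.encode (entryInput k, interleave (programWord nw k (evenPart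
      (entryOutput nw k (pre m (k + 1))))) (oddPart (entryOutput nw k (pre m (k + 1))))) + 3 := by
  have h2 : (k % 2 == 0) = false := by simpa using hk
  rw [program, programDigit, h2, cond_false]

theorem computable_entryInput : Computable entryInput := by
  unfold entryInput
  fun_prop

theorem computable_entryOutput (hnw : Computable nw) :
    Computable fun p : ℕ × List ℕ => entryOutput nw p.1 p.2 := by
  unfold entryOutput
  have := computable_entryInput
  fun_prop

theorem computable_programDigit (hnw : Computable nw) :
    Computable fun p : ℕ × List ℕ × List ℕ => programDigit nw p.1 p.2.1 p.2.2 := by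
  unfold programDigit
  have h1 := computable_entryInput
  have h2 : Computable fun p : ℕ × List ℕ × List ℕ => entryOutput nw p.1 p.2.1 :=
    (computable_entryOutput hnw).comp
      (g := fun p : ℕ × List ℕ × List ℕ => (p.1, p.2.1)) (by fun_prop)
  fun_prop

open Nat.Partrec in
-- The recursive calls change the memory, so this is no primitive recursion with fixed parameters.
-- The recursion theorem yields a code satisfying the recursion equation, and induction on the
-- length shows that it halts with the right word.
theorem computable_programWord (hnw : Computable nw) :
    Computable fun p : ℕ × List ℕ => programWord nw p.1 p.2 := by
  let word (x : ℕ) : List ℕ := (Encodable.decode x.unpair.2 : Option (List ℕ)).getD []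
  let next (x k : ℕ) : ℕ :=
    Nat.pair k (Encodable.encode (evenPart (entryOutput nw k (word x))))
  let join (x k a b : ℕ) : ℕ := Encodable.encode <|
    bif Nat.ble (word x).length k then (Encodable.decode a : Option (List ℕ)).getD [] else
      (Encodable.decode a : Option (List ℕ)).getD [] ++
        [programDigit nw k (word x) ((Encodable.decode b : Option (List ℕ)).getD [])]
  have hword : Computable word := by fun_prop
  have hnext : Computable fun p : ℕ × ℕ => next p.1 p.2 := by
    have : Computable fun p : ℕ × ℕ => entryOutput nw p.2 (word p.1) :=
      (computable_entryOutput hnw).comp (g := fun p : ℕ × ℕ => (p.2, word p.1)) (by fun_prop)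
    fun_prop
  have hjoin : Computable fun p : ℕ × ℕ × ℕ × ℕ => join p.1 p.2.1 p.2.2.1 p.2.2.2 := by
    have : Computable fun p : ℕ × ℕ × ℕ × ℕ => programDigit nw p.2.1 (word p.1)
        ((Encodable.decode p.2.2.2 : Option (List ℕ)).getD []) :=
      (computable_programDigit hnw).comp (g := fun p : ℕ × ℕ × ℕ × ℕ => (p.2.1, word p.1,
        (Encodable.decode p.2.2.2 : Option (List ℕ)).getD [])) (by fun_prop)
    fun_prop
  -- One unfolding of the recursion, with both recursive calls delegated to the code `c`.
  let F (c : Code) (x : ℕ) : Part ℕ :=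
    Nat.casesOn (motive := fun _ => Part ℕ) x.unpair.1
      (Part.some (Encodable.encode ([] : List ℕ))) fun k =>
        (c.eval (Nat.pair k x.unpair.2)).bind fun a =>
          (c.eval (next x k)).map fun b => join x k a b
  have hF : Partrec₂ F := by
    refine Partrec.nat_casesOn_right (f := fun p : Code × ℕ => p.2.unpair.1)
      (g := fun _ => Encodable.encode ([] : List ℕ))
      (h := fun p k => (p.1.eval (Nat.pair k p.2.unpair.2)).bind fun a =>
        (p.1.eval (next p.2 k)).map fun b => join p.2 k a b) (by fun_prop) (by fun_prop) ?_
    refine Partrec.bind (Partrec₂.comp Code.eval_part (g := fun q : (Code × ℕ) × ℕ => q.1.1)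
      (h := fun q => Nat.pair q.2 q.1.2.unpair.2) (by fun_prop) (by fun_prop)) ?_
    refine Partrec.map (Partrec₂.comp Code.eval_part (g := fun q : ((Code × ℕ) × ℕ) × ℕ => q.1.1.1)
      (h := fun q => next q.1.1.2 q.1.2) (by fun_prop) ?_) ?_
    · exact hnext.comp (g := fun q : ((Code × ℕ) × ℕ) × ℕ => (q.1.1.2, q.1.2)) (by fun_prop)
    · exact hjoin.comp (g := fun q : (((Code × ℕ) × ℕ) × ℕ) × ℕ =>
        (q.1.1.1.2, q.1.1.2, q.1.2, q.2)) (by fun_prop)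
  obtain ⟨c, hc⟩ := Code.fixed_point₂ hF
  have key : ∀ k u, c.eval (Nat.pair k (Encodable.encode u)) =
      Part.some (Encodable.encode (programWord nw k u)) := by
    intro k
    induction k with
    | zero =>
      intro u
      rw [hc]
      simp [F, programWord]
    | succ k ih =>
      intro u
      rw [hc]
      simp only [F, Nat.unpair_pair, ih, Part.bind_some, next, Part.map_some]
      simp [join, word, programWord]
  have h1 : Computable fun p : ℕ × List ℕ => Encodable.encode (programWord nw p.1 p.2) := by
    have : Partrec fun p : ℕ × List ℕ => c.eval (Nat.pair p.1 (Encodable.encode p.2)) :=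
      Partrec₂.comp Code.eval_part (g := fun _ : ℕ × List ℕ => c)
        (h := fun p => Nat.pair p.1 (Encodable.encode p.2)) (by fun_prop) (by fun_prop)
    exact this.of_eq_tot fun p => by rw [key]; exact Part.mem_some _
  exact Computable.encode_iff.1 h1

theorem computableMap_program (hnw : Computable nw) : ComputableMap (program nw) := by
  have h := computable_programWord hnw
  refine ComputableFun.of_approximates
    (h := fun u i => (programWord nw (i + 1) u)[i]?) ?_ fun m q hq => ?_
  · have : Computable fun p : List ℕ × ℕ => programWord nw (p.2 + 1) p.1 :=
      h.comp (g := fun p : List ℕ × ℕ => (p.2 + 1, p.1)) (by fun_prop)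
    fun_prop
  · obtain rfl := Part.mem_some_iff.1 hq
    simp only [Approximates, programWord_pre]
    refine ⟨fun n i k hk => (eq_of_pre_getElem? hk).2, fun i => ⟨i + 1, program nw m i, ?_⟩⟩
    exact pre_getElem?_eq (by omega)

end Program

/-- For every computable function `N` there are programs `g m` with memory `m` such that
`U⟨g m, r⟩ = ⟨g m', q⟩` whenever `N⟨m, r⟩ = ⟨m', q⟩`. -/
theorem exists_program {N : Baire →. Baire} (hN : ComputableFun N) :
    ∃ g : Baire → Baire, ComputableMap g ∧ (∀ m i, g m (2 * i) = codeDigit (m i)) ∧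
      ∀ m r y, y ∈ N (pair m r) → pair (g (first y)) (second y) ∈ univ (pair (g m) r) := by
  obtain ⟨nw, hnw, hmono, hsup⟩ := hN
  refine ⟨program nw, computableMap_program hnw, program_two_mul, fun m r y hy => ?_⟩
  have hpre : ∀ u, IsPrefixOf u (pair m r) → IsPrefixOf (nw u) y := fun u hu =>
    (hsup _ _ hy).1 _ ⟨u, hu, rfl⟩
  simp only [univ, Set.mem_ofPred_eq, first_pair, second_pair]
  have hword : ∀ k, IsPrefixOf (entryInput k) r →
      IsPrefixOf (entryOutput nw k (pre m (k + 1))) y := by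
    intro k hk
    refine hpre _ (isPrefixOf_interleave ?_ hk)
    rw [take_pre m (Nat.le_succ k)]
    exact isPrefixOf_pre m k
  constructor
  · rintro w ⟨v, k, hv, hk⟩
    by_cases h2 : k % 2 = 0
    · obtain ⟨i, rfl⟩ : ∃ i, k = 2 * i := ⟨k / 2, by omega⟩
      rw [program_two_mul] at hk
      rw [eq_nil_of_codeDigit hk]
      exact fun i hi => absurd hi (by simp)
    · rw [program_odd m h2] at hk
      have h3 := Prod.mk.inj (Encodable.encode_injective (Nat.add_right_cancel hk))
      rw [← h3.1] at hv
      have h4 := hword k hv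
      rw [← h3.2]
      refine isPrefixOf_interleave ?_ (isPrefixOf_oddPart h4)
      rw [programWord_eq (isPrefixOf_evenPart h4)]
      exact isPrefixOf_pre _ _
  · intro n
    obtain ⟨_, ⟨u, hu, rfl⟩, hl⟩ := (hsup _ _ hy).2 (2 * n)
    -- The position is odd, so it carries an entry, and its input is a long prefix of `r`. The
    -- padding makes `k` at least `u.length`, so that enough memory is read, and at least `n`, so
    -- that enough of the successor program is quoted.
    obtain ⟨k, hk2, hke, hkl⟩ : ∃ k, k % 2 ≠ 0 ∧ entryInput k = pre r u.length ∧
        max n u.length ≤ k := by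
      refine ⟨2 * Nat.pair (Encodable.encode (pre r u.length)) (max n u.length) + 1, by omega,
        ?_, ?_⟩
      · have : ∀ a, (2 * a + 1) / 2 = a := fun a => by omega
        simp [entryInput, this]
      · have := Nat.right_le_pair (Encodable.encode (pre r u.length)) (max n u.length)
        omega
    have hv : IsPrefixOf (entryInput k) r := hke ▸ isPrefixOf_pre _ _
    have h4 := hword k hv
    refine ⟨_, ⟨entryInput k, k, hv, program_odd m hk2⟩, ?_⟩
    have h5 : 2 * n ≤ (entryOutput nw k (pre m (k + 1))).length := by
      refine hl.trans (hmono _ _ (hu.prefix_of_le (isPrefixOf_interleave ?_ hv) ?_)).length_le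
      · rw [take_pre m (Nat.le_succ k)]
        exact isPrefixOf_pre m k
      · refine le_length_interleave ?_ ?_
        · rw [take_pre m (Nat.le_succ k), length_pre]; omega
        · rw [hke, length_pre]
    refine le_length_interleave ?_ (le_length_oddPart h5)
    rw [programWord_eq (isPrefixOf_evenPart h4), length_pre]
    have := le_length_evenPart h5
    omega

section Rounds

/-! ### One round of a loop -/

variable {f : Baire → Set Baire}

theorem mem_step {z s : Baire} : s ∈ step f z ↔
    (∀ r ∈ f (second z), (univ (pair (first z) r)).Nonempty) ∧
      ∃ r ∈ f (second z), s ∈ univ (pair (first z) r) := by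
  constructor
  · rintro ⟨h, y, ⟨r, hr, rfl⟩, hs⟩
    exact ⟨fun r hr => h ⟨r, hr, rfl⟩, r, hr, hs⟩
  · rintro ⟨h, r, hr, hs⟩
    refine ⟨?_, _, ⟨r, hr, rfl⟩, hs⟩
    rintro _ ⟨r, hr, rfl⟩
    exact h r hr

theorem mem_dom_step {z : Baire} : z ∈ dom (step f) ↔
    (f (second z)).Nonempty ∧ ∀ r ∈ f (second z), (univ (pair (first z) r)).Nonempty := by
  constructor
  · rintro ⟨s, hs⟩
    obtain ⟨h, r, hr, -⟩ := mem_step.1 hs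
    exact ⟨⟨r, hr⟩, h⟩
  · rintro ⟨⟨r, hr⟩, h⟩
    obtain ⟨s, hs⟩ := h r hr
    exact ⟨s, mem_step.2 ⟨h, r, hr, hs⟩⟩

theorem mem_step_of_mem_dom {z r s : Baire} (hz : z ∈ dom (step f)) (hr : r ∈ f (second z))
    (hs : s ∈ univ (pair (first z) r)) : s ∈ step f z :=
  mem_step.2 ⟨(mem_dom_step.1 hz).2, r, hr, hs⟩

theorem stage_nonempty {p : Baire} {n : ℕ} (h : ∀ i < n, stage f p i ⊆ dom (step f)) :
    (stage f p n).Nonempty := by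
  induction n with
  | zero => exact ⟨p, rfl⟩
  | succ n ih =>
    obtain ⟨x, hx⟩ := ih fun i hi => h i (by omega)
    obtain ⟨y, hy⟩ := h n (by omega) hx
    exact ⟨y, x, hx, hy⟩

theorem mem_stage_of_run {q : ℕ → Baire} {n : ℕ} (h : ∀ i < n, q (i + 1) ∈ step f (q i)) :
    q n ∈ stage f (q 0) n := by
  induction n with
  | zero => exact rfl
  | succ n ih => exact ⟨q n, ih fun i hi => h i (by omega), h n (by omega)⟩

/-! ### Repeated compositional products -/

/-- The nested domain conditions of the compositions unfold to conditions on stages: each further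
power moves one stage into the domain of `step f`. The last round stops before `U` is applied, so
program and answer stay visible. -/
theorem mem_power_succ {p z : Baire} {n : ℕ} : z ∈ power f (n + 1) p ↔
    (∀ i < n, stage f p i ⊆ dom (step f)) ∧ (∀ x ∈ stage f p n, (f (second x)).Nonempty) ∧
      ∃ x ∈ stage f p n, ∃ r ∈ f (second x), z = pair (first x) r := by
  induction n generalizing z with
  | zero =>
    constructor
    · rintro ⟨r, hr, rfl⟩
      refine ⟨fun i hi => by omega, ?_, p, rfl, r, hr, rfl⟩
      rintro x rfl
      exact ⟨r, hr⟩
    · rintro ⟨-, -, x, rfl, r, hr, rfl⟩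
      exact ⟨r, hr, rfl⟩
  | succ n ih =>
    constructor
    · rintro ⟨h1, y, ⟨h2, u, hu, hy⟩, r, hr, rfl⟩
      obtain ⟨h3, h4, x, hx, r', hr', rfl⟩ := ih.1 hu
      have hdom : ∀ i < n + 1, stage f p i ⊆ dom (step f) := by
        intro i hi
        rcases Nat.lt_succ_iff_lt_or_eq.1 hi with hi | rfl
        · exact h3 i hi
        · exact fun x hx => mem_dom_step.2 ⟨h4 x hx, fun r hr =>
            h2 (ih.2 ⟨h3, h4, x, hx, r, hr, rfl⟩)⟩
      refine ⟨hdom, ?_, y, ⟨x, hx, mem_step_of_mem_dom (hdom n (by omega) hx) hr' hy⟩, r, hr, rfl⟩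
      rintro y' ⟨x', hx', hy'⟩
      obtain ⟨-, r', hr', hy'⟩ := mem_step.1 hy'
      obtain ⟨_, r, hr, -⟩ := h1 ⟨h2, _, ih.2 ⟨h3, h4, x', hx', r', hr', rfl⟩, hy'⟩
      exact ⟨r, hr⟩
    · rintro ⟨h1, h2, y, ⟨x, hx, hy⟩, r, hr, rfl⟩
      have h3 : ∀ i < n, stage f p i ⊆ dom (step f) := fun i hi => h1 i (by omega)
      have h4 : ∀ x ∈ stage f p n, (f (second x)).Nonempty := fun x hx =>
        (mem_dom_step.1 (h1 n (by omega) hx)).1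
      have h5 : power f (n + 1) p ⊆ dom univ := by
        intro u hu
        obtain ⟨-, -, x, hx, r, hr, rfl⟩ := ih.1 hu
        exact (mem_dom_step.1 (h1 n (by omega) hx)).2 r hr
      obtain ⟨-, r', hr', hy'⟩ := mem_step.1 hy
      refine ⟨?_, y, ⟨h5, _, ih.2 ⟨h3, h4, x, hx, r', hr', rfl⟩, hy'⟩, r, hr, rfl⟩
      rintro y' ⟨-, u, hu, hy'⟩
      obtain ⟨-, -, x', hx', r', hr', rfl⟩ := ih.1 hu
      obtain ⟨r, hr⟩ := h2 y' ⟨x', hx', mem_step_of_mem_dom (h1 n (by omega) hx') hr' hy'⟩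
      exact ⟨_, r, hr, rfl⟩

theorem mem_power_succ_of_dom {p z : Baire} (hp : ∀ i, stage f p i ⊆ dom (step f)) {n : ℕ} :
    z ∈ power f (n + 1) p ↔
      ∃ x ∈ stage f p n, ∃ r ∈ f (second x), z = pair (first x) r :=
  ⟨fun h => (mem_power_succ.1 h).2.2, fun h => mem_power_succ.2 ⟨fun i _ => hp i, fun _ hx =>
    (mem_dom_step.1 (hp n hx)).1, h⟩⟩

/-- The power `n + 1` needs the first `n` stages in the domain, so all powers together need all of
them. This is the domain of the inverse limit; the difference is that the powers may use different
runs. -/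
theorem mem_dom_omega {p : Baire} : p ∈ dom (omega f) ↔ ∀ i, stage f p i ⊆ dom (step f) := by
  constructor
  · rintro ⟨_, q, hq, -⟩ i
    exact (mem_power_succ.1 (hq (i + 2))).1 i (by omega)
  · intro h
    have : ∀ n, (power f n p).Nonempty := by
      intro n
      rcases n with _ | n
      · exact ⟨p, rfl⟩
      · obtain ⟨x, hx⟩ := stage_nonempty (n := n) fun i _ => h i
        obtain ⟨r, hr⟩ := (mem_dom_step.1 (h n hx)).1
        exact ⟨_, (mem_power_succ_of_dom h).2 ⟨x, hx, r, hr, rfl⟩⟩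
    choose q hq using this
    exact ⟨_, q, hq, rfl⟩

theorem mem_dom_invLimit {p : Baire} :
    p ∈ dom (invLimit f) ↔ ∀ i, stage f p i ⊆ dom (step f) := by
  constructor
  · rintro ⟨_, h, -⟩
    exact h
  · intro h
    have : ∀ i (x : stage f p i), ∃ y : stage f p (i + 1), y.1 ∈ step f x.1 := by
      rintro i ⟨x, hx⟩
      obtain ⟨y, hy⟩ := h i hx
      exact ⟨⟨y, x, hx, hy⟩, hy⟩
    choose next hnext using this
    let q : ∀ i, stage f p i := fun i => Nat.rec ⟨p, rfl⟩ (fun i x => next i x) i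
    exact ⟨_, h, fun i => (q i).1, rfl, fun i => hnext i (q i), rfl⟩

/-! ### Programs with memory in loops -/

section ProgramStep

variable {N : Baire →. Baire} {g : Baire → Baire}
  (hg : ∀ m r y, y ∈ N (pair m r) → pair (g (first y)) (second y) ∈ univ (pair (g m) r))

include hg

theorem program_mem_dom_step {m q : Baire} (hq : (f q).Nonempty)
    (hN : ∀ r ∈ f q, ∃ y, y ∈ N (pair m r)) : pair (g m) q ∈ dom (step f) := by
  rw [mem_dom_step, first_pair, second_pair]
  refine ⟨hq, fun r hr => ?_⟩
  obtain ⟨y, hy⟩ := hN r hr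
  exact ⟨_, hg m r y hy⟩

theorem exists_of_mem_step_program {m q s : Baire} (hN : ∀ r ∈ f q, ∃ y, y ∈ N (pair m r))
    (hs : s ∈ step f (pair (g m) q)) :
    ∃ r ∈ f q, ∃ y ∈ N (pair m r), s = pair (g (first y)) (second y) := by
  obtain ⟨-, r, hr, hs⟩ := mem_step.1 hs
  rw [second_pair] at hr
  rw [first_pair] at hs
  obtain ⟨y, hy⟩ := hN r hr
  exact ⟨r, hr, y, hy, mem_univ_unique hs (hg m r y hy)⟩

end ProgramStep

/-- The memory of the program in the first component. -/
def memory (x : Baire) : Baire := fun k => decodeDigit (x (4 * k))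

/-- The factor 4 in `memory` comes from two interleavings: the program occupies the even positions
of the state, and the memory the even positions of the program. -/
theorem memory_pair {g : Baire → Baire} (hg : ∀ m i, g m (2 * i) = codeDigit (m i))
    (m q : Baire) : memory (pair (g m) q) = m := by
  funext k
  have h1 : 4 * k % 2 = 0 := by omega
  have h2 : 4 * k / 2 = 2 * k := by omega
  simp [memory, pair, h1, h2, hg]

theorem pair_program_zero_iff {g : Baire → Baire} (hg : ∀ m i, g m (2 * i) = codeDigit (m i))
    (m q : Baire) : pair (g m) q 0 = 0 ↔ m 0 = 0 := by
  have := hg m 0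
  simp only [mul_zero] at this
  simp [pair, this, codeDigit_eq_zero_iff]

/-! ### Reducibility of problems on Baire space -/

theorem IsRealizer.congr {F : Baire → Set Baire} {R S : Baire →. Baire} (hR : IsRealizer R F)
    (h : ∀ p, S p = R p) : IsRealizer S F := (funext h : S = R) ▸ hR

/-- On Baire space every point is its own only name, so a realizer merely selects values and it
suffices to treat all values of `G`. -/
theorem strongWeihrauchLE_of_computableFun {F G : Baire → Set Baire} {H K : Baire →. Baire}
    (hH : ComputableFun H) (hK : ComputableFun K)
    (h : ∀ p ∈ dom F, ∃ k ∈ K p, k ∈ dom G ∧ ∀ s ∈ G k, ∃ t ∈ H s, t ∈ F p) :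
    StrongWeihrauchLE F G := by
  refine ⟨H, K, hH, hK, fun R hR p x hx hdom => ?_⟩
  obtain rfl : x = p := Part.mem_some_iff.1 hx
  obtain ⟨k, hk, hkd, hs⟩ := h x hdom
  obtain ⟨s, hsR, y, hy, hsy⟩ := hR k k (Part.mem_some _) hkd
  obtain rfl : y = s := Part.mem_some_iff.1 hy
  obtain ⟨t, ht, htF⟩ := hs y hsy
  exact ⟨t, Part.mem_bind_iff.2 ⟨k, hk, Part.mem_bind_iff.2 ⟨y, hsR, ht⟩⟩, t, Part.mem_some _, htF⟩

theorem strongWeihrauchLE_of_maps {F G : Baire → Set Baire} {H K : Baire → Baire}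
    (hH : ComputableMap H) (hK : ComputableMap K)
    (h : ∀ p ∈ dom F, K p ∈ dom G ∧ ∀ s ∈ G (K p), H s ∈ F p) : StrongWeihrauchLE F G :=
  strongWeihrauchLE_of_computableFun hH hK fun p hp =>
    ⟨K p, Part.mem_some _, (h p hp).1, fun s hs => ⟨H s, Part.mem_some _, (h p hp).2 s hs⟩⟩

theorem StrongWeihrauchLE.trans {F G E : Baire → Set Baire} (h₁ : StrongWeihrauchLE F G)
    (h₂ : StrongWeihrauchLE G E) : StrongWeihrauchLE F E := by
  obtain ⟨H₁, K₁, hH₁, hK₁, h₁⟩ := h₁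
  obtain ⟨H₂, K₂, hH₂, hK₂, h₂⟩ := h₂
  refine ⟨_, _, hH₂.bind hH₁, hK₁.bind hK₂, fun R hR => ?_⟩
  refine (h₁ _ (h₂ R hR)).congr fun p => ?_
  refine (Part.bind_assoc (K₁ p) K₂ _).trans (congrArg (Part.bind (K₁ p)) (funext fun k => ?_))
  exact ((Part.bind_assoc (K₂ k) _ H₁).trans (congrArg (Part.bind (K₂ k)) (funext fun l =>
    Part.bind_assoc (R l) H₂ H₁))).symm

/-- The original input stays available in the first component of the argument of `H₁`. This
transfers the failure of a reduction from the omega operation to the parallelized diamond. -/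
theorem WeihrauchLE.trans_strong {F G E : Baire → Set Baire} (h₁ : WeihrauchLE F G)
    (h₂ : StrongWeihrauchLE G E) : WeihrauchLE F E := by
  obtain ⟨H₁, K₁, hH₁, hK₁, h₁⟩ := h₁
  obtain ⟨H₂, K₂, hH₂, hK₂, h₂⟩ := h₂
  refine ⟨fun z => (H₂ (second z)).bind fun r => H₁ (pair (first z) r), _, ?_, hK₁.bind hK₂,
    fun R hR => ?_⟩
  · have h := (ComputableFun.pair computableMap_first
      (hH₂.comp_map computableMap_second)).bind hH₁
    refine h.mono fun z q hq => ?_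
    obtain ⟨r, hr, hq⟩ := Part.mem_bind_iff.1 hq
    exact Part.mem_bind_iff.2 ⟨_, Part.mem_bind_iff.2 ⟨_, Part.mem_some _,
      (Part.mem_map_iff _).2 ⟨r, hr, rfl⟩⟩, hq⟩
  · refine (h₁ _ (h₂ R hR)).congr fun p => ?_
    simp only [first_pair, second_pair]
    refine (Part.bind_assoc (K₁ p) K₂ _).trans (congrArg (Part.bind (K₁ p)) (funext fun k => ?_))
    exact ((Part.bind_assoc (K₂ k) _ _).trans (congrArg (Part.bind (K₂ k)) (funext fun l =>
      Part.bind_assoc (R l) H₂ _))).symm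

/-! ### The omega operation is reducible to the inverse limit -/

/-- The loop is simulated with memory `⟨z, x⟩`, where `x` is the simulated state and `z` the pair of
program and answer from which `U` produced it. After `n` rounds `z` is a value of `f^[n]`; initially
both are `p`. -/
theorem omega_le_invLimit (f : Baire → Set Baire) : StrongWeihrauchLE (omega f) (invLimit f) := by
  -- For `w = ⟨⟨z, x⟩, r⟩` this is `⟨first x, r⟩`, the argument of `U` in the simulated round.
  let Z : Baire → Baire := fun w => pair (first (second (first w))) (second w)
  have hZ : ComputableMap Z := (computableMap_first.comp (computableMap_second.comp
    computableMap_first)).pair computableMap_second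
  let N : Baire →. Baire := fun w =>
    (univFun (Z w)).map fun x => pair (pair (Z w) x) (second x)
  have hN : ComputableFun N := by
    have h := (ComputableFun.pair hZ (computableFun_univFun.comp_map hZ)).map
      (computableMap_id.pair (computableMap_second.comp computableMap_second))
    refine h.mono fun w q hq => ?_
    obtain ⟨x, hx, rfl⟩ := (Part.mem_map_iff _).1 hq
    exact (Part.mem_map_iff _).2 ⟨pair (Z w) x, Part.mem_bind_iff.2 ⟨_, Part.mem_some _,
      (Part.mem_map_iff _).2 ⟨x, hx, rfl⟩⟩, by simp⟩
  obtain ⟨g, hgc, hgd, hg⟩ := exists_program hN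
  let K : Baire → Baire := fun p => pair (g (pair p p)) (second p)
  let H : Baire → Baire := fun s => tuple fun n => first (memory (component s n))
  have hK : ComputableMap K :=
    (hgc.comp (computableMap_id.pair computableMap_id)).pair computableMap_second
  have hH : ComputableMap H :=
    ComputableMap.of_digit (fun i => Nat.pair i.unpair.1 (4 * (2 * i.unpair.2)))
      (fun _ m => decodeDigit m) (by fun_prop) (by fun_prop) fun p i => rfl
  refine strongWeihrauchLE_of_maps hH hK fun p hp => ?_
  rw [mem_dom_omega] at hp
  have hstep : ∀ z x i, x ∈ stage f p i →
      pair (g (pair z x)) (second x) ∈ dom (step f) ∧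
      ∀ s ∈ step f (pair (g (pair z x)) (second x)), ∃ r ∈ f (second x),
        ∃ x' ∈ stage f p (i + 1), s = pair (g (pair (pair (first x) r) x')) (second x') := by
    intro z x i hx
    have hxd := hp i hx
    have hdef : ∀ r ∈ f (second x), ∃ y, y ∈ N (pair (pair z x) r) := by
      intro r hr
      obtain ⟨x', hx'⟩ := (mem_dom_step.1 hxd).2 r hr
      exact ⟨_, (Part.mem_map_iff _).2 ⟨x', mem_univFun.2 (by simpa [Z] using hx'), rfl⟩⟩
    refine ⟨program_mem_dom_step hg (mem_dom_step.1 hxd).1 hdef, fun s hs => ?_⟩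
    obtain ⟨r, hr, y, hy, rfl⟩ := exists_of_mem_step_program hg hdef hs
    obtain ⟨x', hx', rfl⟩ := (Part.mem_map_iff _).1 hy
    have hx'' := mem_univFun.1 hx'
    simp only [Z, first_pair, second_pair] at hx'' ⊢
    exact ⟨r, hr, x', ⟨x, hx, mem_step_of_mem_dom hxd hr hx''⟩, rfl⟩
  have hinv : ∀ i, ∀ s ∈ stage f (K p) i, ∃ z ∈ power f i p, ∃ x ∈ stage f p i,
      s = pair (g (pair z x)) (second x) := by
    intro i
    induction i with
    | zero => rintro s rfl; exact ⟨p, rfl, p, rfl, rfl⟩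
    | succ i ih =>
      rintro s ⟨t, ht, hs⟩
      obtain ⟨z, -, x, hx, rfl⟩ := ih t ht
      obtain ⟨r, hr, x', hx', rfl⟩ := (hstep z x i hx).2 s hs
      exact ⟨_, (mem_power_succ_of_dom hp).2 ⟨x, hx, r, hr, rfl⟩, x', hx', rfl⟩
  constructor
  · rw [mem_dom_invLimit]
    intro i s hs
    obtain ⟨z, -, x, hx, rfl⟩ := hinv i s hs
    exact (hstep z x i hx).1
  · rintro _ ⟨-, q, hq0, hq, rfl⟩
    refine ⟨_, fun n => ?_, rfl⟩
    obtain ⟨z, hz, x, -, hx⟩ := hinv n (q n) (hq0 ▸ mem_stage_of_run fun i _ => hq i)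
    rw [component_tuple, hx, memory_pair hgd, first_pair]
    exact hz

/-! ### The omega operation is reducible to the parallelized diamond -/

/-- Follow any run: inside `diamondDom` it can neither stall nor avoid zero forever, so it
terminates with a value. -/
theorem dom_diamond (f : Baire → Set Baire) : dom (diamond f) = diamondDom f := by
  ext q₀
  refine ⟨fun ⟨_, h, _⟩ => h, fun h => ?_⟩
  classical
  let next : Baire → Baire := fun x => if hx : (step f x).Nonempty then hx.some else x
  let q : ℕ → Baire := fun i => Nat.rec (motive := fun _ => Baire) q₀ (fun _ x => next x) i
  have hnext : ∀ i, q i ∈ dom (step f) → q (i + 1) ∈ step f (q i) := by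
    intro i (hi : (step f (q i)).Nonempty)
    change next (q i) ∈ _
    simp only [next, dif_pos hi]
    exact hi.some_mem
  have hrun : ∀ k, (∀ i < k, q i 0 ≠ 0) → IsFiniteRun f k q := by
    intro k
    induction k with
    | zero => exact fun _ i hi => absurd hi (by omega)
    | succ k ih =>
      intro hk i hi
      have hk' := ih fun i hi => hk i (by omega)
      rcases Nat.lt_succ_iff_lt_or_eq.1 hi with hi | rfl
      · exact hk' i hi
      · by_contra hc
        exact h.1 i q rfl hk' ⟨fun hd => hc (hnext i hd), fun j hj => hk j (by omega)⟩
  rcases Classical.em (∃ i : ℕ, q i 0 = 0) with hz | hz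
  · obtain ⟨k, hk, hmin⟩ : ∃ k : ℕ, (fun i => q i 0 = 0) k ∧ ∀ i < k, ¬ (fun i => q i 0 = 0) i :=
      ⟨Nat.find hz, Nat.find_spec hz, fun i hi => Nat.find_min hz hi⟩
    exact ⟨_, h, k, q, rfl, hrun k hmin, ⟨hk, hmin⟩, rfl⟩
  · rw [not_exists] at hz
    exact absurd hz (h.2 q rfl fun i => hrun (i + 1) (fun j _ => hz j) i (by omega))

theorem mem_dom_parallel {F : Baire → Set Baire} {z : Baire} :
    z ∈ dom (parallel F) ↔ ∀ i, component z i ∈ dom F := by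
  constructor
  · rintro ⟨_, q, hq, -⟩ i
    exact ⟨_, hq i⟩
  · intro h
    choose q hq using h
    exact ⟨_, q, hq, rfl⟩

/-- The `n`-th diamond carries a counter starting at `n` as the first digit of its memory and stops
exactly when the counter is zero; the rest of the memory is then a value of `f^[n]`. For `n = 0` it
stops at once with `p`. -/
theorem omega_le_parallel_diamond (f : Baire → Set Baire) :
    StrongWeihrauchLE (omega f) (parallel (diamond f)) := by
  let Z : Baire → Baire := fun w => pair (first (tail (first w))) (second w)
  have hZ : ComputableMap Z := (computableMap_first.comp (computableMap_tail.comp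
    computableMap_first)).pair computableMap_second
  let dec : Baire → Baire := fun v => cons (v 0 - 1) (second v)
  have hdec : ComputableMap dec :=
    ComputableMap.of_digit (fun i => bif i == 0 then 0 else 2 * (i - 1) + 1)
      (fun i m => bif i == 0 then m - 1 else m) (by fun_prop) (by fun_prop)
      fun v i => by cases i <;> simp [dec, cons, second]
  -- In the last round the pair of program and answer is stored without applying `U`, because
  -- `f^[n]` ends with `⟨id × f⟩`. The query written there is never asked.
  let N : Baire →. Baire := fun w => if Nat.ble (w 0) 1 = true
    then Part.some (pair (cons 0 (Z w)) (Z w))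
    else (univFun (Z w)).map fun x => pair (cons (w 0 - 1) x) (second x)
  have hN : ComputableFun N := by
    refine ComputableFun.ite (((computableMap_cons 0).comp hZ).pair hZ) ?_ 0
      (c := fun m => Nat.ble m 1) (by fun_prop)
    have h := (ComputableFun.pair computableMap_id (computableFun_univFun.comp_map hZ)).map
      (hdec.pair (computableMap_second.comp computableMap_second))
    refine h.mono fun w q hq => ?_
    obtain ⟨x, hx, rfl⟩ := (Part.mem_map_iff _).1 hq
    exact (Part.mem_map_iff _).2 ⟨pair w x, Part.mem_bind_iff.2 ⟨_, Part.mem_some _,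
      (Part.mem_map_iff _).2 ⟨x, hx, rfl⟩⟩, by simp [dec]; simp [pair]⟩
  obtain ⟨g, hgc, hgd, hg⟩ := exists_program hN
  let K : Baire → Baire := fun p => tuple fun n => pair (g (cons n p)) (second p)
  let H : Baire → Baire := fun s => tuple fun n => tail (memory (component s n))
  have hK : ComputableMap K := ComputableMap.tuple_cons
    (hgc.pair (computableMap_second.comp computableMap_tail))
  have hH : ComputableMap H :=
    ComputableMap.of_digit (fun i => Nat.pair i.unpair.1 (4 * (i.unpair.2 + 1)))
      (fun _ m => decodeDigit m) (by fun_prop) (by fun_prop) fun p i => rfl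
  refine strongWeihrauchLE_of_maps hH hK fun p hp => ?_
  rw [mem_dom_omega] at hp
  -- After `k` rounds the counter is `n - k`: either the simulation is still running in a state of
  -- stage `k`, or it has stopped and holds a value of the power.
  let Inv (n k : ℕ) (s : Baire) : Prop :=
    (k < n ∧ ∃ x ∈ stage f p k, s = pair (g (cons (n - k) x)) (second x)) ∨
      (k = n ∧ ∃ z ∈ power f n p, ∃ z', s = pair (g (cons 0 z)) z')
  have hstep : ∀ n k s, Inv n k s → s 0 ≠ 0 →
      s ∈ dom (step f) ∧ ∀ s' ∈ step f s, Inv n (k + 1) s' := by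
    rintro n k s (⟨hk, x, hx, rfl⟩ | ⟨-, z, -, z', rfl⟩) hs0
    · have hxd := hp k hx
      have hw0 : ∀ r, pair (cons (n - k) x) r 0 = n - k := fun r => by simp [pair]
      have hZr : ∀ r, Z (pair (cons (n - k) x) r) = pair (first x) r := fun r => by simp [Z]
      by_cases hlast : n - k ≤ 1
      · have hNr : ∀ r, N (pair (cons (n - k) x) r) =
            Part.some (pair (cons 0 (pair (first x) r)) (pair (first x) r)) := fun r => by
          simp only [N, hw0, hZr]
          rw [if_pos (by simpa using hlast)]
        have hdef : ∀ r ∈ f (second x), ∃ y, y ∈ N (pair (cons (n - k) x) r) :=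
          fun r _ => ⟨_, by rw [hNr]; exact Part.mem_some _⟩
        refine ⟨program_mem_dom_step hg (mem_dom_step.1 hxd).1 hdef, fun s' hs' => ?_⟩
        obtain ⟨r, hr, y, hy, rfl⟩ := exists_of_mem_step_program hg hdef hs'
        rw [hNr] at hy
        obtain rfl := Part.mem_some_iff.1 hy
        obtain rfl : n = k + 1 := by omega
        refine Or.inr ⟨rfl, pair (first x) r, (mem_power_succ_of_dom hp).2 ⟨x, hx, r, hr, rfl⟩,
          pair (first x) r, ?_⟩
        rw [first_pair, second_pair]
      · have hNr : ∀ r, N (pair (cons (n - k) x) r) =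
            (univFun (pair (first x) r)).map fun x' => pair (cons (n - k - 1) x') (second x') :=
          fun r => by
            simp only [N, hw0, hZr]
            rw [if_neg (by simpa using hlast)]
        have hdef : ∀ r ∈ f (second x), ∃ y, y ∈ N (pair (cons (n - k) x) r) := by
          intro r hr
          obtain ⟨x', hx'⟩ := (mem_dom_step.1 hxd).2 r hr
          exact ⟨_, by rw [hNr]; exact (Part.mem_map_iff _).2 ⟨x', mem_univFun.2 hx', rfl⟩⟩
        refine ⟨program_mem_dom_step hg (mem_dom_step.1 hxd).1 hdef, fun s' hs' => ?_⟩
        obtain ⟨r, hr, y, hy, rfl⟩ := exists_of_mem_step_program hg hdef hs'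
        rw [hNr] at hy
        obtain ⟨x', hx', rfl⟩ := (Part.mem_map_iff _).1 hy
        refine Or.inl ⟨by omega, x', ⟨x, hx, mem_step_of_mem_dom hxd hr (mem_univFun.1 hx')⟩, ?_⟩
        rw [first_pair, second_pair, Nat.sub_sub]
    · exact absurd ((pair_program_zero_iff hgd _ _).2 rfl) hs0
  have hrun : ∀ n k (q : ℕ → Baire), q 0 = component (K p) n → IsFiniteRun f k q →
      (∀ i < k, q i 0 ≠ 0) → Inv n k (q k) := by
    intro n k q h0 hq hnz
    induction k with
    | zero =>
      rw [component_tuple] at h0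
      rcases n with _ | n
      · exact Or.inr ⟨rfl, p, rfl, _, h0⟩
      · exact Or.inl ⟨by omega, p, rfl, h0⟩
    | succ k ih =>
      exact (hstep n k _ (ih (fun i hi => hq i (by omega)) fun i hi => hnz i (by omega))
        (hnz k (by omega))).2 _ (hq k (by omega))
  constructor
  · rw [mem_dom_parallel]
    intro n
    rw [dom_diamond]
    refine ⟨fun k q h0 hq hst => ?_, fun q h0 hq hnz => ?_⟩
    · exact hst.1 (hstep n k _ (hrun n k q h0 hq fun i hi => hst.2 i hi.le) (hst.2 k le_rfl)).1
    · rcases hrun n (n + 1) q h0 (fun i _ => hq i) fun i _ => hnz i with ⟨h, -⟩ | ⟨h, -⟩ <;> omega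
  · rintro _ ⟨t, ht, rfl⟩
    refine ⟨_, fun n => ?_, rfl⟩
    obtain ⟨-, k, q, h0, hq, hsuc, hk⟩ := ht n
    rcases hrun n k q h0 hq hsuc.2 with ⟨hkn, x, -, hx⟩ | ⟨-, z, hz, z', hx⟩
    · have h := hsuc.1
      rw [hx, pair_program_zero_iff hgd] at h
      simp at h
      omega
    · rw [component_tuple, hk, hx, memory_pair hgd, tail_cons]
      exact hz

end Rounds

/-! ### Word simulation of loops -/

/-- The word function `uw` computes the universal function. -/
structure IsUnivWord (uw : List ℕ → List ℕ) : Prop where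
  computable : Computable uw
  mono : ∀ u v : List ℕ, u <+: v → uw u <+: uw v
  isPrefixOf : ∀ z r : Baire, r ∈ univ z → ∀ u, IsPrefixOf u z → IsPrefixOf (uw u) r
  unbounded : ∀ z r : Baire, r ∈ univ z → ∀ n, ∃ u, IsPrefixOf u z ∧ n ≤ (uw u).length

theorem exists_isUnivWord : ∃ uw, IsUnivWord uw := by
  obtain ⟨uw, h1, h2, h3⟩ := computableFun_univFun
  refine ⟨uw, h1, h2, fun z r hr u hu => ?_, fun z r hr n => ?_⟩
  · exact (h3 z r (mem_univFun.2 hr)).1 _ ⟨u, hu, rfl⟩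
  · obtain ⟨_, ⟨u, hu, rfl⟩, hl⟩ := (h3 z r (mem_univFun.2 hr)).2 n
    exact ⟨u, hu, hl⟩

/-- One round of a loop on words: the prefix `u` of the current value and the prefix `w` of the
answer determine a prefix of the next value. -/
def nextWord (uw : List ℕ → List ℕ) (u w : List ℕ) : List ℕ := uw (interleave (evenPart u) w)

section WordSimulation

variable {uw : List ℕ → List ℕ} (huw : IsUnivWord uw)

include huw

theorem computable_nextWord {α : Type*} [Primcodable α] {u w : α → List ℕ} (hu : Computable u)
    (hw : Computable w) : Computable fun a => nextWord uw (u a) (w a) := by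
  have := huw.computable
  unfold nextWord
  fun_prop

theorem isPrefixOf_nextWord {u w : List ℕ} {x r x' : Baire} (hu : IsPrefixOf u x)
    (hw : IsPrefixOf w r) (hx' : x' ∈ univ (pair (first x) r)) :
    IsPrefixOf (nextWord uw u w) x' :=
  huw.isPrefixOf _ _ hx' _ (isPrefixOf_interleave (isPrefixOf_evenPart hu) hw)

/-- Continuity of `U`, with a bound that works for all sufficiently long prefixes, so that bounds of
successive rounds can be chained. -/
theorem exists_le_length_nextWord {x r x' : Baire} (hx' : x' ∈ univ (pair (first x) r)) (l : ℕ) :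
    ∃ N, ∀ u w, IsPrefixOf u x → IsPrefixOf w r → N ≤ u.length → N ≤ w.length →
      l ≤ (nextWord uw u w).length := by
  obtain ⟨v, hv, hl⟩ := huw.unbounded _ _ hx' l
  refine ⟨2 * v.length, fun u w hu hw hul hwl => hl.trans ?_⟩
  refine (huw.mono _ _ (hv.prefix_of_le
    (isPrefixOf_interleave (isPrefixOf_evenPart hu) hw) ?_)).length_le
  exact le_length_interleave (le_length_evenPart hul) (by omega)

end WordSimulation

/-- The first digit is known to be zero. -/
def zeroHead (u : List ℕ) : Bool := (u[0]?).elim false fun m => m == 0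

/-- The first digit is known to be different from zero. -/
def nonzeroHead (u : List ℕ) : Bool := (u[0]?).elim false fun m => !(m == 0)

/-- The loop, started with prefix `u` and given answers with the listed prefixes, is known to
terminate successfully with the last answer. -/
def haltsFrom (uw : List ℕ → List ℕ) : List ℕ → List (List ℕ) → Bool
  | u, [] => zeroHead u
  | u, w :: W => nonzeroHead u && haltsFrom uw (nextWord uw u w) W

/-- The loop, started with `x` and given answers with the listed prefixes, terminates
successfully with the last answer. -/
def HaltsOn : Baire → List (List ℕ) → Prop
  | x, [] => x 0 = 0
  | x, w :: W => x 0 ≠ 0 ∧ ∀ r, IsPrefixOf w r → ∀ x' ∈ univ (pair (first x) r), HaltsOn x' W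

theorem zeroHead_eq_true {u : List ℕ} : zeroHead u = true ↔ u[0]? = some 0 := by
  rcases h : u[0]? with _ | m <;> simp [zeroHead, h]

theorem nonzeroHead_eq_true {u : List ℕ} : nonzeroHead u = true ↔ ∃ m, u[0]? = some (m + 1) := by
  rcases h : u[0]? with _ | m
  · simp [nonzeroHead, h]
  · rcases m with _ | m <;> simp [nonzeroHead, h]

section WordSimulation

variable {uw : List ℕ → List ℕ} (huw : IsUnivWord uw)

include huw

/-- The state word changes along the recursion, so it is rewritten as a left fold carrying the word
and the conjunction of the tests made so far. -/
theorem computable_haltsFrom {α : Type*} [Primcodable α] {u : α → List ℕ} {W : α → List (List ℕ)}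
    (hu : Computable u) (hW : Computable W) : Computable fun a => haltsFrom uw (u a) (W a) := by
  have key : ∀ (W : List (List ℕ)) (u : List ℕ) (b : Bool), (b && haltsFrom uw u W) =
      ((W.foldl (fun s w => (nextWord uw s.1 w, s.2 && nonzeroHead s.1)) (u, b)).2 &&
        zeroHead (W.foldl (fun s w => (nextWord uw s.1 w, s.2 && nonzeroHead s.1)) (u, b)).1) := by
    intro W
    induction W with
    | nil => intro u b; rfl
    | cons w W ih =>
      intro u b
      rw [List.foldl_cons, ← ih, haltsFrom, Bool.and_assoc]
  have h0 : Computable zeroHead := by unfold zeroHead; fun_prop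
  have h1 : Computable nonzeroHead := by unfold nonzeroHead; fun_prop
  have h2 : Computable fun p : α × (List ℕ × Bool) × List ℕ => nextWord uw p.2.1.1 p.2.2 :=
    computable_nextWord huw (by fun_prop) (by fun_prop)
  refine Computable.of_eq (f := fun a => true && haltsFrom uw (u a) (W a)) ?_
    fun a => Bool.true_and _
  simp only [key]
  fun_prop

theorem nextWord_mono {u v : List ℕ} (huv : u <+: v) (w : List ℕ) :
    nextWord uw u w <+: nextWord uw v w := by
  have h : evenPart u <+: evenPart v :=
    knownWord_prefix huv.length_le fun i m h => getElem?_of_prefix huv h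
  refine huw.mono _ _ (knownWord_prefix (by have := h.length_le; omega) fun i m hi => ?_)
  rcases hb : i % 2 == 0 with _ | _
  · simpa [hb] using hi
  · simp only [hb, cond_true] at hi ⊢
    exact getElem?_of_prefix h hi

theorem haltsFrom_mono (W : List (List ℕ)) {u v : List ℕ} (huv : u <+: v)
    (h : haltsFrom uw u W = true) : haltsFrom uw v W = true := by
  induction W generalizing u v with
  | nil => exact zeroHead_eq_true.2 (getElem?_of_prefix huv (zeroHead_eq_true.1 h))
  | cons w W ih =>
    obtain ⟨h1, h2⟩ := Bool.and_eq_true_iff.1 h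
    obtain ⟨m, hm⟩ := nonzeroHead_eq_true.1 h1
    exact Bool.and_eq_true_iff.2 ⟨nonzeroHead_eq_true.2 ⟨m, getElem?_of_prefix huv hm⟩,
      ih (nextWord_mono huw huv w) h2⟩

/-- The test has seen only prefixes, so its verdict holds for all answers extending them. -/
theorem haltsOn_of_haltsFrom (W : List (List ℕ)) {u : List ℕ} {x : Baire} (hu : IsPrefixOf u x)
    (h : haltsFrom uw u W = true) : HaltsOn x W := by
  induction W generalizing u x with
  | nil => exact isPrefixOf_iff_getElem?.1 hu 0 0 (zeroHead_eq_true.1 h)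
  | cons w W ih =>
    obtain ⟨h1, h2⟩ := Bool.and_eq_true_iff.1 h
    obtain ⟨m, hm⟩ := nonzeroHead_eq_true.1 h1
    refine ⟨?_, fun r hr x' hx' => ih (isPrefixOf_nextWord huw hu hr hx') h2⟩
    rw [isPrefixOf_iff_getElem?.1 hu 0 _ hm]
    omega

/-- A successful run is finite and is certified by first digits, so finite prefixes of the answers
suffice. They are found backwards: the prefix of the next state needed later determines how much of
the current state and answer is needed. -/
theorem exists_haltsFrom {f : Baire → Set Baire} (k : ℕ) (q : ℕ → Baire)
    (hq : IsFiniteRun f k q) (hs : IsSuccessful k q) :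
    ∃ n W, haltsFrom uw (pre (q 0) n) W = true := by
  induction k generalizing q with
  | zero =>
    exact ⟨1, [], zeroHead_eq_true.2 (by rw [pre_getElem?_eq one_pos, hs.1])⟩
  | succ k ih =>
    obtain ⟨n, W, hW⟩ := ih (fun i => q (i + 1)) (fun i hi => hq (i + 1) (by omega))
      ⟨hs.1, fun i hi => hs.2 (i + 1) (by omega)⟩
    obtain ⟨-, r, -, hr⟩ := mem_step.1 (hq 0 (by omega))
    obtain ⟨N, hN⟩ := exists_le_length_nextWord huw hr n
    refine ⟨N + 1, pre r N :: W, Bool.and_eq_true_iff.2 ⟨nonzeroHead_eq_true.2 ?_, ?_⟩⟩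
    · obtain ⟨m, hm⟩ := Nat.exists_eq_succ_of_ne_zero (hs.2 0 (by omega))
      exact ⟨m, by rw [pre_getElem?_eq (by omega), hm]⟩
    · refine haltsFrom_mono huw W ((isPrefixOf_pre _ _).prefix_of_le
        (isPrefixOf_nextWord huw (isPrefixOf_pre _ _) (isPrefixOf_pre _ _) hr) ?_) hW
      rw [length_pre]
      exact hN _ _ (isPrefixOf_pre _ _) (isPrefixOf_pre _ _) (by simp) (by simp)

end WordSimulation

/-! ### The parallelized diamond is reducible to the omega operation -/

/-- The answer prefixes coded by the number `c`. -/
def scheduleOf (c : ℕ) : List (List ℕ) :=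
  ((Encodable.decode c : Option (ℕ × List (List ℕ))).getD (0, [])).2

@[fun_prop] theorem computable_scheduleOf {α : Type*} [Primcodable α] {c : α → ℕ}
    (hc : Computable c) : Computable fun a => scheduleOf (c a) := by
  unfold scheduleOf
  fun_prop

/-- There is a computable partial function that finds, for every sequence of inputs of the diamond
operator, prefixes of answers that make the loops terminate. -/
theorem exists_schedule (f : Baire → Set Baire) : ∃ S : Baire →. Baire, ComputableFun S ∧
    ∀ y, (∀ i, component y i ∈ dom (diamond f)) →
      ∃ W ∈ S y, ∀ i, HaltsOn (component y i) (scheduleOf (W i)) := by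
  obtain ⟨uw, huw⟩ := exists_isUnivWord
  let len (c : ℕ) : ℕ := ((Encodable.decode c : Option (ℕ × List (List ℕ))).getD (0, [])).1
  -- `T y ⟨i, c⟩ = 0` says that `c` codes a prefix length and answer prefixes certifying termination
  -- of loop `i`; minimization then finds one for every `i`.
  let T : Baire → Baire := fun y idx =>
    bif haltsFrom uw (pre (component y idx.unpair.1) (len idx.unpair.2))
      (scheduleOf idx.unpair.2) then 0 else 1
  let col (u : List ℕ) (idx : ℕ) : List ℕ :=
    knownWord (fun k => u[Nat.pair idx.unpair.1 k]?) (len idx.unpair.2)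
  have hcol : Computable fun p : List ℕ × ℕ => col p.1 p.2 := by fun_prop
  have hT : ComputableMap T := by
    refine ComputableFun.of_approximates (h := fun u idx =>
      bif (col u idx).length == len idx.unpair.2 then
        some (bif haltsFrom uw (col u idx) (scheduleOf idx.unpair.2) then 0 else 1) else none)
      ?_ fun y q hq => ?_
    · have := computable_haltsFrom huw (α := List ℕ × ℕ) (u := fun p => col p.1 p.2)
        (W := fun p => scheduleOf p.2.unpair.2) hcol (by fun_prop)
      have h2 : Computable fun p : List ℕ × ℕ => len p.2.unpair.2 := by fun_prop
      fun_prop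
    · obtain rfl := Part.mem_some_iff.1 hq
      have hpre : ∀ n idx, IsPrefixOf (col (pre y n) idx) (component y idx.unpair.1) :=
        fun n idx => knownWord_isPrefixOf fun k m h => (eq_of_pre_getElem? h).2
      constructor
      · intro n idx m hm
        rcases hb : (col (pre y n) idx).length == len idx.unpair.2 with _ | _
        · simp [hb] at hm
        · simp only [hb, cond_true, Option.some_inj] at hm
          rw [← hm, (hpre n idx).eq_pre, beq_iff_eq.1 hb]
      · intro idx
        refine ⟨Nat.pair idx.unpair.1 (len idx.unpair.2), T y idx, ?_⟩
        have hl : (col (pre y (Nat.pair idx.unpair.1 (len idx.unpair.2))) idx).length =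
            len idx.unpair.2 :=
          knownWord_length_eq fun k hk =>
            ⟨_, pre_getElem?_eq (Nat.pair_lt_pair_right _ hk)⟩
        simp only [hl, beq_self_eq_true, cond_true]
        rw [(hpre _ idx).eq_pre, hl]
  refine ⟨fun y => minimize (T y), computableFun_minimize.comp_map hT, fun y hy => ?_⟩
  have hex : ∀ i, ∃ c, T y (Nat.pair i c) = 0 := by
    intro i
    obtain ⟨_, -, k, q, h0, hq, hs, -⟩ := hy i
    obtain ⟨n, W, hW⟩ := exists_haltsFrom huw k q hq hs
    refine ⟨Encodable.encode (n, W), ?_⟩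
    simp only [T, Nat.unpair_pair, len, scheduleOf, Encodable.encodek, Option.getD_some]
    rw [← h0, hW, cond_true]
  have hmin : ∀ i, ∃ c, T y (Nat.pair i c) = 0 ∧ ∀ c' < c, T y (Nat.pair i c') ≠ 0 := by
    classical
    exact fun i => ⟨Nat.find (hex i), Nat.find_spec (hex i), fun c hc => Nat.find_min (hex i) hc⟩
  choose W h0 h1 using hmin
  refine ⟨W, mem_minimize.2 fun i => ⟨h0 i, h1 i⟩, fun i => ?_⟩
  have h := h0 i
  simp only [T, Nat.unpair_pair] at h
  refine haltsOn_of_haltsFrom huw _ (isPrefixOf_pre (component y i) (len (W i))) ?_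
  by_contra hc
  rw [Bool.not_eq_true] at hc
  rw [hc] at h
  simp at h

/-! ### The loop that runs infinitely many loops one after the other

Its memory consists of a control digit (the number of the current loop and the remaining answer
prefixes), the current value of the current loop, all the initial values, and a schedule. -/

/-- The answer prefixes in the control digit `c`. -/
def pending (c : ℕ) : List (List ℕ) :=
  (Encodable.decode c.unpair.2 : Option (List (List ℕ))).getD []

/-- The control digit for the loop `i` with remaining answer prefixes `L`. -/
def control (i : ℕ) (L : List (List ℕ)) : ℕ := Nat.pair i (Encodable.encode L)

@[simp] theorem unpair_control_fst (i : ℕ) (L : List (List ℕ)) : (control i L).unpair.1 = i := by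
  simp [control]

@[simp] theorem pending_control (i : ℕ) (L : List (List ℕ)) : pending (control i L) = L := by
  simp [pending, control]

@[fun_prop] theorem computable_control {α : Type*} [Primcodable α] {i : α → ℕ}
    {L : α → List (List ℕ)} (hi : Computable i) (hL : Computable L) :
    Computable fun a => control (i a) (L a) := by
  unfold control
  fun_prop

@[fun_prop] theorem computable_pending {α : Type*} [Primcodable α] {c : α → ℕ}
    (hc : Computable c) : Computable fun a => pending (c a) := by
  unfold pending
  fun_prop

/-- The query asked with memory `m`. -/
def queryOf (m : Baire) : Baire := fun k =>
  -- With no prefix left the round only switches to the next loop. Its answer is ignored, but the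
  -- query must lie in the domain of `f`, hence the zero sequence.
  bif (pending (m 0)).length == 0 then 0 else second (first (tail m)) k

theorem computableMap_queryOf : ComputableMap queryOf :=
  ComputableMap.of_two_digits (fun _ => 0) (fun i _ => 4 * i + 3)
    (fun _ c d => bif (pending c).length == 0 then 0 else d) (by fun_prop) (by fun_prop)
    (by fun_prop) fun p i => by
      simp only [queryOf, second, first, tail]
      congr 2
      omega

/-- The memory when the loop number `v 0` is started. -/
def loadLoop (v : Baire) : Baire :=
  cons (control (v 0) (scheduleOf (second (tail v) (v 0))))
    (pair (component (first (tail v)) (v 0)) (tail v))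

theorem computableMap_loadLoop : ComputableMap loadLoop :=
  ComputableMap.of_two_digits (fun _ => 0)
    (fun i c => bif i == 0 then 2 * c + 2 else
      bif (i - 1) % 2 == 0 then 2 * Nat.pair c ((i - 1) / 2) + 1 else (i - 1) / 2 + 1)
    (fun i c d => bif i == 0 then control c (scheduleOf d) else d)
    (by fun_prop) (by fun_prop) (by fun_prop) fun p i => by
      rcases i with _ | i
      · rfl
      · simp only [loadLoop, cons, pair, component, first, tail, Nat.add_sub_cancel]
        by_cases h : i % 2 = 0
        · simp [h]
        · have hb : (i % 2 == 0) = false := by simpa using h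
          simp [h, hb]

/-- The answer `r` with its prefix replaced by `w`. -/
def overwrite (w : List ℕ) (r : Baire) : Baire := fun k => (w[k]?).getD (r k)

theorem isPrefixOf_overwrite (w : List ℕ) (r : Baire) : IsPrefixOf w (overwrite w r) :=
  isPrefixOf_iff_getElem?.2 fun i m h => by simp [overwrite, h]

theorem overwrite_eq {w : List ℕ} {r : Baire} {k : ℕ} (hk : w.length ≤ k) :
    overwrite w r k = r k := by
  simp [overwrite, List.getElem?_eq_none hk]

/-- The data to start the next loop with. -/
def loopSuccessor (z : Baire) : Baire :=
  cons ((first z 0).unpair.1 + 1) (second (tail (first z)))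

theorem computableMap_loopSuccessor : ComputableMap loopSuccessor :=
  ComputableMap.of_digit (fun i => bif i == 0 then 0 else 2 * (2 * (i - 1) + 2))
    (fun i m => bif i == 0 then m.unpair.1 + 1 else m) (by fun_prop) (by fun_prop)
    fun p i => by rcases i with _ | i <;> rfl

/-- The argument for the universal function in the next round of the current loop. -/
def roundArgument (z : Baire) : Baire :=
  pair (first (first (tail (first z))))
    (overwrite (((pending (first z 0))[0]?).getD []) (second z))

theorem computableMap_roundArgument : ComputableMap roundArgument :=
  ComputableMap.of_two_digits (fun _ => 0)
    (fun i _ => bif i % 2 == 0 then 2 * (4 * (i / 2) + 1) else 2 * (i / 2) + 1)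
    (fun i c d => bif i % 2 == 0 then d else ((((pending c)[0]?).getD [])[i / 2]?).getD d)
    (by fun_prop) (by fun_prop) (by fun_prop) fun p i => by
      by_cases h : i % 2 = 0
      · simp only [roundArgument, pair, first, tail, h, if_true, beq_self_eq_true, cond_true]
        congr 1; ring
      · have hb : (i % 2 == 0) = false := by simpa using h
        simp only [roundArgument, pair, if_neg h, hb, cond_false, overwrite]
        rfl

/-- The memory after one round of the current loop, with new value `second v`. -/
def roundMemory (v : Baire) : Baire :=
  cons (control (first (first v) 0).unpair.1 ((pending (first (first v) 0)).drop 1))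
    (pair (second v) (second (tail (first (first v)))))

theorem computableMap_roundMemory : ComputableMap roundMemory :=
  ComputableMap.of_digit
    (fun i => bif i == 0 then 0 else bif (i - 1) % 2 == 0 then 2 * ((i - 1) / 2) + 1 else
      4 * (2 * ((i - 1) / 2) + 2))
    (fun i c => bif i == 0 then control c.unpair.1 ((pending c).drop 1) else c)
    (by fun_prop) (by fun_prop) fun p i => by
      rcases i with _ | i
      · rfl
      · simp only [roundMemory, cons, pair, first, second, tail, Nat.add_sub_cancel]
        by_cases h : i % 2 = 0
        · simp [h]
        · have hb : (i % 2 == 0) = false := by simpa using h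
          simp only [if_neg h, hb, cond_false,
            show (i + 1 == 0) = false from rfl]
          congr 1; ring

/-- One round of the loop that runs infinitely many loops. -/
noncomputable def roundFun : Baire →. Baire := fun z =>
  (if ((pending (z 0)).length == 0) = true then Part.some (loadLoop (loopSuccessor z))
    else (univFun (roundArgument z)).map fun x => roundMemory (pair z x)).map
      fun m => pair m (queryOf m)

theorem computableFun_roundFun : ComputableFun roundFun := by
  have h1 : ComputableFun fun z => Part.some (loadLoop (loopSuccessor z)) :=
    computableMap_loadLoop.comp computableMap_loopSuccessor
  have h2 : ComputableFun fun z =>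
      (univFun (roundArgument z)).map fun x => roundMemory (pair z x) := by
    refine ((ComputableFun.pair computableMap_id
      (computableFun_univFun.comp_map computableMap_roundArgument)).map
        computableMap_roundMemory).mono fun z q hq => ?_
    obtain ⟨x, hx, rfl⟩ := (Part.mem_map_iff _).1 hq
    exact (Part.mem_map_iff _).2 ⟨pair z x, Part.mem_bind_iff.2 ⟨_, Part.mem_some _,
      (Part.mem_map_iff _).2 ⟨x, hx, rfl⟩⟩, rfl⟩
  exact ((h1.ite h2 0 (c := fun m => (pending m).length == 0) (by fun_prop)).map
    (computableMap_id.pair computableMap_queryOf))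

theorem queryOf_cons_nil (i : ℕ) (d : Baire) :
    queryOf (cons (control i []) d) = fun _ => 0 := by
  funext k; simp [queryOf]

theorem queryOf_cons_cons (i : ℕ) (w : List ℕ) (L : List (List ℕ)) (x e : Baire) :
    queryOf (cons (control i (w :: L)) (pair x e)) = second x := by
  funext k; simp [queryOf]

theorem mem_roundFun_nil {i : ℕ} {x y W r z : Baire} :
    z ∈ roundFun (pair (cons (control i [])
      (pair x (pair y W))) r) ↔
      z = pair (loadLoop (cons (i + 1) (pair y W)))
        (queryOf (loadLoop (cons (i + 1) (pair y W)))) := by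
  have h0 : ∀ m : Baire, pair m r 0 = m 0 := fun m => by simp [pair]
  simp only [roundFun, h0, cons_zero, pending_control, List.length_nil]
  rw [if_pos (by simp)]
  simp [loopSuccessor]

theorem mem_roundFun_cons {i : ℕ} {w : List ℕ} {L : List (List ℕ)} {x y W r z : Baire} :
    z ∈ roundFun (pair (cons (control i (w :: L)) (pair x (pair y W))) r) ↔
    ∃ x' ∈ univ (pair (first x) (overwrite w r)),
      z = pair (cons (control i L) (pair x' (pair y W)))
        (queryOf (cons (control i L) (pair x' (pair y W)))) := by
  have h0 : ∀ m : Baire, pair m r 0 = m 0 := fun m => by simp [pair]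
  simp only [roundFun, h0, cons_zero, pending_control, List.length_cons]
  rw [if_neg (by simp)]
  simp only [Part.mem_map_iff, mem_univFun]
  constructor
  · rintro ⟨_, ⟨x', hx', rfl⟩, rfl⟩
    refine ⟨x', by simpa [roundArgument] using hx', ?_⟩
    simp [roundMemory]
  · rintro ⟨x', hx', rfl⟩
    refine ⟨_, ⟨x', by simpa [roundArgument] using hx', rfl⟩, ?_⟩
    simp [roundMemory]

/-- The number of the current loop and the remaining answer prefixes after `t` rounds. -/
def controlSeq (W : Baire) : ℕ → ℕ × List (List ℕ)
  | 0 => (0, scheduleOf (W 0))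
  | t + 1 => match controlSeq W t with
    | (i, []) => (i + 1, scheduleOf (W (i + 1)))
    | (i, _ :: L) => (i, L)

/-- Each loop has a finite schedule and uses up one word per round, so every loop is completed. The
control sequence depends on `W` alone, hence is the same in all runs; this matters since the
components of the omega operation may stem from different runs. -/
theorem exists_controlSeq_nil (W : Baire) (i : ℕ) : ∃ t, controlSeq W t = (i, []) := by
  have key : ∀ (L : List (List ℕ)) (i t : ℕ), controlSeq W t = (i, L) →
      ∃ t, controlSeq W t = (i, []) := by
    intro L
    induction L with
    | nil => exact fun i t h => ⟨t, h⟩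
    | cons w L ih => exact fun i t h => ih i (t + 1) (by rw [controlSeq, h])
  induction i with
  | zero => exact key _ 0 0 rfl
  | succ i ih =>
    obtain ⟨t, ht⟩ := ih
    exact key _ (i + 1) (t + 1) (by rw [controlSeq, ht])

/-- The value `x` is reached by a finite run from `p` without termination before. -/
def IsReached (f : Baire → Set Baire) (p x : Baire) : Prop :=
  ∃ (k : ℕ) (q : ℕ → Baire), q 0 = p ∧ IsFiniteRun f k q ∧ (∀ i < k, q i 0 ≠ 0) ∧ q k = x

theorem isReached_refl (f : Baire → Set Baire) (p : Baire) : IsReached f p p :=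
  ⟨0, fun _ => p, rfl, fun i hi => absurd hi (by omega), fun i hi => absurd hi (by omega), rfl⟩

theorem IsReached.snoc {f : Baire → Set Baire} {p x x' : Baire} (h : IsReached f p x)
    (hx : x 0 ≠ 0) (hx' : x' ∈ step f x) : IsReached f p x' := by
  obtain ⟨k, q, h0, hq, hnz, rfl⟩ := h
  have hle : ∀ i ≤ k, (if i ≤ k then q i else x') = q i := fun i hi => if_pos hi
  refine ⟨k + 1, fun i => if i ≤ k then q i else x', by simpa using h0, fun i hi => ?_,
    fun i hi => ?_, by simp⟩
  · simp only [hle i (by omega)]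
    rcases Nat.lt_succ_iff_lt_or_eq.1 hi with hi | rfl
    · rw [hle _ hi]; exact hq i hi
    · simpa using hx'
  · simp only [hle i (by omega)]
    rcases Nat.lt_succ_iff_lt_or_eq.1 hi with hi | rfl
    · exact hnz i hi
    · exact hx

/-- Otherwise the run leading to `x` would stall. -/
theorem IsReached.mem_dom_step {f : Baire → Set Baire} {p x : Baire} (h : IsReached f p x)
    (hp : p ∈ diamondDom f) (hx : x 0 ≠ 0) : x ∈ dom (step f) := by
  obtain ⟨k, q, h0, hq, hnz, rfl⟩ := h
  by_contra hc
  refine hp.1 k q h0 hq ⟨hc, fun i hi => ?_⟩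
  rcases hi.lt_or_eq with hi | rfl
  · exact hnz i hi
  · exact hx

theorem IsReached.mem_diamond {f : Baire → Set Baire} {p x : Baire} (h : IsReached f p x)
    (hp : p ∈ diamondDom f) (hx : x 0 = 0) : x ∈ diamond f p := by
  obtain ⟨k, q, h0, hq, hnz, rfl⟩ := h
  exact ⟨hp, k, q, h0, hq, ⟨hx, hnz⟩, rfl⟩

/-- If the answers of `f` may be changed at finitely many places and `f` has an answer for the
zero sequence, then the parallelized diamond of `f` is reducible to its omega operation. -/
theorem parallel_diamond_le_omega {f : Baire → Set Baire}
    (hfin : ∀ p r w, r ∈ f p → overwrite w r ∈ f p) (hzero : (f fun _ => 0).Nonempty) :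
    StrongWeihrauchLE (parallel (diamond f)) (omega f) := by
  obtain ⟨S, hS, hSy⟩ := exists_schedule f
  obtain ⟨g, hgc, hgd, hg⟩ := exists_program computableFun_roundFun
  let start : Baire → Baire := fun m => pair (g m) (queryOf m)
  have hstart : ComputableMap start := hgc.pair computableMap_queryOf
  let K : Baire →. Baire := fun y => (S y).map fun W => start (loadLoop (cons 0 (pair y W)))
  have hK : ComputableFun K := by
    refine ((ComputableFun.pair computableMap_id hS).map (hstart.comp
      (computableMap_loadLoop.comp (computableMap_cons 0)))).mono fun y q hq => ?_
    obtain ⟨W, hW, rfl⟩ := (Part.mem_map_iff _).1 hq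
    exact (Part.mem_map_iff _).2 ⟨pair y W, Part.mem_bind_iff.2 ⟨_, Part.mem_some _,
      (Part.mem_map_iff _).2 ⟨W, hW, rfl⟩⟩, rfl⟩
  -- The power `n + 1` keeps the program of a state at stage `n`, from which the memory after `n`
  -- rounds is read. The index `0` is skipped.
  let mems : Baire → Baire := fun s => tuple fun n => memory (component s (n + 1))
  have hmems : ComputableMap mems :=
    ComputableMap.of_digit (fun i => Nat.pair (i.unpair.1 + 1) (4 * i.unpair.2))
      (fun _ m => decodeDigit m) (by fun_prop) (by fun_prop) fun p i => rfl
  let test : Baire → Baire := fun s idx =>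
    bif s (Nat.pair idx.unpair.2 0) == control idx.unpair.1 [] then 0 else 1
  have htest : ComputableMap test :=
    ComputableMap.of_digit (fun i => Nat.pair i.unpair.2 0)
      (fun i m => bif m == control i.unpair.1 [] then 0 else 1) (by fun_prop) (by fun_prop)
      fun p i => rfl
  let out : Baire → Baire := fun v =>
    tuple fun i => first (tail (component (second v) (first v i)))
  have hout : ComputableMap out :=
    ComputableMap.of_two_digits (fun i => 2 * i.unpair.1)
      (fun i m => 2 * Nat.pair m (2 * i.unpair.2 + 1) + 1) (fun _ _ d => d) (by fun_prop)
      (by fun_prop) (by fun_prop) fun p i => rfl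
  -- For each `i`, search for a round in which loop `i` has just finished and read the result from
  -- that component alone, so consistency between components is not needed.
  let H : Baire →. Baire := fun s =>
    (minimize (test (mems s))).map fun ν => out (pair ν (mems s))
  have hH : ComputableFun H := by
    refine ((ComputableFun.pair (computableFun_minimize.comp_map (htest.comp hmems))
      hmems).map hout).mono fun y q hq => ?_
    obtain ⟨ν, hν, rfl⟩ := (Part.mem_map_iff _).1 hq
    exact (Part.mem_map_iff _).2 ⟨pair ν (mems y), Part.mem_bind_iff.2 ⟨_, hν,
      (Part.mem_map_iff _).2 ⟨_, Part.mem_some _, rfl⟩⟩, rfl⟩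
  refine strongWeihrauchLE_of_computableFun hH hK fun y hy => ?_
  rw [mem_dom_parallel] at hy
  obtain ⟨W, hW, hWh⟩ := hSy y hy
  have hyd : ∀ i, component y i ∈ diamondDom f := fun i => dom_diamond f ▸ hy i
  -- The simulated value `x` is reached by a genuine run of the current loop, since overwritten
  -- answers are still answers of `f`, and the remaining prefixes are certain to make it terminate.
  let Inv (t : ℕ) (s : Baire) : Prop := ∃ x,
    s = start (cons (control (controlSeq W t).1 (controlSeq W t).2) (pair x (pair y W))) ∧
      HaltsOn x (controlSeq W t).2 ∧ IsReached f (component y (controlSeq W t).1) x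
  have hload : ∀ i, loadLoop (cons i (pair y W)) =
      cons (control i (scheduleOf (W i))) (pair (component y i) (pair y W)) := fun i => by
    simp [loadLoop]
  have hstep : ∀ t s, Inv t s → s ∈ dom (step f) ∧ ∀ s' ∈ step f s, Inv (t + 1) s' := by
    rintro t s ⟨x, rfl, hx, hr⟩
    rcases hc : controlSeq W t with ⟨i, _ | ⟨w, L⟩⟩
    · simp only [hc] at hx hr ⊢
      have hdef : ∀ m, ∀ r ∈ f (queryOf m), ∃ z, z ∈ roundFun
          (pair (cons (control i []) (pair x (pair y W))) r) :=
        fun m r _ => ⟨_, mem_roundFun_nil.2 rfl⟩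
      refine ⟨program_mem_dom_step hg ?_ (hdef _), fun s' hs' => ?_⟩
      · rw [queryOf_cons_nil]; exact hzero
      · obtain ⟨r, -, z, hz, rfl⟩ := exists_of_mem_step_program hg (hdef _) hs'
        rw [mem_roundFun_nil, hload] at hz
        refine ⟨component y (i + 1), ?_⟩
        simp only [controlSeq, hc, hz, first_pair, second_pair]
        exact ⟨rfl, hWh (i + 1), isReached_refl f _⟩
    · simp only [hc] at hx hr ⊢
      have hxd := IsReached.mem_dom_step hr (hyd i) hx.1
      have hdef : ∀ r ∈ f (queryOf (cons (control i (w :: L)) (pair x (pair y W)))),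
          ∃ z, z ∈ roundFun (pair (cons (control i (w :: L)) (pair x (pair y W))) r) := by
        intro r hr
        rw [queryOf_cons_cons] at hr
        obtain ⟨x', hx'⟩ := (Weihrauch.mem_dom_step.1 hxd).2 _ (hfin _ r w hr)
        exact ⟨_, mem_roundFun_cons.2 ⟨x', hx', rfl⟩⟩
      refine ⟨program_mem_dom_step hg ?_ hdef, fun s' hs' => ?_⟩
      · rw [queryOf_cons_cons]
        exact (Weihrauch.mem_dom_step.1 hxd).1
      · obtain ⟨r, hrf, z, hz, rfl⟩ := exists_of_mem_step_program hg hdef hs'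
        obtain ⟨x', hx', rfl⟩ := mem_roundFun_cons.1 hz
        rw [queryOf_cons_cons] at hrf
        refine ⟨x', ?_⟩
        simp only [controlSeq, hc, first_pair, second_pair]
        exact ⟨rfl, hx.2 _ (isPrefixOf_overwrite w r) _ hx',
          IsReached.snoc hr hx.1 (mem_step_of_mem_dom hxd (hfin _ r w hrf) hx')⟩
  have hinv : ∀ t, ∀ s ∈ stage f (start (loadLoop (cons 0 (pair y W)))) t, Inv t s := by
    intro t
    induction t with
    | zero =>
      rintro s rfl
      exact ⟨component y 0, by rw [hload]; rfl, hWh 0, isReached_refl f _⟩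
    | succ t ih =>
      rintro s' ⟨s, hs, hs'⟩
      exact (hstep t s (ih s hs)).2 s' hs'
  have hdom : ∀ t, stage f (start (loadLoop (cons 0 (pair y W)))) t ⊆ dom (step f) :=
    fun t s hs => (hstep t s (hinv t s hs)).1
  refine ⟨_, (Part.mem_map_iff _).2 ⟨W, hW, rfl⟩, mem_dom_omega.2 hdom, ?_⟩
  rintro _ ⟨z, hz, rfl⟩
  have hmem : ∀ t, ∃ x, component (mems (tuple z)) t =
      cons (control (controlSeq W t).1 (controlSeq W t).2) (pair x (pair y W)) ∧
        HaltsOn x (controlSeq W t).2 ∧ IsReached f (component y (controlSeq W t).1) x := by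
    intro t
    obtain ⟨s, hs, r, -, hzr⟩ := (mem_power_succ_of_dom hdom).1 (hz (t + 1))
    obtain ⟨x, rfl, h⟩ := hinv t s hs
    refine ⟨x, ?_, h⟩
    simp only [mems, component_tuple, hzr, start, first_pair]
    rw [memory_pair hgd]
  have htestz : ∀ i t, test (mems (tuple z)) (Nat.pair i t) = 0 ↔ controlSeq W t = (i, []) := by
    intro i t
    obtain ⟨x, hx, -⟩ := hmem t
    have h0 : mems (tuple z) (Nat.pair t 0) =
        control (controlSeq W t).1 (controlSeq W t).2 := congrFun hx 0
    simp only [test, Nat.unpair_pair, h0]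
    constructor
    · intro h
      have h1 : control (controlSeq W t).1 (controlSeq W t).2 = control i [] := by
        by_contra hc
        rw [beq_false_of_ne hc] at h
        simp at h
      refine Prod.ext ?_ ?_
      · rw [← unpair_control_fst (controlSeq W t).1 (controlSeq W t).2, h1, unpair_control_fst]
      · rw [← pending_control (controlSeq W t).1 (controlSeq W t).2, h1, pending_control]
    · intro h
      simp [h]
  have hmin : ∀ i, ∃ t, test (mems (tuple z)) (Nat.pair i t) = 0 ∧
      ∀ c < t, test (mems (tuple z)) (Nat.pair i c) ≠ 0 := by
    intro i
    have hex : ∃ t, test (mems (tuple z)) (Nat.pair i t) = 0 := by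
      obtain ⟨t, ht⟩ := exists_controlSeq_nil W i
      exact ⟨t, (htestz i t).2 ht⟩
    classical
    exact ⟨Nat.find hex, Nat.find_spec hex, fun c hc => Nat.find_min hex hc⟩
  choose ν hν hν' using hmin
  refine ⟨_, (Part.mem_map_iff _).2 ⟨ν, mem_minimize.2 fun i => ⟨hν i, hν' i⟩, rfl⟩, ?_⟩
  refine ⟨_, fun i => ?_, rfl⟩
  obtain ⟨x, hx, hh, hr⟩ := hmem (ν i)
  rw [(htestz i (ν i)).1 (hν i)] at hx hh hr
  rw [first_pair, second_pair, hx, tail_cons, first_pair]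
  exact IsReached.mem_diamond hr (hyd i) hh

/-! ### Turing reducibility -/

/-- A partial function defined at `p` only is enough, since nothing is required off the domain. -/
theorem turingLE_iff_exists_computableFun {p q : Baire} :
    TuringLE q p ↔ ∃ F, ComputableFun F ∧ q ∈ F p := by
  constructor
  · intro h
    obtain ⟨h, hh, -, H⟩ := h.exists_approximates
    refine ⟨fun p' => ⟨p' = p, fun _ => q⟩, ComputableFun.of_approximates hh ?_, rfl, rfl⟩
    rintro p' q' ⟨rfl, rfl⟩
    exact H
  · rintro ⟨F, hF, hq⟩
    exact hF.turingLE hq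

theorem TuringLE.refl (p : Baire) : TuringLE p p := TuringReducible.refl _

theorem TuringLE.trans {p q r : Baire} (h₁ : TuringLE p q) (h₂ : TuringLE q r) : TuringLE p r :=
  TuringReducible.trans h₁ h₂

theorem TuringLE.pair {p q r : Baire} (hp : TuringLE p r) (hq : TuringLE q r) :
    TuringLE (pair p q) r := by
  obtain ⟨F, hF, hp⟩ := turingLE_iff_exists_computableFun.1 hp
  obtain ⟨G, hG, hq⟩ := turingLE_iff_exists_computableFun.1 hq
  exact (ComputableFun.pair hF hG).turingLE
    (Part.mem_bind_iff.2 ⟨p, hp, (Part.mem_map_iff _).2 ⟨q, hq, rfl⟩⟩)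

theorem turingLE_of_computable {p : Baire} (hp : Computable p) (q : Baire) : TuringLE p q :=
  (computableMap_const hp).turingLE q

theorem computable_of_turingLE_zero {p : Baire} (h : TuringLE p fun _ => 0) : Computable p :=
  TuringReducible.partrec_of_const h

theorem computableMap_overwrite (w : List ℕ) : ComputableMap (overwrite w) :=
  ComputableMap.of_digit (fun i => i) (fun i m => (w[i]?).getD m) (by fun_prop) (by fun_prop)
    fun _ _ => rfl

theorem overwrite_pre_overwrite (w : List ℕ) (r : Baire) :
    overwrite (pre r w.length) (overwrite w r) = r := by
  funext k
  rcases Nat.lt_or_ge k w.length with h | h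
  · simp [overwrite, pre_getElem?_eq h]
  · rw [overwrite_eq (by simpa using h), overwrite_eq h]

theorem deg_eq_iff {p q : Baire} : deg p = deg q ↔ TuringLE p q ∧ TuringLE q p :=
  Quotient.eq

/-- Overwriting is undone by restoring the old prefix. This freedom serves twice: to impose
scheduled prefixes on answers and to run the finite extension argument. -/
theorem deg_overwrite (w : List ℕ) (r : Baire) : deg (overwrite w r) = deg r := by
  refine deg_eq_iff.2 ⟨(computableMap_overwrite w).turingLE r, ?_⟩
  have := (computableMap_overwrite (pre r w.length)).turingLE (overwrite w r)
  rwa [overwrite_pre_overwrite] at this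

/-! ### Sequences that avoid an upper cone -/

/-- Only countability is used; the enumeration itself need not be effective. -/
theorem exists_enumeration_approximations : ∃ e : ℕ → List ℕ → ℕ → Option ℕ,
    (∀ n, Computable fun p : List ℕ × ℕ => e n p.1 p.2) ∧
      ∀ h : List ℕ → ℕ → Option ℕ, (Computable fun p : List ℕ × ℕ => h p.1 p.2) → ∃ n, e n = h := by
  let A := {h : List ℕ → ℕ → Option ℕ // Computable fun p : List ℕ × ℕ => h p.1 p.2}
  let code : A → {f : ℕ → ℕ // Computable f} := fun ⟨h, hh⟩ =>
    ⟨fun n => Encodable.encode ((Encodable.decode n : Option (List ℕ × ℕ)).bind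
      fun p => h p.1 p.2), by
        have h2 : Computable fun z : ℕ × (List ℕ × ℕ) => h z.2.1 z.2.2 :=
          hh.comp Computable.snd
        fun_prop⟩
  have hcode : Function.Injective code := by
    rintro ⟨h, hh⟩ ⟨h', hh'⟩ heq
    obtain rfl : h = h' := funext fun u => funext fun i => by
      have := congrFun (Subtype.ext_iff.1 heq) (Encodable.encode (u, i))
      simpa only [code, Encodable.encodek, Option.bind_some, Encodable.encode_inj] using this
    rfl
  have : Countable A := hcode.countable
  have : Nonempty A := ⟨⟨fun _ _ => none, by fun_prop⟩⟩
  obtain ⟨e, he⟩ := exists_surjective_nat A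
  exact ⟨fun n => (e n).1, fun n => (e n).2, fun h hh => by
    obtain ⟨n, hn⟩ := he ⟨h, hh⟩
    exact ⟨n, congrArg Subtype.val hn⟩⟩

/-- The sequences of columns agree on the first `N` columns and on the first `l` digits of the
tuple. -/
def AgreeOn (N l : ℕ) (R R' : ℕ → Baire) : Prop :=
  ∀ i, i < l ∨ i.unpair.1 < N → tuple R i = tuple R' i

theorem AgreeOn.trans {N l : ℕ} {R R' R'' : ℕ → Baire} (h : AgreeOn N l R R')
    (h' : AgreeOn N l R' R'') : AgreeOn N l R R'' := fun i hi => (h i hi).trans (h' i hi)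

theorem AgreeOn.mono {N l N' l' : ℕ} {R R' : ℕ → Baire} (h : AgreeOn N l R R') (hN : N' ≤ N)
    (hl : l' ≤ l) : AgreeOn N' l' R R' := fun i hi => h i (by omega)

theorem AgreeOn.column_eq {N l : ℕ} {R R' : ℕ → Baire} (h : AgreeOn N l R R') {c : ℕ}
    (hc : c < N) : R c = R' c := by
  funext k
  have := h (Nat.pair c k) (Or.inr (by simpa using hc))
  simpa [tuple] using this

/-- If `A` is not reducible to `tuple R`, then the approximation `h` fails to produce `A` from
all the sequences that agree with a suitable finite modification of `R`. -/
theorem exists_agreeOn_not_approximates {A : Baire} {R : ℕ → Baire}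
    (hA : ¬ TuringLE A (tuple R)) (N l : ℕ) {h : List ℕ → ℕ → Option ℕ}
    (hh : Computable fun p : List ℕ × ℕ => h p.1 p.2) :
    ∃ R' l', l ≤ l' ∧ AgreeOn N l R R' ∧ TuringLE (tuple R') (tuple R) ∧
      ∀ R'', AgreeOn N l' R' R'' → ¬ Approximates h (tuple R'') A := by
  -- Either some admissible modification makes `h` output a wrong digit, and freezing the finite
  -- prefix used keeps it wrong; or `h` is never wrong, and then it cannot be total on any
  -- admissible modification.
  by_cases hc : ∃ R₁, AgreeOn N l R R₁ ∧ ∃ n i b, h (pre (tuple R₁) n) i = some b ∧ A i ≠ b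
  · obtain ⟨R₁, hR₁, n, i, b, hb, hne⟩ := hc
    refine ⟨component (overwrite (pre (tuple R₁) (max l n)) (tuple R)), max l n, le_max_left _ _,
      fun j hj => ?_, ?_, fun R'' hR'' hap => ?_⟩
    · rw [tuple_component]
      rcases Nat.lt_or_ge j (max l n) with hj' | hj'
      · rw [overwrite, pre_getElem?_eq hj', Option.getD_some]
        exact hR₁ j hj
      · rw [overwrite_eq (by simpa using hj')]
    · rw [tuple_component]
      exact (computableMap_overwrite _).turingLE _
    · refine hne (hap.1 n i b ?_)
      rw [← hb]
      congr 1
      refine pre_congr fun j hj => ?_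
      rw [← hR'' j (Or.inl (lt_of_lt_of_le hj (le_max_right _ _))), tuple_component, overwrite,
        pre_getElem?_eq (lt_of_lt_of_le hj (le_max_right _ _)), Option.getD_some]
  · refine ⟨R, l, le_rfl, fun _ _ => rfl, TuringLE.refl _, fun R'' hR'' hap => hA ?_⟩
    let fixed (i : ℕ) : Bool := !(Nat.ble l i) || !(Nat.ble N i.unpair.1)
    have hfixed : ∀ i, fixed i = true ↔ i < l ∨ i.unpair.1 < N := by
      intro i
      simp only [fixed, Bool.or_eq_true, Bool.not_eq_true', ← Bool.not_eq_true, Nat.ble_eq, not_le]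
    let known (u : List ℕ) (n : ℕ) : List (Option ℕ) :=
      listOf (fun i => bif fixed i then u[i]? else none) n
    have hknown : ∀ u v n, known u n = known v n →
        ∀ i < n, (i < l ∨ i.unpair.1 < N) → u[i]? = v[i]? := by
      intro u v n huv i hi hfi
      have := congrArg (fun L => L[i]?) huv
      simpa only [known, getElem?_listOf, if_pos hi, (hfixed i).2 hfi, cond_true,
        Option.some_inj] using this
    have hknown' : ∀ u v n, (∀ i < n, (i < l ∨ i.unpair.1 < N) → u[i]? = v[i]?) →
        known u n = known v n := by
      intro u v n huv
      refine List.map_congr_left fun i hi => ?_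
      rcases hfi : fixed i with _ | _
      · rfl
      · exact huv i (List.mem_range.1 hi) ((hfixed i).1 hfi)
    -- Search through all words `v` that agree with the given word at the frozen positions, and
    -- return the first digit that `h` outputs on one of them.
    let h' (u : List ℕ) (i : ℕ) : Option ℕ := firstSome (fun j =>
      (Encodable.decode j : Option (List ℕ)).bind fun v =>
        bif known u v.length == known v v.length then h v i else none) u.length
    have hh' : Computable fun p : List ℕ × ℕ => h' p.1 p.2 := by
      have h1 : Computable fun p : ((List ℕ × ℕ) × ℕ) × List ℕ => h p.2 p.1.1.2 :=
        hh.comp (g := fun p : ((List ℕ × ℕ) × ℕ) × List ℕ => (p.2, p.1.1.2)) (by fun_prop)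
      have h2 : Computable fun p : List ℕ × ℕ => known p.1 p.2 := by fun_prop
      have h3 : Computable fun p : ((List ℕ × ℕ) × ℕ) × List ℕ => known p.1.1.1 p.2.length :=
        h2.comp (g := fun p : ((List ℕ × ℕ) × ℕ) × List ℕ => (p.1.1.1, p.2.length)) (by fun_prop)
      have h4 : Computable fun p : ((List ℕ × ℕ) × ℕ) × List ℕ => known p.2 p.2.length :=
        h2.comp (g := fun p : ((List ℕ × ℕ) × ℕ) × List ℕ => (p.2, p.2.length)) (by fun_prop)
      refine computable_firstSome (by fun_prop) (computable_optionBind (by fun_prop) ?_)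
      exact computable_cond (computable_beq h3 h4) h1 (by fun_prop)
    refine turingLE_of_approximates hh' ⟨fun n i m hm => ?_, fun i => ?_⟩
    · obtain ⟨j, -, hj, -⟩ := firstSome_spec hm
      obtain ⟨v, -, hv⟩ := Option.bind_eq_some_iff.1 hj
      rcases hb : known (pre (tuple R) n) v.length == known v v.length with _ | _
      · simp [hb] at hv
      · rw [hb, cond_true] at hv
        by_contra hne
        refine hc ⟨component (overwrite v (tuple R)), fun i hi => ?_, v.length, i, m, ?_, hne⟩
        · rw [tuple_component]
          rcases Nat.lt_or_ge i v.length with hiv | hiv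
          · have := hknown _ _ _ (beq_iff_eq.1 hb) i hiv hi
            rw [List.getElem?_eq_getElem hiv] at this
            rw [overwrite, List.getElem?_eq_getElem hiv, Option.getD_some]
            exact (eq_of_pre_getElem? this).2
          · rw [overwrite_eq hiv]
        · rw [tuple_component, ← (isPrefixOf_overwrite v (tuple R)).eq_pre]
          exact hv
    · obtain ⟨n, m, hm⟩ := hap.2 i
      -- The prefix of `tuple R''` on which `h` answers is one of the candidates; the length must
      -- exceed its code and cover its frozen positions.
      refine ⟨max n (Encodable.encode (pre (tuple R'') n) + 1),
        firstSome_isSome (k := Encodable.encode (pre (tuple R'') n)) (m := m) (by simp) ?_⟩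
      rw [Encodable.encodek, Option.bind_some, hknown' _ (pre (tuple R'') n)]
      · simpa using hm
      · intro j hj hfj
        rw [length_pre] at hj
        rw [pre_getElem?_eq (lt_of_lt_of_le hj (le_max_left _ _)), pre_getElem?_eq hj, hR'' j hfj]

theorem turingLE_tuple_update {R : ℕ → Baire} {P r : Baire} (hR : TuringLE (tuple R) P)
    (hr : TuringLE r P) (N : ℕ) : TuringLE (tuple (Function.update R N r)) P := by
  let T : Baire → Baire := fun z i => bif i.unpair.1 == N then second z i.unpair.2 else first z i
  have hT : ComputableMap T :=
    ComputableMap.of_digit (fun i => bif i.unpair.1 == N then 2 * i.unpair.2 + 1 else 2 * i)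
      (fun _ m => m) (by fun_prop) (by fun_prop) fun p i => by
        rcases hb : i.unpair.1 == N with _ | _ <;> simp [T, hb, first, second]
  have h := (hT.turingLE (pair (tuple R) r)).trans (hR.pair hr)
  have heq : T (pair (tuple R) r) = tuple (Function.update R N r) := by
    funext i
    simp only [T, first_pair, second_pair]
    by_cases hi : i.unpair.1 = N
    · simp [tuple, hi]
    · rw [beq_false_of_ne hi]
      simp [tuple, Function.update_of_ne hi]
  rwa [heq] at h

/-- Suppose that the columns of a sequence are chosen one after the other, and that each of them
can be chosen below `P` and with any given prefix. If `A` is not reducible to `P`, then there is a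
choice such that `A` is not reducible to the whole sequence. -/
theorem exists_tuple_not_turingLE {A P : Baire} (hA : ¬ TuringLE A P)
    (C : ℕ → (ℕ → Baire) → Set Baire)
    (hC : ∀ c R R', (∀ c' < c, R c' = R' c') → C c R = C c R')
    (hex : ∀ c R, (∀ c' < c, R c' ∈ C c' R) → ∀ w, ∃ r ∈ C c R, TuringLE r P ∧ IsPrefixOf w r) :
    ∃ R : ℕ → Baire, (∀ c, R c ∈ C c R) ∧ ¬ TuringLE A (tuple R) := by
  obtain ⟨e, he, hesurj⟩ := exists_enumeration_approximations
  -- A finite stage: the first `N` columns are final and the first `l` digits of the tuple are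
  -- frozen. At every finite stage the tuple stays below `P`, although the limit need not.
  let Good (N : ℕ) (s : (ℕ → Baire) × ℕ) : Prop :=
    (∀ c < N, s.1 c ∈ C c s.1) ∧ TuringLE (tuple s.1) P
  have hstep : ∀ N (s : {s // Good N s}), ∃ s' : {s // Good (N + 1) s},
      s.1.2 ≤ s'.1.2 ∧ AgreeOn N s.1.2 s.1.1 s'.1.1 ∧
        ∀ R, AgreeOn (N + 1) s'.1.2 s'.1.1 R → ¬ Approximates (e N) (tuple R) A := by
    rintro N ⟨⟨R, l⟩, hval, hP⟩
    obtain ⟨R₁, l₁, hl₁, hag, hle, hnot⟩ :=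
      exists_agreeOn_not_approximates (fun h => hA (h.trans hP)) N l (he N)
    have hval₁ : ∀ c < N, R₁ c ∈ C c R₁ := fun c hc => by
      rw [← hC c R R₁ fun c' hc' => hag.column_eq (by omega), ← hag.column_eq hc]
      exact hval c hc
    -- The prescribed prefix of the new column protects the frozen digits: a position below `l₁` has
    -- its index within the column below `l₁`.
    obtain ⟨r, hr, hrP, hpre⟩ := hex N R₁ hval₁ (pre (R₁ N) l₁)
    have hag₂ : AgreeOn N l₁ R₁ (Function.update R₁ N r) := by
      intro i hi
      by_cases hiN : i.unpair.1 = N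
      · have hil : i.unpair.2 < l₁ := by
          have := Nat.unpair_right_le i
          omega
        simp only [tuple, hiN, Function.update_self]
        exact (isPrefixOf_iff_getElem?.1 hpre _ _ (pre_getElem?_eq hil)).symm
      · simp [tuple, Function.update_of_ne hiN]
    refine ⟨⟨⟨Function.update R₁ N r, l₁⟩, fun c hc => ?_,
      turingLE_tuple_update (hle.trans hP) hrP N⟩, hl₁, hag.trans (hag₂.mono le_rfl hl₁), ?_⟩
    · have h1 : C c (Function.update R₁ N r) = C c R₁ :=
        hC c _ _ fun c' hc' => by rw [Function.update_of_ne (by omega)]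
      simp only [h1]
      rcases Nat.lt_succ_iff_lt_or_eq.1 hc with hc | rfl
      · rw [Function.update_of_ne (by omega)]
        exact hval₁ c hc
      · rw [Function.update_self]
        exact hr
    · exact fun R' hR' => hnot R' (hag₂.trans (hR'.mono (by omega) le_rfl))
  choose next hnl hnag hnot using hstep
  have h0 : Good 0 (fun _ _ => 0, 0) :=
    ⟨fun c hc => absurd hc (by omega), turingLE_of_computable (Computable.const 0) P⟩
  let s : ∀ N, {s // Good N s} := fun N =>
    Nat.rec (motive := fun N => {s // Good N s}) ⟨_, h0⟩ (fun N s => next N s) N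
  have hag : ∀ N M, N ≤ M → (s N).1.2 ≤ (s M).1.2 ∧ AgreeOn N (s N).1.2 (s N).1.1 (s M).1.1 := by
    intro N M hNM
    induction M, hNM using Nat.le_induction with
    | base => exact ⟨le_rfl, fun _ _ => rfl⟩
    | succ M hM ih =>
      exact ⟨ih.1.trans (hnl M (s M)), ih.2.trans ((hnag M (s M)).mono hM ih.1)⟩
  -- Column `c` is final from stage `c + 1` on.
  let R : ℕ → Baire := fun c => (s (c + 1)).1.1 c
  have hR : ∀ N, AgreeOn N (s N).1.2 (s N).1.1 R := by
    intro N i hi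
    change (s N).1.1 i.unpair.1 i.unpair.2 = (s (i.unpair.1 + 1)).1.1 i.unpair.1 i.unpair.2
    rcases Nat.lt_or_ge i.unpair.1 N with h | h
    · rw [(hag (i.unpair.1 + 1) N h).2.column_eq (Nat.lt_succ_self _)]
    · exact (hag N (i.unpair.1 + 1) (by omega)).2 i hi
  refine ⟨R, fun c => ?_, fun hle => ?_⟩
  · have h1 := (s (c + 1)).2.1 c (Nat.lt_succ_self c)
    rwa [hC c _ R fun c' hc' => (hR (c + 1)).column_eq (by omega)] at h1
  · obtain ⟨h, hh, -, hap⟩ := hle.exists_approximates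
    obtain ⟨n, rfl⟩ := hesurj h hh
    exact hnot n (s n) R (hR (n + 1)) hap

/-! ### Values of the omega operation are computable from the answers -/

/-- The known part of the column `c` of the tuple with prefix `u`. -/
def columnWord (u : List ℕ) (c : ℕ) : List ℕ := knownWord (fun j => u[Nat.pair c j]?) u.length

@[fun_prop] theorem computable_columnWord {α : Type*} [Primcodable α] {u : α → List ℕ} {c : α → ℕ}
    (hu : Computable u) (hc : Computable c) : Computable fun a => columnWord (u a) (c a) := by
  unfold columnWord
  fun_prop

theorem isPrefixOf_columnWord (R : ℕ → Baire) (M c : ℕ) :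
    IsPrefixOf (columnWord (pre (tuple R) M) c) (R c) := by
  refine knownWord_isPrefixOf fun j m hm => ?_
  have := (eq_of_pre_getElem? hm).2
  simpa [tuple] using this

theorem le_length_columnWord (R : ℕ → Baire) {M c l : ℕ} (h : Nat.pair c l ≤ M) :
    l ≤ (columnWord (pre (tuple R) M) c).length := by
  refine le_length_knownWord (fun j hj => ?_) ?_
  · exact ⟨_, pre_getElem?_eq ((Nat.pair_lt_pair_right c hj).trans_le h)⟩
  · rw [length_pre]
    exact (Nat.right_le_pair c l).trans h

/-- The word of the state of a loop after `i` rounds that use the columns `pair n 0`, `pair n 1`,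
and so on, of the tuple with prefix `u` as answers. -/
def stateWord (uw : List ℕ → List ℕ) (k : ℕ → ℕ) (u : List ℕ) (n i : ℕ) : List ℕ :=
  (listOf (fun j => columnWord u (Nat.pair n j)) i).foldl (nextWord uw) (listOf k u.length)

theorem stateWord_succ (uw : List ℕ → List ℕ) (k : ℕ → ℕ) (u : List ℕ) (n i : ℕ) :
    stateWord uw k u n (i + 1) =
      nextWord uw (stateWord uw k u n i) (columnWord u (Nat.pair n i)) := by
  simp [stateWord, listOf, List.range_succ]

/-- Given `k` and the answers, the states are determined by iterating `U`. Simulating the rounds on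
words does this uniformly in `n`, and required lengths propagate backwards through the rounds. -/
theorem tuple_turingLE_tuple_answers {k : ℕ → ℕ} (hk : Computable k) {R : ℕ → Baire}
    {x : ℕ → ℕ → Baire} {z : ℕ → Baire} (h0 : ∀ n, x n 0 = k)
    (hx : ∀ n, ∀ i < n, x n (i + 1) ∈ univ (pair (first (x n i)) (R (Nat.pair n i))))
    (hz0 : z 0 = k) (hz : ∀ n, z (n + 1) = pair (first (x n n)) (R (Nat.pair n n))) :
    TuringLE (tuple z) (tuple R) := by
  obtain ⟨uw, huw⟩ := exists_isUnivWord
  have hpre : ∀ M n i, i ≤ n → IsPrefixOf (stateWord uw k (pre (tuple R) M) n i) (x n i) := by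
    intro M n i hi
    induction i with
    | zero => rw [h0]; exact isPrefixOf_pre _ _
    | succ i ih =>
      rw [stateWord_succ]
      exact isPrefixOf_nextWord huw (ih (by omega)) (isPrefixOf_columnWord _ _ _) (hx n i hi)
  have hlen : ∀ n i, i ≤ n → ∀ l, ∃ N, ∀ M ≥ N,
      l ≤ (stateWord uw k (pre (tuple R) M) n i).length := by
    intro n i hi
    induction i with
    | zero =>
      refine fun l => ⟨l, fun M hM => ?_⟩
      change l ≤ (listOf k (pre (tuple R) M).length).length
      simpa using hM
    | succ i ih =>
      intro l
      obtain ⟨N, hN⟩ := exists_le_length_nextWord huw (hx n i hi) l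
      obtain ⟨N', hN'⟩ := ih (by omega) N
      refine ⟨max N' (Nat.pair (Nat.pair n i) N), fun M hM => ?_⟩
      rw [stateWord_succ]
      exact hN _ _ (hpre M n i (by omega)) (isPrefixOf_columnWord _ _ _)
        (hN' M ((le_max_left _ _).trans hM))
        (le_length_columnWord R ((le_max_right _ _).trans hM))
  let W (u : List ℕ) (n : ℕ) : List ℕ :=
    interleave (evenPart (stateWord uw k u n n)) (columnWord u (Nat.pair n n))
  let h (u : List ℕ) (i : ℕ) : Option ℕ :=
    bif i.unpair.1 == 0 then some (k i.unpair.2) else (W u (i.unpair.1 - 1))[i.unpair.2]?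
  have hW : Computable fun p : List ℕ × ℕ => W p.1 p.2 := by
    have h1 : Computable fun p : (List ℕ × ℕ) × List ℕ × List ℕ => nextWord uw p.2.1 p.2.2 :=
      computable_nextWord huw (by fun_prop) (by fun_prop)
    have h2 : Computable fun p : List ℕ × ℕ => stateWord uw k p.1 p.2 p.2 := by
      unfold stateWord
      fun_prop
    fun_prop
  have hh : Computable fun p : List ℕ × ℕ => h p.1 p.2 := by
    have h1 : Computable fun p : List ℕ × ℕ => W p.1 (p.2.unpair.1 - 1) :=
      hW.comp (g := fun p : List ℕ × ℕ => (p.1, p.2.unpair.1 - 1)) (by fun_prop)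
    fun_prop
  have hWpre : ∀ M n, IsPrefixOf (W (pre (tuple R) M) n) (z (n + 1)) := fun M n => by
    rw [hz]
    exact isPrefixOf_interleave (isPrefixOf_evenPart (hpre M n n le_rfl))
      (isPrefixOf_columnWord _ _ _)
  refine turingLE_of_approximates hh ⟨fun M i m hm => ?_, fun i => ?_⟩
  · rcases hi : i.unpair.1 with _ | n
    · simp only [h, hi, beq_self_eq_true, cond_true, Option.some_inj] at hm
      simp only [tuple, hi, hz0, hm]
    · simp only [h, hi, beq_false_of_ne (Nat.succ_ne_zero n), cond_false,
        Nat.add_sub_cancel] at hm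
      simp only [tuple, hi]
      exact isPrefixOf_iff_getElem?.1 (hWpre M n) _ _ hm
  · rcases hi : i.unpair.1 with _ | n
    · exact ⟨0, k i.unpair.2, by simp only [h, hi, beq_self_eq_true, cond_true]⟩
    -- Only the even half of the state enters `z (n + 1)`, hence the factor 2.
    · obtain ⟨N, hN⟩ := hlen n n le_rfl (2 * (i.unpair.2 + 1))
      let M := max N (Nat.pair (Nat.pair n n) (i.unpair.2 + 1))
      have hl : i.unpair.2 < (W (pre (tuple R) M) n).length :=
        le_length_interleave (le_length_evenPart (hN M (le_max_left _ _)))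
          (le_length_columnWord R (le_max_right _ _))
      refine ⟨M, (W (pre (tuple R) M) n)[i.unpair.2], ?_⟩
      simp only [h, hi, beq_false_of_ne (Nat.succ_ne_zero n), cond_false, Nat.add_sub_cancel]
      exact List.getElem?_eq_getElem hl

/-! ### The problem on degrees -/

section DegreeProblem

theorem mem_realizerVersion {F : Degree → Set Degree} {x r : Baire} :
    r ∈ realizerVersion F x ↔ deg r ∈ F (deg x) := by
  constructor
  · rintro ⟨a, ha, b, hb, h⟩
    obtain rfl := Part.mem_some_iff.1 ha
    obtain rfl := Part.mem_some_iff.1 hb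
    exact h
  · exact fun h => ⟨_, Part.mem_some _, _, Part.mem_some _, h⟩

theorem overwrite_mem_realizerVersion {F : Degree → Set Degree} {x r : Baire} (w : List ℕ)
    (h : r ∈ realizerVersion F x) : overwrite w r ∈ realizerVersion F x :=
  mem_realizerVersion.2 (by rw [deg_overwrite]; exact mem_realizerVersion.1 h)

theorem TuringLE.of_deg_eq {x y : Baire} (h : deg x = deg y) : TuringLE x y := (deg_eq_iff.1 h).1

variable {p : ℕ → Baire}

theorem IsDescendingSequence.turingLE (hp : IsDescendingSequence p) {m n : ℕ} (h : n ≤ m) :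
    TuringLE (p m) (p n) := by
  induction m, h using Nat.le_induction with
  | base => exact TuringLE.refl _
  | succ m _ ih => exact (hp.1 m).1.trans ih

theorem IsDescendingSequence.le_of_turingLE (hp : IsDescendingSequence p) {m n : ℕ}
    (h : TuringLE (p m) (p n)) : n ≤ m := by
  by_contra hlt
  exact (hp.1 m).2 (h.trans (hp.turingLE (by omega : m + 1 ≤ n)))

theorem IsDescendingSequence.deg_injective (hp : IsDescendingSequence p) {m n : ℕ}
    (h : deg (p m) = deg (p n)) : m = n :=
  le_antisymm (hp.le_of_turingLE (.of_deg_eq h.symm)) (hp.le_of_turingLE (.of_deg_eq h))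

/-- A computable sequence has nothing strictly below it. -/
theorem IsDescendingSequence.deg_ne_zero (hp : IsDescendingSequence p) (n : ℕ) :
    deg (p n) ≠ deg fun _ => 0 := fun h =>
  (hp.1 n).2 ((TuringLE.of_deg_eq h).trans (turingLE_of_computable (Computable.const 0) _))

/-- The realizer version of the problem on degrees. -/
abbrev degreeRealizer (p : ℕ → Baire) : Baire → Set Baire := realizerVersion (degreeProblem p)

theorem deg_of_mem_degreeRealizer_zero (hp : IsDescendingSequence p) {x r : Baire}
    (hx : deg x = deg fun _ => 0) (hr : r ∈ degreeRealizer p x) : ∃ n, deg r = deg (p n) := by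
  rcases mem_realizerVersion.1 hr with ⟨h, -⟩ | ⟨n, h, -⟩ | ⟨-, h⟩
  · exact absurd (h.symm.trans hx) (hp.deg_ne_zero _)
  · exact absurd (h.symm.trans hx) (hp.deg_ne_zero _)
  · exact h

theorem deg_of_mem_degreeRealizer_succ (hp : IsDescendingSequence p) {x r : Baire} {n : ℕ}
    (hx : deg x = deg (p (n + 1))) (hr : r ∈ degreeRealizer p x) : deg r = deg (p n) := by
  rcases mem_realizerVersion.1 hr with ⟨h, -⟩ | ⟨m, h, h'⟩ | ⟨h, -⟩
  · exact absurd (hp.deg_injective (hx.symm.trans h)) (by omega)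
  · have := hp.deg_injective (hx.symm.trans h)
    obtain rfl : n = m := by omega
    exact h'
  · exact absurd (hx.symm.trans h) (hp.deg_ne_zero _)

/-- A degree in the domain of the problem. -/
def IsDomainDegree (p : ℕ → Baire) (a : Degree) : Prop :=
  a = deg (fun _ => 0) ∨ ∃ n, a = deg (p n)

theorem IsDomainDegree.nonempty {x : Baire} (h : IsDomainDegree p (deg x)) :
    (degreeRealizer p x).Nonempty := by
  rcases h with h | ⟨_ | n, h⟩
  · exact ⟨p 0, mem_realizerVersion.2 (Or.inr (Or.inr ⟨h, 0, rfl⟩))⟩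
  · exact ⟨p 0, mem_realizerVersion.2 (Or.inl ⟨h, rfl⟩)⟩
  · exact ⟨p n, mem_realizerVersion.2 (Or.inr (Or.inl ⟨n, h, rfl⟩))⟩

theorem isDomainDegree_of_mem {x r : Baire} (h : r ∈ degreeRealizer p x) :
    IsDomainDegree p (deg x) ∧ IsDomainDegree p (deg r) := by
  rcases mem_realizerVersion.1 h with ⟨h, h'⟩ | ⟨n, h, h'⟩ | ⟨h, n, h'⟩
  · exact ⟨Or.inr ⟨0, h⟩, Or.inr ⟨0, h'⟩⟩
  · exact ⟨Or.inr ⟨n + 1, h⟩, Or.inr ⟨n, h'⟩⟩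
  · exact ⟨Or.inl h, Or.inr ⟨n, h'⟩⟩

/-- One round need not climb more than one step. A computable query may be answered in `a_m`.
Otherwise the query has degree `a_j` with `j ≥ m + 1`, so its answer has degree `a_{j-1} ≤ a_m`. A
prefix can be imposed without changing the degree. -/
theorem exists_mem_degreeRealizer_turingLE (hp : IsDescendingSequence p) {x : Baire} {m : ℕ}
    (hx : (degreeRealizer p x).Nonempty) (hle : TuringLE x (p (m + 1))) (w : List ℕ) :
    ∃ r ∈ degreeRealizer p x, TuringLE r (p m) ∧ IsPrefixOf w r := by
  suffices h : ∃ r ∈ degreeRealizer p x, TuringLE r (p m) by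
    obtain ⟨r, hr, hle⟩ := h
    exact ⟨overwrite w r, overwrite_mem_realizerVersion w hr,
      ((computableMap_overwrite w).turingLE r).trans hle, isPrefixOf_overwrite w r⟩
  obtain ⟨y, hy⟩ := hx
  rcases (isDomainDegree_of_mem hy).1 with h | ⟨j, h⟩
  · exact ⟨p m, mem_realizerVersion.2 (Or.inr (Or.inr ⟨h, m, rfl⟩)), TuringLE.refl _⟩
  · have hj := hp.le_of_turingLE ((TuringLE.of_deg_eq h.symm).trans hle)
    obtain ⟨j, rfl⟩ : ∃ i, j = i + 1 := ⟨j - 1, by omega⟩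
    exact ⟨p j, mem_realizerVersion.2 (Or.inr (Or.inl ⟨j, h, rfl⟩)), hp.turingLE (by omega)⟩

/-! ### The inverse limit is not reducible to the omega operation -/

/-- There is a computable input for which each value of the inverse limit computes `p 0`. -/
theorem exists_computable_mem_dom_invLimit (hp : IsDescendingSequence p) :
    ∃ q₀, Computable q₀ ∧ q₀ ∈ dom (invLimit (degreeRealizer p)) ∧
      ∀ t ∈ invLimit (degreeRealizer p) q₀, TuringLE (p 0) t := by
  -- With the identity as transition, the memory is kept and the answer becomes the next query.
  obtain ⟨g, hg, -, hmem⟩ := exists_program (N := fun z => Part.some z) computableMap_id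
  have hmem' : ∀ m r y, y ∈ Part.some (pair m r) →
      pair (g (first y)) (second y) ∈ univ (pair (g m) r) := hmem
  let c := g fun _ => 0
  have hstep : ∀ q s, s ∈ step (degreeRealizer p) (pair c q) →
      ∃ r ∈ degreeRealizer p q, s = pair c r := by
    intro q s hs
    obtain ⟨r, hr, y, hy, hs⟩ := exists_of_mem_step_program (N := fun z => Part.some z) hmem'
      (fun r _ => ⟨_, Part.mem_some _⟩) hs
    obtain rfl := Part.mem_some_iff.1 hy
    exact ⟨r, hr, by rw [hs, first_pair, second_pair]⟩
  have hc : Computable (pair c fun _ => 0) := by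
    have h1 : ComputableMap fun q => pair (g q) q := hg.pair computableMap_id
    exact computable_of_turingLE_zero (h1.turingLE fun _ => 0)
  refine ⟨pair c fun _ => 0, hc, mem_dom_invLimit.2 fun i x hx => ?_, ?_⟩
  · obtain ⟨q, hq, rfl⟩ : ∃ q, IsDomainDegree p (deg q) ∧ x = pair c q := by
      induction i generalizing x with
      | zero => exact ⟨_, Or.inl rfl, hx⟩
      | succ i ih =>
        obtain ⟨x', hx', hs⟩ := hx
        obtain ⟨q, -, rfl⟩ := ih x' hx'
        obtain ⟨r, hr, rfl⟩ := hstep q x hs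
        exact ⟨r, (isDomainDegree_of_mem hr).2, rfl⟩
    exact program_mem_dom_step (N := fun z => Part.some z) hmem' hq.nonempty
      fun r _ => ⟨_, Part.mem_some _⟩
  · rintro t ⟨-, q, hq0, hq, rfl⟩
    have hrun : ∀ i, q i = pair c (second (q i)) ∧
        second (q (i + 1)) ∈ degreeRealizer p (second (q i)) := by
      have key : ∀ i, q i = pair c (second (q i)) → ∃ r ∈ degreeRealizer p (second (q i)),
          q (i + 1) = pair c r := fun i hi => hstep _ _ (hi ▸ hq i)
      have hform : ∀ i, q i = pair c (second (q i)) := by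
        intro i
        induction i with
        | zero => rw [hq0, second_pair]
        | succ i ih =>
          obtain ⟨r, -, hr⟩ := key i ih
          rw [hr, second_pair]
      refine fun i => ⟨hform i, ?_⟩
      obtain ⟨r, hr, h⟩ := key i (hform i)
      rwa [h, second_pair]
    -- From degree `a_n` the run has no choice and reaches `a_0` after `n` further rounds.
    have hdown : ∀ n i, deg (second (q i)) = deg (p n) → ∃ j, TuringLE (p 0) (second (q j)) := by
      intro n
      induction n with
      | zero => exact fun i hi => ⟨i, .of_deg_eq hi.symm⟩
      | succ n ih => exact fun i hi => ih (i + 1) (deg_of_mem_degreeRealizer_succ hp hi (hrun i).2)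
    obtain ⟨n, hn⟩ := deg_of_mem_degreeRealizer_zero hp (by rw [hq0, second_pair]) (hrun 0).2
    obtain ⟨j, hj⟩ := hdown n 1 hn
    have := (computableMap_second.comp (computableMap_component j)).turingLE (tuple q)
    rw [component_tuple] at this
    exact hj.trans this

/-- The state after `i` rounds of the `n`-th loop on `k` with the columns of `R` as answers. -/
noncomputable def loopState (k : Baire) (R : ℕ → Baire) (n : ℕ) : ℕ → Baire
  | 0 => k
  | i + 1 => Classical.epsilon fun x =>
      x ∈ univ (pair (first (loopState k R n i)) (R (Nat.pair n i)))

/-- Answers of one run occupy increasing columns, so a state depends on earlier columns only and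
columns can be chosen one after the other. -/
theorem loopState_congr {k : Baire} {R R' : ℕ → Baire} {n i : ℕ}
    (h : ∀ c < Nat.pair n i, R c = R' c) : loopState k R n i = loopState k R' n i := by
  induction i with
  | zero => rfl
  | succ i ih =>
    have hi := Nat.pair_lt_pair_right n (Nat.lt_succ_self i)
    rw [loopState, loopState, ih fun c hc => h c (hc.trans hi), h _ hi]

/-- On a computable input, the omega operation has a value that does not compute `p 0`. -/
theorem exists_mem_omega_not_turingLE (hp : IsDescendingSequence p) {k : Baire}
    (hk : Computable k) (hdom : k ∈ dom (omega (degreeRealizer p))) :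
    ∃ s ∈ omega (degreeRealizer p) k, ¬ TuringLE (p 0) s := by
  have hst := mem_dom_omega.1 hdom
  -- Column `⟨n, i⟩` is the answer in round `i` of the run for the power `n + 1`. Since `i ≤ n`, the
  -- bound is some `p j` with `j ≥ 1`, so `a_0` is not reached. Columns with `i > n` are not used.
  let C (c : ℕ) (R : ℕ → Baire) : Set Baire := {r | c.unpair.2 ≤ c.unpair.1 →
    r ∈ degreeRealizer p (second (loopState k R c.unpair.1 c.unpair.2)) ∧
      TuringLE r (p (c.unpair.1 + 1 - c.unpair.2))}
  have hinv : ∀ R n i, i ≤ n → (∀ c < Nat.pair n i, R c ∈ C c R) →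
      loopState k R n i ∈ stage (degreeRealizer p) k i ∧
        TuringLE (loopState k R n i) (p (n + 1 - i + 1)) ∧
        ∀ j < i, loopState k R n (j + 1) ∈
          univ (pair (first (loopState k R n j)) (R (Nat.pair n j))) := by
    intro R n i hi hR
    induction i with
    | zero => exact ⟨rfl, turingLE_of_computable hk _, fun j hj => absurd hj (by omega)⟩
    | succ i ih =>
      have hlt := Nat.pair_lt_pair_right n (Nat.lt_succ_self i)
      obtain ⟨h1, h2, h3⟩ := ih (by omega) fun c hc => hR c (hc.trans hlt)
      have hRi := hR _ hlt
      simp only [C, Set.mem_ofPred_eq, Nat.unpair_pair] at hRi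
      obtain ⟨hr, hrle⟩ := hRi (by omega)
      have hd := hst i h1
      have hu : loopState k R n (i + 1) ∈
          univ (pair (first (loopState k R n i)) (R (Nat.pair n i))) :=
        Classical.epsilon_spec ((mem_dom_step.1 hd).2 _ hr)
      refine ⟨⟨_, h1, mem_step_of_mem_dom hd hr hu⟩, ?_, fun j hj => ?_⟩
      · rw [show n + 1 - (i + 1) + 1 = n + 1 - i by omega]
        exact (computableFun_univFun.turingLE (mem_univFun.2 hu)).trans
          (((computableMap_first.turingLE _).trans (h2.trans (hp.turingLE (by omega)))).pair hrle)
      · rcases Nat.lt_succ_iff_lt_or_eq.1 hj with hj | rfl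
        · exact h3 j hj
        · exact hu
  -- Here the assumption that `p 0` is not computable from the tuple of the later members is used.
  obtain ⟨R, hR, hnot⟩ := exists_tuple_not_turingLE (P := tuple fun n => p (n + 1)) hp.2.2 C
    (fun c R R' h => by
      have := loopState_congr (k := k) (n := c.unpair.1) (i := c.unpair.2) (R := R) (R' := R')
        (by simpa using h)
      simp only [C, this])
    (fun c R hR w => by
      by_cases hc : c.unpair.2 ≤ c.unpair.1
      · obtain ⟨h1, h2, -⟩ := hinv R _ _ hc (by simpa using hR)
        obtain ⟨r, hr, hle, hw⟩ := exists_mem_degreeRealizer_turingLE hp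
          (mem_dom_step.1 (hst _ h1)).1 ((computableMap_second.turingLE _).trans h2) w
        refine ⟨r, fun _ => ⟨hr, hle⟩, hle.trans ?_, hw⟩
        have := (computableMap_component (c.unpair.1 - c.unpair.2)).turingLE
          (tuple fun n => p (n + 1))
        rwa [component_tuple, ← Nat.sub_add_comm hc] at this
      · exact ⟨overwrite w fun _ => 0, fun h => absurd h hc,
          ((computableMap_overwrite w).turingLE _).trans
            (turingLE_of_computable (Computable.const 0) _), isPrefixOf_overwrite _ _⟩)
  have hinv' := fun n => hinv R n n le_rfl fun c _ => hR c
  let z : ℕ → Baire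
    | 0 => k
    | n + 1 => pair (first (loopState k R n n)) (R (Nat.pair n n))
  refine ⟨tuple z, ⟨z, fun n => ?_, rfl⟩, fun h => hnot (h.trans ?_)⟩
  · rcases n with _ | n
    · exact rfl
    · have hRn := hR (Nat.pair n n)
      simp only [C, Set.mem_ofPred_eq, Nat.unpair_pair] at hRn
      exact (mem_power_succ_of_dom hst).2 ⟨_, (hinv' n).1, _, (hRn le_rfl).1, rfl⟩
  · exact tuple_turingLE_tuple_answers hk (x := loopState k R) (fun _ => rfl)
      (fun n => (hinv' n).2.2) rfl fun _ => rfl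

/-- A realizer of the omega operation may answer computable inputs by values that do not compute `p
0`. A reduction would send the computable `q₀` to a computable input and recover a sequence
computing `p 0` from such a value. -/
theorem not_invLimit_le_omega (hp : IsDescendingSequence p) :
    ¬ WeihrauchLE (invLimit (degreeRealizer p)) (omega (degreeRealizer p)) := by
  rintro ⟨H, K, hH, hK, hred⟩
  obtain ⟨q₀, hq₀, hdom, hval⟩ := exists_computable_mem_dom_invLimit hp
  have hex : ∀ k : Baire, ∃ G : Part Baire, (k ∈ dom (omega (degreeRealizer p)) →
      ∃ s ∈ G, s ∈ omega (degreeRealizer p) k) ∧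
        (Computable k → ∀ s ∈ G, ¬ TuringLE (p 0) s) := by
    intro k
    by_cases hk : k ∈ dom (omega (degreeRealizer p))
    · by_cases hc : Computable k
      · obtain ⟨s, hs, hnot⟩ := exists_mem_omega_not_turingLE hp hc hk
        refine ⟨Part.some s, fun _ => ⟨s, Part.mem_some _, hs⟩, fun _ s' hs' => ?_⟩
        rwa [Part.mem_some_iff.1 hs']
      · obtain ⟨s, hs⟩ := hk
        exact ⟨Part.some s, fun _ => ⟨s, Part.mem_some _, hs⟩, fun h => absurd h hc⟩
    · exact ⟨Part.none, fun h => absurd h hk, fun _ s hs => absurd hs (Part.notMem_none s)⟩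
  choose G hG hnot using hex
  have hreal : IsRealizer G (omega (degreeRealizer p)) := by
    intro k x hx hxdom
    obtain rfl := Part.mem_some_iff.1 hx
    obtain ⟨s, hs, h⟩ := hG x hxdom
    exact ⟨s, hs, s, Part.mem_some _, h⟩
  obtain ⟨t, ht, y, hy, hty⟩ := hred G hreal q₀ q₀ (Part.mem_some _) hdom
  obtain rfl := Part.mem_some_iff.1 hy
  obtain ⟨k, hk, ht⟩ := Part.mem_bind_iff.1 ht
  obtain ⟨r, hr, ht⟩ := Part.mem_bind_iff.1 ht
  have hkc : Computable k := computable_of_turingLE_zero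
    ((hK.turingLE hk).trans (turingLE_of_computable hq₀ _))
  exact hnot k hkc r hr ((hval y hty).trans ((hH.turingLE ht).trans
    ((turingLE_of_computable hq₀ r).pair (TuringLE.refl r))))

end DegreeProblem

/-! ### Existence of descending sequences -/

/-- The columns of `x` from the column `n` on. -/
def columnsFrom (x : Baire) (n : ℕ) : Baire := tuple fun j => component x (n + j)

theorem isOpen_of_cylinders {S : Set (ℕ → ℕ)}
    (h : ∀ x ∈ S, ∃ M, ∀ y : ℕ → ℕ, (∀ i < M, y i = x i) → y ∈ S) : IsOpen S := by
  refine isOpen_iff_forall_mem_open.2 fun x hx => ?_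
  obtain ⟨M, hM⟩ := h x hx
  refine ⟨⋂ i ∈ Finset.range M, {y : ℕ → ℕ | y i = x i}, fun y hy => hM y fun i hi => ?_,
    isOpen_biInter_finset fun i _ => (isOpen_discrete ({x i} : Set ℕ)).preimage
      (continuous_apply i : Continuous fun y : ℕ → ℕ => y i), ?_⟩
  · simpa using Set.mem_iInter₂.1 hy i (Finset.mem_range.2 hi)
  · simp

theorem exists_cylinder_subset {S : Set (ℕ → ℕ)} (hS : IsOpen S) {x : ℕ → ℕ} (hx : x ∈ S) :
    ∃ M, ∀ y : ℕ → ℕ, (∀ i < M, y i = x i) → y ∈ S := by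
  obtain ⟨I, u, hu, hsub⟩ := isOpen_pi_iff.1 hS x hx
  refine ⟨I.sup id + 1, fun y hy => hsub fun i hi => ?_⟩
  rw [hy i (Nat.lt_succ_of_le (Finset.le_sup (f := id) hi))]
  exact (hu i hi).2

/-- Baire category. The set `V (n, m)` on which approximation `m`, applied to the columns after `n`,
outputs a wrong digit of column `n` is open, and its union with its exterior is dense. A point in
all these unions works: near a point where the approximation succeeds, changing column `n` alone
makes it fail. -/
theorem exists_column_not_turingLE_columnsFrom :
    ∃ x : Baire, ∀ n, ¬ TuringLE (component x n) (columnsFrom x (n + 1)) := by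
  obtain ⟨e, -, he⟩ := exists_enumeration_approximations
  let V (a : ℕ × ℕ) : Set (ℕ → ℕ) := {x | ∃ N i b,
    e a.2 (pre (columnsFrom x (a.1 + 1)) N) i = some b ∧ component x a.1 i ≠ b}
  have hV : ∀ a, IsOpen (V a) := fun a => isOpen_of_cylinders <| by
    rintro x ⟨N, i, b, h, hne⟩
    refine ⟨max (Nat.pair a.1 i + 1)
      ((Finset.range N).sup (fun j => Nat.pair (a.1 + 1 + j.unpair.1) j.unpair.2) + 1),
      fun y hy => ⟨N, i, b, ?_, ?_⟩⟩
    · rw [← h]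
      congr 1
      refine pre_congr fun j hj => hy _ (lt_of_lt_of_le (Nat.lt_succ_of_le ?_) (le_max_right _ _))
      exact Finset.le_sup (f := fun j => Nat.pair (a.1 + 1 + j.unpair.1) j.unpair.2)
        (Finset.mem_range.2 hj)
    · rwa [component, hy _ (lt_of_lt_of_le (Nat.lt_succ_self _) (le_max_left _ _))]
  have hdense : Dense (⋂ a, (V a ∪ (closure (V a))ᶜ)) := by
    refine dense_iInter_of_isOpen (fun a => (hV a).union isClosed_closure.isOpen_compl)
      fun a x => ?_
    rw [closure_union]
    by_cases hx : x ∈ closure (V a)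
    · exact Or.inl hx
    · exact Or.inr (subset_closure hx)
  obtain ⟨x, hx⟩ := hdense.nonempty
  refine ⟨x, fun n hle => ?_⟩
  obtain ⟨h, hh, -, hap⟩ := hle.exists_approximates
  obtain ⟨m, rfl⟩ := he h hh
  rcases Set.mem_iInter.1 hx (n, m) with ⟨N, i, b, hb, hne⟩ | hxV
  · exact hne (hap.1 N i b hb)
  · obtain ⟨M, hM⟩ := exists_cylinder_subset isClosed_closure.isOpen_compl hxV
    -- Position `Nat.pair n M` lies outside the first `M` digits, so the modified point stays in the
    -- neighbourhood; the later columns, hence the output, are unchanged.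
    refine hM (Function.update x (Nat.pair n M) (x (Nat.pair n M) + 1)) (fun i hi => ?_)
      (subset_closure ?_)
    · have := Nat.right_le_pair n M
      rw [Function.update_of_ne (by omega)]
    · obtain ⟨N, b, hb⟩ := hap.2 M
      refine ⟨N, M, b, ?_, ?_⟩
      · rw [← hb]
        congr 1
        refine pre_congr fun j _ => ?_
        simp only [columnsFrom, tuple, component]
        rw [Function.update_of_ne]
        intro h
        have := congrArg (fun c => c.unpair.1) h
        simp only [Nat.unpair_pair] at this
        omega
      · rw [← hap.1 N M b hb]
        simp [component]

theorem turingLE_columnsFrom (x : Baire) (n : ℕ) :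
    TuringLE (tuple fun j => columnsFrom x (n + j)) (columnsFrom x n) := by
  let T : Baire → Baire := fun z i =>
    z (Nat.pair (i.unpair.1 + i.unpair.2.unpair.1) i.unpair.2.unpair.2)
  have hT : ComputableMap T := ComputableMap.of_digit
    (fun i => Nat.pair (i.unpair.1 + i.unpair.2.unpair.1) i.unpair.2.unpair.2) (fun _ m => m)
    (by fun_prop) (by fun_prop) fun _ _ => rfl
  have heq : (tuple fun j => columnsFrom x (n + j)) = T (columnsFrom x n) := by
    funext i
    simp [T, columnsFrom, tuple, add_assoc]
  rw [heq]
  exact hT.turingLE _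

/-- Take `p n` to be the columns of a generic `x` from `n` on: `p n` computes column `n`, while `p
(n + 1)` does not. The tuple of `p 1, p 2, …` only rearranges columns, so it is computable from `p
1` and cannot compute `p 0`. -/
theorem exists_isDescendingSequence : ∃ p : ℕ → Baire, IsDescendingSequence p := by
  obtain ⟨x, hx⟩ := exists_column_not_turingLE_columnsFrom
  have hle : ∀ n m, TuringLE (columnsFrom x (n + m)) (columnsFrom x n) := fun n m => by
    have := (computableMap_component m).turingLE (tuple fun j => columnsFrom x (n + j))
    rw [component_tuple] at this
    exact this.trans (turingLE_columnsFrom x n)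
  have hnot : ∀ n, ¬ TuringLE (columnsFrom x n) (columnsFrom x (n + 1)) := fun n h => by
    have := (computableMap_component 0).turingLE (columnsFrom x n)
    rw [columnsFrom, component_tuple] at this
    exact hx n (this.trans h)
  have htuple : TuringLE (tuple fun n => columnsFrom x (n + 1)) (columnsFrom x 1) := by
    simpa only [add_comm] using turingLE_columnsFrom x 1
  exact ⟨columnsFrom x, fun n => ⟨hle n 1, hnot n⟩, htuple.trans (hle 0 1),
    fun h => hnot 0 (h.trans htuple)⟩

end Weihrauch

/-! ### The main theorem -/

theorem mainTheorem8 :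
    (∃ p : ℕ → Weihrauch.Baire, Weihrauch.IsDescendingSequence p) ∧
    ∀ p : ℕ → Weihrauch.Baire, Weihrauch.IsDescendingSequence p →
      ¬ Weihrauch.WeihrauchLE
          (Weihrauch.invLimit (Weihrauch.realizerVersion (Weihrauch.degreeProblem p)))
          (Weihrauch.omega (Weihrauch.realizerVersion (Weihrauch.degreeProblem p))) ∧
      Weihrauch.StrongWeihrauchEquiv
        (Weihrauch.omega (Weihrauch.realizerVersion (Weihrauch.degreeProblem p)))
        (Weihrauch.parallel
          (Weihrauch.diamond (Weihrauch.realizerVersion (Weihrauch.degreeProblem p)))) ∧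
      Weihrauch.StrongWeihrauchLE
        (Weihrauch.parallel
          (Weihrauch.diamond (Weihrauch.realizerVersion (Weihrauch.degreeProblem p))))
        (Weihrauch.invLimit (Weihrauch.realizerVersion (Weihrauch.degreeProblem p))) ∧
      ¬ Weihrauch.WeihrauchLE
          (Weihrauch.invLimit (Weihrauch.realizerVersion (Weihrauch.degreeProblem p)))
          (Weihrauch.parallel
            (Weihrauch.diamond (Weihrauch.realizerVersion (Weihrauch.degreeProblem p)))) := by
  refine ⟨Weihrauch.exists_isDescendingSequence, fun p hp => ?_⟩
  -- Both hypotheses hold here: degrees ignore finite changes, and the degree of the zero sequence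
  -- lies in the domain.
  have hle := Weihrauch.parallel_diamond_le_omega
    (f := Weihrauch.realizerVersion (Weihrauch.degreeProblem p))
    (fun _ _ w hr => Weihrauch.overwrite_mem_realizerVersion w hr)
    ⟨p 0, Weihrauch.mem_realizerVersion.2 (Or.inr (Or.inr ⟨rfl, 0, rfl⟩))⟩
  exact ⟨Weihrauch.not_invLimit_le_omega hp, ⟨Weihrauch.omega_le_parallel_diamond _, hle⟩,
    hle.trans (Weihrauch.omega_le_invLimit _),
    fun h => Weihrauch.not_invLimit_le_omega hp (h.trans_strong hle)⟩
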